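/- **Setting.** Let $q_1,\dots,q_r$ be distinct primes, fix a sign $\pm$ and $\nu\in\mathbb Z^r$; for a positive integer $n$ coprime to all $q_i$ put $N=\pm n\prod_i q_i^{\nu_i}$. For a prime $\ell$ let $v=v_\ell$ be the valuation of $\mathbb Q_\ell$ and define the modified norm of $y\in\mathbb Q_\ell^\times$ by $|y|'_\ell=\ell^{-2\lfloor v(y)/2\rfloor}$ if $\ell\ne2$, while for $\ell=2$, with $y_0=y2^{-v(y)}$, $|y|'_2$ is $2^{-v(y)}$ if $v(y)$ is even and $y_0\equiv1\ (4)$, $2^{-v(y)+2}$ if $v(y)$ is even and $y_0\equiv3\ (4)$, and $2^{-v(y)+3}$ if $v(y)$ is odd. For $y=(y_i)\in\prod_i\mathbb Q_{q_i}$ write $|y^2-4N|'_q=\prod_i|y_i^2-4N|'_{q_i}$. Let $\omega_i(y_i)=\left(\frac{(y_i^2-4N)\,|y_i^2-4N|'_{q_i}}{q_i}\right)$ (Kronecker symbol) for $y_i^2\neq4N$; for $\epsilon=(\epsilon_i)\in\{0,\pm1\}^r$ let $Y_{\epsilon_i}=\{y_i\in\mathbb Q_{q_i}: y_i^2\ne4N,\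 \omega_i(y_i)=\epsilon_i\}$ and $Y_\epsilon=\prod_iY_{\epsilon_i}$. Let $X_0=\{x\in\mathbb R:x^2\mp1>0\}$, $X_1=\{x\in\mathbb R:x^2\mp1<0\}$. Put $\mathrm e(x)=e^{2\pi ix}$ for $x\in\mathbb R$, $\mathrm e_\ell(x)=\mathrm e(-\langle x\rangle_\ell)$ for $x\in\mathbb Q_\ell$, where $\langle x\rangle_\ell$ is the fractional part, and $\mathrm e_q(y)=\prod_i\mathrm e_{q_i}(y_i)$. Each $\mathbb Q_\ell$ carries the Haar measure with $\mathrm{vol}(\mathbb Z_\ell)=1$. **Hypotheses.** Let $\Phi$ be a smooth complex-valued function on $(0,\infty)$ all of whose derivatives decay rapidly at $+\infty$. Suppose that its Mellin transform $\widetilde\Phi$ converges absolutely in some right half-plane and has a meromorphic continuation to $\mathrm{Re}\,s>-2$, holomorphic except for at most a simple pole at $s=0$, and that $\widetilde\Phi(\sigma+it)$ is of rapid decay as $|t|\to\infty$, uniformly for $\sigma$ in compact subintervals of $(-2,\infty)$. Let $a_0,a_1,\dots,a_r\in\mathbb Z_{\ge-1}$. Let $\overline\varphi:\mathbb R\to\mathbb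 C$ agree on each of $X_0$, $X_1$ with a function in $C_c^\infty(\mathbb R)$ (in particular, $\overline\varphi\in C_c^\infty(\mathbb R)$ is allowed), let $\overline{\psi_i}$ be locally constant compactly supported functions on $\mathbb Q_{q_i}$ (only their restrictions to $Y_{\epsilon_i}$ matter), and put $$\varphi(x)=|x^2\mp1|^{a_0/2}\,\overline\varphi(x),\qquad \psi_i(y_i)=|y_i^2-4N|_{q_i}'^{\,a_i/2}\;\overline{\psi_i}(y_i).$$ For $C>0$, $\xi\in\mathbb R$, $\eta\in\prod_i\mathbb Q_{q_i}$ let $$\mathbf F_\epsilon(\xi,\eta)=\int_{\mathbb R}\int_{Y_\epsilon}\varphi(x)\prod_{i=1}^r\psi_i(y_i)\;\Phi\!\left(\frac{C}{|x^2\mp1|^{1/2}\,|y^2-4N|_q'^{\,1/2}}\right)\mathrm e(-x\xi)\,\mathrm e_q(-y\eta)\,dx\,dy .$$ **Theorem.** (1) The integral converges absolutely, and $$|\mathbf F_\epsilon(\xi,\eta)|\le K\,(1+|\xi|)^{-1-\frac{a_0}2}\prod_{i=1}^r(1+|\eta_i|_{q_i})^{-1-\frac{a_i}2},$$ where $K$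 depends only on $\Phi$, $\overline\varphi$, $\overline{\psi_i}$, $\epsilon$, $a_0,\dots,a_r$, $q_1,\dots,q_r$, $\pm$ and $\nu$, and not on $n$, $C$, $\xi$, $\eta$. (2) If moreover $a_0=0$ and $\overline\varphi\in C_c^\infty(\mathbb R)$, then for every $\varepsilon>0$ if $a_1,\dots,a_r\ge0$, and for every $\varepsilon>\frac13$ if some of $a_1,\dots,a_r$ is $-1$, $$|\mathbf F_\epsilon(\xi,\eta)|\le K\left[\Bigl(|C|^2\prod_{i=1}^r(1+|\eta_i|_{q_i})\Bigr)^{1-\varepsilon}+(1+|\xi|)^{-2}\right]\prod_{i=1}^r(1+|\eta_i|_{q_i})^{-1-\frac{a_i}2},$$ where $K$ depends only on $\varepsilon$ and the data listed in (1), and not on $n$, $C$, $\xi$, $\eta$. -/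

import Mathlib

open MeasureTheory Set Filter Asymptotics
open scoped Topology ContDiff

noncomputable section

namespace SemilocalFourier

/-! ### The field of `p`-adic numbers as a measure space -/

instance instMeasurableSpacePadic (p : ℕ) [Fact p.Prime] : MeasurableSpace ℚ_[p] := borel _

instance instBorelSpacePadic (p : ℕ) [Fact p.Prime] : BorelSpace ℚ_[p] := ⟨rfl⟩

/-- The compact set `ℤ_p ⊆ ℚ_p`, which has nonempty interior. -/
def padicUnitBall (p : ℕ) [Fact p.Prime] : TopologicalSpace.PositiveCompacts ℚ_[p] where
  carrier := Metric.closedBall 0 1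
  isCompact' := isCompact_closedBall 0 1
  interior_nonempty' :=
    ⟨0, interior_mono Metric.ball_subset_closedBall
      (by rw [Metric.isOpen_ball.interior_eq]; exact Metric.mem_ball_self one_pos)⟩

/-- The Haar measure on `ℚ_p` that gives `ℤ_p` volume `1`. -/
def padicHaar (p : ℕ) [Fact p.Prime] : Measure ℚ_[p] :=
  Measure.addHaarMeasure (padicUnitBall p)

instance instIsAddHaarPadicHaar (p : ℕ) [Fact p.Prime] : (padicHaar p).IsAddHaarMeasure :=
  inferInstanceAs (Measure.addHaarMeasure (padicUnitBall p)).IsAddHaarMeasure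

instance instSigmaFinitePadicHaar (p : ℕ) [Fact p.Prime] : SigmaFinite (padicHaar p) :=
  inferInstanceAs (SigmaFinite (Measure.addHaarMeasure (padicUnitBall p)))

/-! ### Additive characters -/

/-- `e(x) = exp(2πix)` for real `x`. -/
def eInf (x : ℝ) : ℂ := Complex.exp (2 * Real.pi * Complex.I * x)

/-- The fractional part `⟨x⟩_p = ∑_{n < 0} a_n p^n` of `x = ∑ a_n p^n ∈ ℚ_p` (digits
`0 ≤ a_n < p`).  With `k = max(0, -v(x))` the number `z = p^k x` is a `p`-adic integer, and
`z.appr k ∈ {0, …, p^k - 1}` is the sum of its first `k` digits. -/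
def padicFract (p : ℕ) [Fact p.Prime] (x : ℚ_[p]) : ℚ :=
  let k : ℕ := (-x.valuation).toNat
  let z : ℚ_[p] := (p : ℚ_[p]) ^ k * x
  if h : ‖z‖ ≤ 1 then (PadicInt.appr (⟨z, h⟩ : ℤ_[p]) k : ℚ) / (p : ℚ) ^ k else 0

/-- The additive character `e_p(x) = e(-⟨x⟩_p)` of `ℚ_p` (note the minus sign). -/
def ePadic (p : ℕ) [Fact p.Prime] (x : ℚ_[p]) : ℂ := eInf (-((padicFract p x : ℚ) : ℝ))

/-! ### The modified norm and the symbol `ω` -/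

/-- The integer `m` with `|y|'_p = p ^ m`, for `y ≠ 0`. -/
def modNormExp (p : ℕ) [Fact p.Prime] (y : ℚ_[p]) : ℤ :=
  if p = 2 then
    if Even y.valuation then
      -- `y₀ ≡ 1 (mod 4)`, resp. `y₀ ≡ 3 (mod 4)`, for the unit `y₀ = y * 2 ^ (-v(y))`
      if ‖y * (p : ℚ_[p]) ^ (-y.valuation) - 1‖ ≤ 1 / 4 then -y.valuation
      else -y.valuation + 2
    else -y.valuation + 3
  else -2 * (y.valuation / 2)

open Classical in
/-- The modified norm `|y|'_p`. -/
def modNorm (p : ℕ) [Fact p.Prime] (y : ℚ_[p]) : ℝ :=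
  if y = 0 then 0 else (p : ℝ) ^ modNormExp p y

/-- The Kronecker symbol `(x / p)` of a `p`-adic integer `x`: the Legendre symbol of `x mod p` if
`p` is odd; if `p = 2`, it is `0` for even `x`, `1` for `x ≡ ±1 (mod 8)` and `-1` for
`x ≡ ±3 (mod 8)`. -/
def kroneckerPadic (p : ℕ) [Fact p.Prime] (x : ℤ_[p]) : ℤ :=
  if p = 2 then ZMod.χ₈ ((PadicInt.appr x 3 : ℕ) : ZMod 8)
  else quadraticChar (ZMod p) (PadicInt.toZMod x)

/-- `ω(y) = ( D |D|'_p / p )` for `D = y² - 4N`; here `D |D|'_p` is a `p`-adic integer whenever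
`D ≠ 0`. -/
def omegaPadic (p : ℕ) [Fact p.Prime] (N : ℚ) (y : ℚ_[p]) : ℤ :=
  let D : ℚ_[p] := y ^ 2 - 4 * (N : ℚ_[p])
  let u : ℚ_[p] := D * (p : ℚ_[p]) ^ modNormExp p D
  if h : ‖u‖ ≤ 1 then kroneckerPadic p ⟨u, h⟩ else 0

/-- `Y_e = {y ∈ ℚ_p | y² ≠ 4N, ω(y) = e}`. -/
def regionY (p : ℕ) [Fact p.Prime] (N : ℚ) (e : ℤ) : Set ℚ_[p] :=
  {y | y ^ 2 ≠ 4 * (N : ℚ_[p]) ∧ omegaPadic p N y = e}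

/-- `X_0 = {x ∈ ℝ | x² ∓ 1 > 0}` and `X_1 = {x ∈ ℝ | x² ∓ 1 < 0}`, where `sgn = ±1`. -/
def regionX (sgn : ℤˣ) (i : Fin 2) : Set ℝ :=
  if i = 0 then {x | 0 < x ^ 2 - ((sgn : ℤ) : ℝ)} else {x | x ^ 2 - ((sgn : ℤ) : ℝ) < 0}

/-! ### Classes of functions -/

/-- The class `𝒮`: smooth functions on `(0, ∞)` all of whose derivatives decay rapidly at `+∞`. -/
def ClassS (Φ : ℝ → ℂ) : Prop :=
  ContDiffOn ℝ ∞ Φ (Ioi 0) ∧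
    ∀ k m : ℕ, iteratedDerivWithin k Φ (Ioi 0) =O[atTop] fun x : ℝ => x ^ (-(m : ℤ))

/-- `G` is a meromorphic continuation to `Re s > -2` of the Mellin transform of `Φ` (which
converges absolutely in some right half plane), with at most a simple pole at `s = 0` and no other
pole, and of rapid decay in vertical strips. -/
structure IsMellinContinuation (Φ : ℝ → ℂ) (G : ℂ → ℂ) : Prop where
  eq_mellin : ∃ A : ℝ, ∀ s : ℂ, A < s.re → MellinConvergent Φ s ∧ G s = mellin Φ s
  analyticAt : ∀ s : ℂ, -2 < s.re → s ≠ 0 → AnalyticAt ℂ G s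
  meromorphicAt_zero : MeromorphicAt G 0
  pole_zero : -1 ≤ meromorphicOrderAt G 0
  rapid_decay : ∀ (σ₁ σ₂ : ℝ) (k : ℕ), -2 < σ₁ → ∃ B : ℝ, ∀ s : ℂ, σ₁ ≤ s.re → s.re ≤ σ₂ →
    1 ≤ |s.im| → ‖G s‖ ≤ B * |s.im| ^ (-(k : ℤ))

/-- On each of the regions `X_0`, `X_1`, the function `φ` is smooth up to the boundary and has
bounded support: it is the restriction of a function in `C_c^∞(ℝ)`. -/
def SmoothUpToBoundary (sgn : ℤˣ) (φ : ℝ → ℂ) : Prop :=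
  ∀ i : Fin 2, ∃ g : ℝ → ℂ, ContDiff ℝ ∞ g ∧ HasCompactSupport g ∧ EqOn φ g (regionX sgn i)

/-! ### The Fourier transform -/

section Transform

variable {r : ℕ} (q : Fin r → ℕ) [∀ i, Fact (q i).Prime]

/-- `N = ± n q^ν = ± n ∏ q_i ^ ν_i`. -/
def bigN (sgn : ℤˣ) (ν : Fin r → ℤ) (n : ℕ) : ℚ :=
  ((sgn : ℤ) : ℚ) * (n : ℚ) * ∏ i, (q i : ℚ) ^ ν i

/-- `Y_e = Y_{e_1} × ⋯ × Y_{e_r}`. -/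
def regionYProd (N : ℚ) (e : Fin r → ℤ) : Set (∀ i, ℚ_[q i]) :=
  Set.univ.pi fun i => regionY (q i) N (e i)

/-- The integrand
`φ(x) ∏ ψ_i(y_i) Φ(C / (|x² ∓ 1|^{1/2} |y² - 4N|'_q^{1/2})) e(-xξ) e_q(-yη)`, where
`φ(x) = |x² ∓ 1|^{a₀/2} φ'(x)` and `ψ_i(y_i) = |y_i² - 4N|'^{a_i/2} ψ'_i(y_i)`. -/
def integrand (sgn : ℤˣ) (N : ℚ) (a₀ : ℤ) (a : Fin r → ℤ) (φ' : ℝ → ℂ)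
    (ψ' : ∀ i, ℚ_[q i] → ℂ) (Φ : ℝ → ℂ) (C ξ : ℝ) (η : ∀ i, ℚ_[q i])
    (x : ℝ) (y : ∀ i, ℚ_[q i]) : ℂ :=
  (((|x ^ 2 - ((sgn : ℤ) : ℝ)| ^ ((a₀ : ℝ) / 2) : ℝ) : ℂ) * φ' x) *
    (∏ i, (((modNorm (q i) (y i ^ 2 - 4 * (N : ℚ_[q i])) ^ ((a i : ℝ) / 2) : ℝ) : ℂ) *
      ψ' i (y i))) *
    Φ (C / (|x ^ 2 - ((sgn : ℤ) : ℝ)| ^ ((1 : ℝ) / 2) *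
      (∏ i, modNorm (q i) (y i ^ 2 - 4 * (N : ℚ_[q i]))) ^ ((1 : ℝ) / 2))) *
    eInf (-(x * ξ)) * ∏ i, ePadic (q i) (-(y i * η i))

/-- The measure `dx dy` on `ℝ × Y_e`. -/
def semilocalMeasure (N : ℚ) (e : Fin r → ℤ) : Measure (ℝ × (∀ i, ℚ_[q i])) :=
  (volume : Measure ℝ).prod
    ((Measure.pi fun i => padicHaar (q i)).restrict (regionYProd q N e))

/-- `𝐅_e(ξ, η)`, the integral of the integrand over `x ∈ ℝ` and `y ∈ Y_e`. -/
def fourierF (sgn : ℤˣ) (N : ℚ) (a₀ : ℤ) (a e : Fin r → ℤ) (φ' : ℝ → ℂ)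
    (ψ' : ∀ i, ℚ_[q i] → ℂ) (Φ : ℝ → ℂ) (C ξ : ℝ) (η : ∀ i, ℚ_[q i]) : ℂ :=
  ∫ x : ℝ, ∫ y in regionYProd q N e, integrand q sgn N a₀ a φ' ψ' Φ C ξ η x y
    ∂(Measure.pi fun i => padicHaar (q i))

end Transform

end SemilocalFourier

end

noncomputable section

namespace SemilocalFourier

/-! ### Inverse Mellin transforms and contour shifts -/

/-! The integral factors through one real parameter. Write Φ(e^u) = h(u). For a fixed `y` the
integral over `x` is an oscillatory integral with weight |x² ∓ 1|^(a₀/2) and amplitude h(l − log|x²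
∓ 1|/2), where l = log C − log|y² − 4N|'/2. All dependence on `C`, `n` and `y` sits in the shift
`l`, so every estimate uniform in `l` is uniform in these data.

Contour shifts of the inverse Mellin integral (`IsMellinContinuation.symbol`) show that h has
bounded derivatives of all orders, decays at every exponential rate at +∞, and tends at −∞ to a
constant c at every exponential rate b < 2. The pole at 0 is harmless for the derivatives of h,
because each d/du brings a factor s.

Archimedean side: near a zero of x² ∓ 1 the integrand behaves like a power dist^α times a bounded
symbol in log dist. Differentiating it costs one power of dist, while integrating the exponential
gains 1/|ξ|. Cutting at distance 1/|ξ| from the zeros and integrating by parts outside gives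
|ξ|^(−1−α), uniformly in `l` (`IsWeight.norm_integral_le`, `realTerm_fourier_bound`).

p-adic side: the modified norm and the symbol ω depend only on the discriminant D = y² − 4N up to a
small relative error. Where |D| is large compared with 1/|η|, a translation of `y` changes nothing
in the integrand except the additive character, which acquires a constant factor different from 1.
Such points contribute zero (`exists_translation`, `integral_eq_integral_indicator_of_translation`).
What remains is the set |D| ≪ 1/(1+|η|), over which |D|^s integrates to O((1+|η|)^(−1−s)) by a
volume estimate (`localFactor_bound`). `semilocal_bound` combines all primes, allowing an extra
factor bounded by a constant plus a power of |y² − 4N|'.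

Part (1) follows by inserting the uniform archimedean bound. For part (2) the archimedean integral
is compared with c times the Fourier transform of φ, which is O((1+|ξ|)^(−2)). The difference is
O(C^b m^(−b/2)) with m = |y² − 4N|'. If all a_i ≥ 0, take b = 2(1−ε). If some a_i = −1, the power
m^(−(1−ε)) may be too singular; the bound with b = 3(1−ε) is then averaged geometrically with the
trivial bound O((1+|ξ|)^(−1)), which leaves m^(−3(1−ε)/4), admissible exactly for ε > 1/3, and
Young's inequality separates the result. For ε ≥ 1 the decay of h at +∞ suffices. -/

/-- A smooth function on `ℝ` all of whose derivatives are bounded. -/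
def IsBoundedSymbol (h : ℝ → ℂ) : Prop :=
  ∃ H : ℕ → ℝ → ℂ, H 0 = h ∧ (∀ k u, HasDerivAt (H k) (H (k + 1) u) u) ∧
    ∀ k, ∃ K, ∀ u, ‖H k u‖ ≤ K

theorem isBoundedSymbol_const (c : ℂ) : IsBoundedSymbol fun _ => c := by
  refine ⟨fun k _ => if k = 0 then c else 0, by simp, fun k u => ?_, fun k => ⟨‖c‖, fun u => ?_⟩⟩
  · simpa using hasDerivAt_const u (if k = 0 then c else 0)
  · dsimp only
    split_ifs <;> simp

/-- The integrand of `(d/du)^k` of an inverse Mellin transform, in the variable `u = log x`. -/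
def mellinKernel (G : ℂ → ℂ) (k : ℕ) (u : ℝ) (s : ℂ) : ℂ :=
  (-s) ^ k * Complex.exp (-s * u) * G s

/-- The point `σ + it`. -/
def linePoint (σ t : ℝ) : ℂ := σ + t * Complex.I

theorem linePoint_re (σ t : ℝ) : (linePoint σ t).re = σ := by simp [linePoint]

theorem linePoint_im (σ t : ℝ) : (linePoint σ t).im = t := by simp [linePoint]

theorem continuous_linePoint (σ : ℝ) : Continuous (linePoint σ) := by
  unfold linePoint; fun_prop

theorem norm_mellinKernel (G : ℂ → ℂ) (k : ℕ) (u : ℝ) (s : ℂ) :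
    ‖mellinKernel G k u s‖ = Real.exp (-s.re * u) * (‖s‖ ^ k * ‖G s‖) := by
  simp only [mellinKernel, norm_mul, norm_pow, norm_neg, Complex.norm_exp]
  simp
  ring

theorem integrable_of_norm_le_inv_sq {f : ℝ → ℂ} (hf : Continuous f) {B : ℝ}
    (hB : ∀ t : ℝ, 1 ≤ |t| → ‖f t‖ ≤ B * |t| ^ (-2 : ℤ)) : Integrable f := by
  obtain ⟨B₀, hB₀⟩ := (isCompact_Icc (a := (-1 : ℝ)) (b := 1)).exists_bound_of_continuousOn
    hf.continuousOn
  refine (integrable_inv_one_add_sq.const_mul (2 * max B₀ B)).mono' hf.aestronglyMeasurable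
    (Eventually.of_forall fun t => ?_)
  have hB0 : 0 ≤ max B₀ B := le_max_of_le_left ((norm_nonneg _).trans (hB₀ 0 (by norm_num)))
  rcases le_total |t| 1 with h | h
  · have h1 := hB₀ t (abs_le.mp h)
    have h2 : t ^ 2 ≤ 1 := by rw [← sq_abs]; nlinarith [abs_nonneg t]
    have h3 : 1 / 2 ≤ (1 + t ^ 2)⁻¹ := by
      rw [one_div]; exact inv_anti₀ (by positivity) (by linarith)
    calc ‖f t‖ ≤ max B₀ B := h1.trans (le_max_left _ _)
      _ = 2 * max B₀ B * (1 / 2) := by ring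
      _ ≤ _ := by gcongr
  · have h1 := hB t h
    have h2 : 1 ≤ t ^ 2 := by rw [← sq_abs]; nlinarith [abs_nonneg t]
    have h3 : |t| ^ (-2 : ℤ) ≤ 2 * (1 + t ^ 2)⁻¹ := by
      rw [zpow_neg, show (2 : ℤ) = ((2 : ℕ) : ℤ) by rfl, zpow_natCast, sq_abs, ← div_eq_mul_inv,
        inv_eq_one_div, div_le_div_iff₀ (by positivity) (by positivity)]
      linarith
    calc ‖f t‖ ≤ B * |t| ^ (-2 : ℤ) := h1
      _ ≤ max B₀ B * |t| ^ (-2 : ℤ) := by gcongr; exact le_max_right _ _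
      _ ≤ max B₀ B * (2 * (1 + t ^ 2)⁻¹) := by gcongr
      _ = _ := by ring

/-- Continuity and rapid decay on the vertical line with real part `σ`. -/
structure RapidOnLine (G : ℂ → ℂ) (σ : ℝ) : Prop where
  cont : Continuous fun t => G (linePoint σ t)
  decay : ∀ k : ℕ, ∃ B : ℝ, ∀ t : ℝ, 1 ≤ |t| → ‖G (linePoint σ t)‖ ≤ B * |t| ^ (-(k : ℤ))

theorem norm_le_of_one_le_abs_im (s : ℂ) (hs : 1 ≤ |s.im|) : ‖s‖ ≤ (|s.re| + 1) * |s.im| := by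
  refine (Complex.norm_le_abs_re_add_abs_im s).trans ?_
  nlinarith [abs_nonneg s.re]

/-- The factor |s|^k is absorbed by asking for k + 2 powers of decay; the two left over give
integrability along the line. -/
theorem norm_pow_mul_le {s : ℂ} (hs : 1 ≤ |s.im|) {k : ℕ} {g B M : ℝ} (hg : 0 ≤ g)
    (hM : |s.re| ≤ M) (hB : g ≤ B * |s.im| ^ (-((k + 2 : ℕ) : ℤ))) :
    ‖s‖ ^ k * g ≤ (M + 1) ^ k * B * |s.im| ^ (-2 : ℤ) := by
  have h0 : (0 : ℝ) < |s.im| := by linarith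
  have hM0 : 0 ≤ M := (abs_nonneg _).trans hM
  calc ‖s‖ ^ k * g ≤ ((M + 1) * |s.im|) ^ k * (B * |s.im| ^ (-((k + 2 : ℕ) : ℤ))) := by
        gcongr
        exact (norm_le_of_one_le_abs_im s hs).trans (by gcongr)
    _ = (M + 1) ^ k * B * (|s.im| ^ (k : ℤ) * |s.im| ^ (-((k + 2 : ℕ) : ℤ))) := by
        rw [mul_pow, zpow_natCast]; ring
    _ = _ := by
        rw [← zpow_add₀ h0.ne']
        congr 2
        push_cast
        ring

namespace RapidOnLine

variable {G : ℂ → ℂ} {σ : ℝ}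

theorem integrable_mellinKernel (h : RapidOnLine G σ) (k : ℕ) (u : ℝ) :
    Integrable fun t => mellinKernel G k u (linePoint σ t) := by
  obtain ⟨B, hB⟩ := h.decay (k + 2)
  refine integrable_of_norm_le_inv_sq (B := Real.exp (-σ * u) * ((|σ| + 1) ^ k * B)) ?_
    fun t ht => ?_
  · have h1 := continuous_linePoint σ
    exact ((h1.neg.pow k).mul (Complex.continuous_exp.comp (h1.neg.mul continuous_const))).mul h.cont
  · rw [norm_mellinKernel, linePoint_re, mul_assoc]
    refine mul_le_mul_of_nonneg_left ?_ (Real.exp_nonneg _)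
    have := norm_pow_mul_le (s := linePoint σ t) (k := k) (by rwa [linePoint_im])
      (norm_nonneg (G (linePoint σ t))) (M := |σ|) (B := B) (by rw [linePoint_re])
      (by rw [linePoint_im]; exact hB t ht)
    rwa [linePoint_im] at this

theorem integrable_norm_pow (h : RapidOnLine G σ) (k : ℕ) :
    Integrable fun t => ‖linePoint σ t‖ ^ k * ‖G (linePoint σ t)‖ := by
  simpa [norm_mellinKernel] using (h.integrable_mellinKernel k 0).norm

/-- Differentiation under the integral sign: each d/du brings down a factor −s, which rapid decay
absorbs. The dominating function is uniform for parameters within distance 1 of `u`. -/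
theorem hasDerivAt_integral (h : RapidOnLine G σ) (k : ℕ) (u : ℝ) :
    HasDerivAt (fun u => ∫ t, mellinKernel G k u (linePoint σ t))
      (∫ t, mellinKernel G (k + 1) u (linePoint σ t)) u := by
  refine (hasDerivAt_integral_of_dominated_loc_of_deriv_le
    (F' := fun u t => mellinKernel G (k + 1) u (linePoint σ t)) (Metric.ball_mem_nhds u one_pos)
    (bound := fun t => Real.exp (|σ| * (|u| + 1)) *
      (‖linePoint σ t‖ ^ (k + 1) * ‖G (linePoint σ t)‖))
    (Eventually.of_forall fun v => (h.integrable_mellinKernel k v).aestronglyMeasurable)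
    (h.integrable_mellinKernel k u) (h.integrable_mellinKernel (k + 1) u).aestronglyMeasurable
    (Eventually.of_forall fun t v hv => ?_) ((h.integrable_norm_pow (k + 1)).const_mul _)
    (Eventually.of_forall fun t v _ => ?_)).2
  · rw [norm_mellinKernel, linePoint_re]
    refine mul_le_mul_of_nonneg_right (Real.exp_le_exp.2 ?_) (by positivity)
    have h1 : |v| ≤ |u| + 1 := by
      rw [Metric.mem_ball, Real.dist_eq] at hv
      have := abs_sub_abs_le_abs_sub v u
      linarith
    calc -σ * v ≤ |-σ * v| := le_abs_self _
      _ = |σ| * |v| := by rw [abs_mul, abs_neg]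
      _ ≤ _ := by gcongr
  · have h1 : HasDerivAt (fun x : ℝ => -linePoint σ t * (x : ℂ)) (-linePoint σ t) v := by
      simpa using (Complex.ofRealCLM.hasDerivAt (x := v)).const_mul (-linePoint σ t)
    have h2 := (h1.cexp.const_mul ((-linePoint σ t) ^ k)).mul_const (G (linePoint σ t))
    refine h2.congr_deriv ?_
    simp only [mellinKernel, pow_succ]
    ring

end RapidOnLine

/-- The parameter `u` enters the modulus of the kernel only through the factor exp(−σu), which is
constant along the line. The choice of the line is thus the choice of an exponential rate. -/
theorem norm_integral_mellinKernel_le (G : ℂ → ℂ) (σ : ℝ) (k : ℕ) :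
    ∃ K, 0 ≤ K ∧ ∀ u, ‖∫ t, mellinKernel G k u (linePoint σ t)‖ ≤ K * Real.exp (-σ * u) := by
  refine ⟨∫ t, ‖linePoint σ t‖ ^ k * ‖G (linePoint σ t)‖,
    integral_nonneg fun t => by positivity, fun u => ?_⟩
  refine (norm_integral_le_integral_norm _).trans (le_of_eq ?_)
  simp_rw [norm_mellinKernel, linePoint_re]
  rw [integral_const_mul, mul_comm]

/-- Two vertical integrals agree if the function is holomorphic on the strip between them and
decays quadratically there. -/
theorem integral_line_eq {F : ℂ → ℂ} {σ₁ σ₂ B : ℝ} (hσ : σ₁ ≤ σ₂)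
    (hF : ∀ s : ℂ, σ₁ ≤ s.re → s.re ≤ σ₂ → DifferentiableAt ℂ F s)
    (hB : ∀ s : ℂ, σ₁ ≤ s.re → s.re ≤ σ₂ → 1 ≤ |s.im| → ‖F s‖ ≤ B * |s.im| ^ (-2 : ℤ)) :
    ∫ t, F (linePoint σ₁ t) = ∫ t, F (linePoint σ₂ t) := by
  have hint : ∀ σ, σ₁ ≤ σ → σ ≤ σ₂ → Integrable fun t => F (linePoint σ t) := by
    intro σ h1 h2
    refine integrable_of_norm_le_inv_sq (B := B) ?_ fun t ht => ?_
    · refine continuous_iff_continuousAt.2 fun t => ?_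
      exact ContinuousAt.comp (f := linePoint σ)
        (hF _ (by rwa [linePoint_re]) (by rwa [linePoint_re])).continuousAt
        (continuous_linePoint σ).continuousAt
    · have := hB (linePoint σ t) (by rwa [linePoint_re]) (by rwa [linePoint_re])
        (by rwa [linePoint_im])
      rwa [linePoint_im] at this
  have hlim : ∀ σ, σ₁ ≤ σ → σ ≤ σ₂ → Tendsto (fun T : ℝ => ∫ t in (-T)..T, F (linePoint σ t)) atTop
      (𝓝 (∫ t, F (linePoint σ t))) := fun σ h1 h2 =>
    intervalIntegral_tendsto_integral (hint σ h1 h2) tendsto_neg_atTop_atBot tendsto_id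
  have hhor : ∀ ε : ℝ, ε = 1 ∨ ε = -1 →
      Tendsto (fun T : ℝ => ∫ x in σ₁..σ₂, F (x + (ε * T : ℝ) * Complex.I)) atTop (𝓝 0) := by
    -- The sign `ε` treats the upper and lower horizontal sides together; both vanish in the limit
    -- by the quadratic decay.
    intro ε hε
    have habs : |ε| = 1 := by rcases hε with rfl | rfl <;> simp
    have h1 : Tendsto (fun T : ℝ => B * |T| ^ (-2 : ℤ) * |σ₂ - σ₁|) atTop (𝓝 0) := by
      have : Tendsto (fun T : ℝ => |T| ^ (-2 : ℤ)) atTop (𝓝 0) :=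
        (tendsto_zpow_atTop_zero (by norm_num)).comp tendsto_abs_atTop_atTop
      simpa using (this.const_mul B).mul_const |σ₂ - σ₁|
    refine squeeze_zero_norm' ?_ h1
    filter_upwards [eventually_ge_atTop 1] with T hT
    refine intervalIntegral.norm_integral_le_of_norm_le_const fun x hx => ?_
    rw [uIoc_of_le hσ] at hx
    have him : |(x + (ε * T : ℝ) * Complex.I : ℂ).im| = |T| := by simp [abs_mul, habs]
    have := hB (x + (ε * T : ℝ) * Complex.I) (by simpa using hx.1.le) (by simpa using hx.2)
      (by rw [him]; exact hT.trans (le_abs_self T))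
    rwa [him] at this
  have hrect : ∀ T : ℝ, (∫ x in σ₁..σ₂, F (x + ((-1) * T : ℝ) * Complex.I)) -
      (∫ x in σ₁..σ₂, F (x + (1 * T : ℝ) * Complex.I)) +
      Complex.I • (∫ t in (-T)..T, F (linePoint σ₂ t)) -
      Complex.I • (∫ t in (-T)..T, F (linePoint σ₁ t)) = 0 := by
    intro T
    have := Complex.integral_boundary_rect_eq_zero_of_differentiableOn F (linePoint σ₁ (-T))
      (linePoint σ₂ T) (fun s hs => by
        simp only [linePoint_re, linePoint_im, uIcc_of_le hσ, Complex.mem_reProdIm] at hs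
        exact (hF s hs.1.1 hs.1.2).differentiableWithinAt)
    simp only [linePoint_re, linePoint_im] at this
    simpa only [neg_one_mul, one_mul, linePoint] using this
  have hl := (((hhor (-1) (Or.inr rfl)).sub (hhor 1 (Or.inl rfl))).add
    ((hlim σ₂ hσ le_rfl).const_smul Complex.I)).sub ((hlim σ₁ le_rfl hσ).const_smul Complex.I)
  have h0 := tendsto_nhds_unique (hl.congr hrect) tendsto_const_nhds
  rw [sub_zero, zero_add, ← smul_sub, smul_eq_zero] at h0
  exact (sub_eq_zero.1 (h0.resolve_left Complex.I_ne_zero)).symm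

/-! ### Contour shifts past the possible pole at 0. -/

namespace IsMellinContinuation

variable {Φ : ℝ → ℂ} {G : ℂ → ℂ}

theorem rapidOnLine (hG : IsMellinContinuation Φ G) {σ : ℝ} (hσ : -2 < σ) (hσ0 : σ ≠ 0) :
    RapidOnLine G σ where
  cont := by
    refine continuous_iff_continuousAt.2 fun t => ?_
    refine ContinuousAt.comp (f := linePoint σ)
      (hG.analyticAt _ (by rwa [linePoint_re]) fun h => hσ0 ?_).continuousAt
      (continuous_linePoint σ).continuousAt
    rw [← linePoint_re σ t, h, Complex.zero_re]
  decay k := by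
    obtain ⟨B, hB⟩ := hG.rapid_decay σ σ k hσ
    refine ⟨B, fun t ht => ?_⟩
    have := hB (linePoint σ t) (by rw [linePoint_re]) (by rw [linePoint_re]) (by rwa [linePoint_im])
    rwa [linePoint_im] at this

/-- The zero of `s` cancels the pole of the continuation. -/
theorem exists_entire_mul (hG : IsMellinContinuation Φ G) :
    ∃ H : ℂ → ℂ, (∀ s : ℂ, s ≠ 0 → H s = -s * G s) ∧
      ∀ s : ℂ, -2 < s.re → DifferentiableAt ℂ H s := by
  have hm : MeromorphicAt (fun s : ℂ => s * G s) 0 :=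
    (MeromorphicAt.id 0).mul hG.meromorphicAt_zero
  have ho : 0 ≤ meromorphicOrderAt (fun s : ℂ => s * G s) 0 := by
    have h1 : meromorphicOrderAt (fun s : ℂ => s * G s) 0 =
        meromorphicOrderAt (id : ℂ → ℂ) 0 + meromorphicOrderAt G 0 :=
      meromorphicOrderAt_mul (MeromorphicAt.id 0) hG.meromorphicAt_zero
    rw [h1, meromorphicOrderAt_id]
    have := add_le_add_right hG.pole_zero (1 : WithTop ℤ)
    exact le_trans (by norm_num) this
  obtain ⟨c, hc⟩ := tendsto_nhds_of_meromorphicOrderAt_nonneg hm ho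
  -- The removable singularity of −s·G(s) is filled in with its limit at 0.
  refine ⟨Function.update (fun s => -s * G s) 0 (-c), fun s hs => by simp [hs], fun s hs => ?_⟩
  have hne : ∀ z : ℂ, z ≠ 0 → -2 < z.re →
      DifferentiableAt ℂ (Function.update (fun s => -s * G s) 0 (-c)) z := by
    intro z hz hz2
    have h1 : DifferentiableAt ℂ (fun s => -s * G s) z :=
      differentiableAt_id.neg.mul (hG.analyticAt z hz2 hz).differentiableAt
    refine h1.congr_of_eventuallyEq ?_
    filter_upwards [isOpen_ne.mem_nhds hz] with w hw
    rw [Function.update_of_ne hw]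
  rcases eq_or_ne s 0 with rfl | hs0
  · refine (Complex.analyticAt_of_differentiable_on_punctured_nhds_of_continuousAt ?_
      ?_).differentiableAt
    · have : ∀ᶠ z : ℂ in 𝓝 0, -2 < z.re :=
        Complex.continuous_re.continuousAt.eventually (lt_mem_nhds (by simp))
      filter_upwards [self_mem_nhdsWithin, nhdsWithin_le_nhds this] with z hz hz2
      exact hne z hz hz2
    · rw [continuousAt_update_same]
      simpa using hc.neg
  · exact hne s hs0 hs

/-- With at least one derivative in `u` the kernel contains a factor s that cancels the pole at 0,
so the two lines may lie on opposite sides of it. Without the derivative a residue would appear;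
this is the source of the constant c in `symbol`. -/
theorem integral_line_eq (hG : IsMellinContinuation Φ G) {σ₁ σ₂ : ℝ} (h1 : -2 < σ₁)
    (h12 : σ₁ ≤ σ₂) (h10 : σ₁ ≠ 0) (h20 : σ₂ ≠ 0) (k : ℕ) (u : ℝ) :
    ∫ t, mellinKernel G (k + 1) u (linePoint σ₁ t) =
      ∫ t, mellinKernel G (k + 1) u (linePoint σ₂ t) := by
  obtain ⟨H, hH, hHd⟩ := hG.exists_entire_mul
  set F : ℂ → ℂ := fun s => (-s) ^ k * Complex.exp (-s * u) * H s with hFdef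
  have hF : ∀ s, s ≠ 0 → mellinKernel G (k + 1) u s = F s := by
    intro s hs
    simp only [mellinKernel, hFdef, hH s hs, pow_succ]
    ring
  have hline : ∀ σ, σ ≠ 0 → ∀ t, mellinKernel G (k + 1) u (linePoint σ t) = F (linePoint σ t) :=
    fun σ hσ t => hF _ fun h => hσ (by rw [← linePoint_re σ t, h, Complex.zero_re])
  simp_rw [hline σ₁ h10, hline σ₂ h20]
  -- Of these powers, k + 1 compensate for the polynomial factor and 2 remain for integrability.
  obtain ⟨B, hB⟩ := hG.rapid_decay σ₁ σ₂ (k + 1 + 2) h1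
  refine SemilocalFourier.integral_line_eq
    (B := Real.exp (max |σ₁| |σ₂| * |u|) * ((max |σ₁| |σ₂| + 1) ^ (k + 1) * B)) h12
    (fun s hs1 hs2 => ?_) fun s hs1 hs2 him => ?_
  · have := hHd s (h1.trans_le hs1)
    fun_prop
  · have hs0 : s ≠ 0 := by
      rintro rfl
      simp at him
      linarith
    have hre : |s.re| ≤ max |σ₁| |σ₂| := abs_le_max_abs_abs hs1 hs2
    rw [← hF s hs0, norm_mellinKernel, mul_assoc]
    refine mul_le_mul (Real.exp_le_exp.2 ?_) ?_ (by positivity) (Real.exp_nonneg _)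
    · calc -s.re * u ≤ |-s.re * u| := le_abs_self _
        _ = |s.re| * |u| := by rw [abs_mul, abs_neg]
        _ ≤ _ := by gcongr
    · exact norm_pow_mul_le him (norm_nonneg _) hre (hB s hs1 hs2 him)

/-- Mellin inversion in the variable `u = log x`. -/
theorem eq_integral (hΦ : ClassS Φ) (hG : IsMellinContinuation Φ G) :
    ∃ A : ℝ, 0 < A ∧ ∀ σ, A ≤ σ → ∀ u, Φ (Real.exp u) =
      ((2 * Real.pi)⁻¹ : ℝ) * ∫ t, mellinKernel G 0 u (linePoint σ t) := by
  obtain ⟨A, hA⟩ := hG.eq_mellin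
  refine ⟨max A 0 + 1, by positivity, fun σ hσ u => ?_⟩
  have hσA : A < σ := by linarith [le_max_left A 0]
  have hσ0 : 0 < σ := by linarith [le_max_right A 0]
  have hl := hG.rapidOnLine (σ := σ) (by linarith) hσ0.ne'
  have heq : ∀ t : ℝ, mellin Φ (σ + t * Complex.I) = G (linePoint σ t) := fun t =>
    ((hA (linePoint σ t) (by rwa [linePoint_re])).2).symm
  have hint : Complex.VerticalIntegrable (mellin Φ) σ := by
    unfold Complex.VerticalIntegrable
    simp_rw [heq]
    simpa [mellinKernel] using hl.integrable_mellinKernel 0 0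
  have hcont : ContinuousAt Φ (Real.exp u) :=
    hΦ.1.continuousOn.continuousAt (Ioi_mem_nhds (Real.exp_pos u))
  have := mellinInv_mellin_eq σ Φ (Real.exp_pos u) ((hA σ (by simpa using hσA)).1) hint hcont
  rw [← this, mellinInv]
  simp_rw [heq]
  rw [Complex.real_smul, one_div]
  congr 2
  ext t
  have h0 : ((Real.exp u : ℝ) : ℂ) ≠ 0 := by exact_mod_cast (Real.exp_pos u).ne'
  rw [smul_eq_mul, Complex.cpow_def_of_ne_zero h0, ← Complex.ofReal_log (Real.exp_pos u).le,
    Real.log_exp, mellinKernel, linePoint, pow_zero, one_mul, mul_comm (u : ℂ)]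

/-- The function `u ↦ Φ(e^u)` is a bounded symbol, it decays exponentially at `+∞`, and it
approaches a constant at `-∞` at every exponential rate less than `2`. -/
theorem symbol (hΦ : ClassS Φ) (hG : IsMellinContinuation Φ G) :
    IsBoundedSymbol (fun u => Φ (Real.exp u)) ∧
    (∀ A : ℝ, 0 ≤ A → ∃ K, 0 ≤ K ∧ ∀ u, ‖Φ (Real.exp u)‖ ≤ K * Real.exp (-A * u)) ∧
    ∃ c : ℂ, ∀ b : ℝ, 0 < b → b < 2 → ∃ K, 0 ≤ K ∧ ∀ u,
      ‖Φ (Real.exp u) - c‖ ≤ K * Real.exp (b * u) := by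
  obtain ⟨A₀, hA₀, hinv⟩ := hG.eq_integral hΦ
  have hlA : ∀ σ, A₀ ≤ σ → RapidOnLine G σ := fun σ hσ =>
    hG.rapidOnLine (by linarith) (by linarith)
  set H : ℕ → ℝ → ℂ := fun k u =>
    ((2 * Real.pi)⁻¹ : ℝ) * ∫ t, mellinKernel G k u (linePoint A₀ t) with hH
  have hHd : ∀ k u, HasDerivAt (H k) (H (k + 1) u) u := fun k u =>
    ((hlA A₀ le_rfl).hasDerivAt_integral k u).const_mul _
  have hH0 : ∀ u, H 0 u = Φ (Real.exp u) := fun u => (hinv A₀ le_rfl u).symm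
  have hupper : ∀ k, ∃ K, 0 ≤ K ∧ ∀ u, ‖H k u‖ ≤ K * Real.exp (-A₀ * u) := by
    intro k
    obtain ⟨K, hK0, hK⟩ := norm_integral_mellinKernel_le G A₀ k
    refine ⟨(2 * Real.pi)⁻¹ * K, by positivity, fun u => ?_⟩
    rw [hH, norm_mul, Complex.norm_real, Real.norm_of_nonneg (by positivity), mul_assoc]
    exact mul_le_mul_of_nonneg_left (hK u) (by positivity)
  -- Derivatives are moved to the line Re s = −b, where the kernel grows like exp(bu). The strip −2
  -- < Re s limits b to less than 2.
  have hlower : ∀ k, ∀ b : ℝ, 0 < b → b < 2 → ∃ K, 0 ≤ K ∧ ∀ u,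
      ‖H (k + 1) u‖ ≤ K * Real.exp (b * u) := by
    intro k b hb0 hb2
    obtain ⟨K, hK0, hK⟩ := norm_integral_mellinKernel_le G (-b) (k + 1)
    refine ⟨(2 * Real.pi)⁻¹ * K, by positivity, fun u => ?_⟩
    rw [hH, norm_mul, Complex.norm_real, Real.norm_of_nonneg (by positivity), mul_assoc,
      ← hG.integral_line_eq (σ₁ := -b) (by linarith) (by linarith) (by linarith) hA₀.ne']
    simpa using mul_le_mul_of_nonneg_left (hK u) (by positivity : (0 : ℝ) ≤ (2 * Real.pi)⁻¹)
  have hintb : ∀ b : ℝ, 0 < b → b < 2 → ∀ u, IntegrableOn (H 1) (Iic u) := by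
    intro b hb0 hb2 u
    obtain ⟨K, _, hK⟩ := hlower 0 b hb0 hb2
    refine ((integrableOn_exp_mul_Iic hb0 u).const_mul K).mono' ?_ (Eventually.of_forall hK)
    exact (continuous_iff_continuousAt.2 fun x => (hHd 1 x).continuousAt).aestronglyMeasurable
  -- The first derivative is integrable at −∞, so the function itself has a limit there; integrating
  -- the derivative from −∞ then gives the rate of approach.
  have hlim : ∃ c, Tendsto (H 0) atBot (𝓝 c) :=
    ⟨_, tendsto_limUnder_of_hasDerivAt_of_integrableOn_Iic (a := 0) (fun x _ => hHd 0 x)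
      (hintb 1 one_pos one_lt_two 0)⟩
  obtain ⟨c, hc⟩ := hlim
  have hsub : ∀ b : ℝ, 0 < b → b < 2 → ∃ K, 0 ≤ K ∧ ∀ u, ‖H 0 u - c‖ ≤ K * Real.exp (b * u) := by
    intro b hb0 hb2
    obtain ⟨K, hK0, hK⟩ := hlower 0 b hb0 hb2
    refine ⟨K / b, by positivity, fun u => ?_⟩
    rw [← integral_Iic_of_hasDerivAt_of_tendsto' (fun x _ => hHd 0 x) (hintb b hb0 hb2 u) hc]
    calc ‖∫ x in Iic u, H 1 x‖ ≤ ∫ x in Iic u, K * Real.exp (b * x) :=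
          norm_integral_le_of_norm_le ((integrableOn_exp_mul_Iic hb0 u).const_mul K)
            (Eventually.of_forall hK)
      _ = K / b * Real.exp (b * u) := by
          rw [integral_const_mul, integral_exp_mul_Iic hb0]; ring
  have hbdd : ∀ k, ∃ K, ∀ u, ‖H k u‖ ≤ K := by
    intro k
    obtain ⟨K₁, hK₁0, hK₁⟩ := hupper k
    have hlow : ∃ K, ∀ u, u ≤ 0 → ‖H k u‖ ≤ K := by
      cases k with
      | zero =>
        obtain ⟨K, hK0, hK⟩ := hsub 1 one_pos one_lt_two
        refine ⟨K + ‖c‖, fun u hu => ?_⟩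
        calc ‖H 0 u‖ = ‖(H 0 u - c) + c‖ := by rw [sub_add_cancel]
          _ ≤ ‖H 0 u - c‖ + ‖c‖ := norm_add_le _ _
          _ ≤ K * Real.exp (1 * u) + ‖c‖ := by gcongr; exact hK u
          _ ≤ K * 1 + ‖c‖ := by gcongr; exact Real.exp_le_one_iff.2 (by linarith)
          _ = _ := by ring
      | succ k =>
        obtain ⟨K, hK0, hK⟩ := hlower k 1 one_pos one_lt_two
        refine ⟨K, fun u hu => (hK u).trans ?_⟩
        exact mul_le_of_le_one_right hK0 (Real.exp_le_one_iff.2 (by linarith))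
    obtain ⟨K₂, hK₂⟩ := hlow
    refine ⟨max K₁ K₂, fun u => ?_⟩
    rcases le_total u 0 with hu | hu
    · exact (hK₂ u hu).trans (le_max_right _ _)
    · refine ((hK₁ u).trans ?_).trans (le_max_left _ _)
      exact mul_le_of_le_one_right hK₁0 (Real.exp_le_one_iff.2 (by nlinarith))
  refine ⟨⟨H, funext hH0, hHd, hbdd⟩, fun A hA => ?_, c, fun b hb0 hb2 => ?_⟩
  · obtain ⟨K₁, hK₁⟩ := hbdd 0
    obtain ⟨K₂, hK₂0, hK₂⟩ := norm_integral_mellinKernel_le G (max A A₀) 0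
    have hK₁0 : 0 ≤ K₁ := (norm_nonneg _).trans (hK₁ 0)
    refine ⟨max K₁ ((2 * Real.pi)⁻¹ * K₂), by positivity, fun u => ?_⟩
    -- For u ≤ 0 boundedness is enough, since exp(−Au) ≥ 1. For u ≥ 0 the inversion line is placed
    -- at max(A, A₀), to the right of both abscissae.
    rcases le_total u 0 with hu | hu
    · rw [← hH0]
      calc ‖H 0 u‖ ≤ K₁ * 1 := by simpa using hK₁ u
        _ ≤ _ := by
          gcongr
          · exact le_max_left _ _
          · exact Real.one_le_exp (by nlinarith)
    · rw [hinv (max A A₀) (le_max_right _ _), norm_mul, Complex.norm_real,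
        Real.norm_of_nonneg (by positivity)]
      calc (2 * Real.pi)⁻¹ * ‖∫ t, mellinKernel G 0 u (linePoint (max A A₀) t)‖
          ≤ (2 * Real.pi)⁻¹ * (K₂ * Real.exp (-max A A₀ * u)) := by gcongr; exact hK₂ u
        _ = ((2 * Real.pi)⁻¹ * K₂) * Real.exp (-max A A₀ * u) := by ring
        _ ≤ _ := by
          gcongr
          · exact le_max_right _ _
          · exact le_max_left _ _
  · obtain ⟨K, hK0, hK⟩ := hsub b hb0 hb2
    exact ⟨K, hK0, fun u => by rw [← hH0]; exact hK u⟩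

end IsMellinContinuation

/-! ### Oscillatory integrals with power singularities at the end points -/

theorem norm_eInf (x : ℝ) : ‖eInf x‖ = 1 := by
  rw [eInf, Complex.norm_exp]
  simp

theorem continuous_eInf : Continuous eInf := by
  unfold eInf; fun_prop

theorem hasDerivAt_eInf_neg_mul (ξ x : ℝ) :
    HasDerivAt (fun x : ℝ => eInf (-(x * ξ)))
      (-(2 * Real.pi * Complex.I * ξ) * eInf (-(x * ξ))) x := by
  have h1 : HasDerivAt (fun x : ℝ => -(2 * Real.pi * Complex.I * ξ) * (x : ℂ))
      (-(2 * Real.pi * Complex.I * ξ)) x := by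
    simpa using (Complex.ofRealCLM.hasDerivAt (x := x)).const_mul (-(2 * Real.pi * Complex.I * ξ))
  have h2 : ∀ x : ℝ, eInf (-(x * ξ)) = Complex.exp (-(2 * Real.pi * Complex.I * ξ) * (x : ℂ)) := by
    intro x
    rw [eInf]
    congr 1
    push_cast
    ring
  simp_rw [h2]
  refine h1.cexp.congr_deriv ?_
  ring

/-! ### Amplitudes modelled on powers of the distance to the end points. -/

/-- Distance to the end points of `(a, b)`. -/
def endDist (a b x : ℝ) : ℝ := min (x - a) (b - x)

theorem endDist_pos {a b x : ℝ} (hx : x ∈ Ioo a b) : 0 < endDist a b x :=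
  lt_min (sub_pos.2 hx.1) (sub_pos.2 hx.2)

theorem endDist_rpow_le {a b x : ℝ} (hx : x ∈ Ioo a b) (α : ℝ) :
    endDist a b x ^ α ≤ (x - a) ^ α + (b - x) ^ α := by
  have h1 := Real.rpow_nonneg (sub_pos.2 hx.1).le α
  have h2 := Real.rpow_nonneg (sub_pos.2 hx.2).le α
  rcases min_choice (x - a) (b - x) with h | h <;> rw [endDist, h] <;> linarith

/-- On `(a, b)` the smooth function `w` is positive, and on `S` it is comparable to the distance
to the end points. -/
structure IsWeight (a b : ℝ) (S : Set ℝ) (w w' : ℝ → ℝ) : Prop where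
  len : a + 2 ≤ b
  smooth : ContDiff ℝ ∞ w
  smooth' : ContDiff ℝ ∞ w'
  hasDeriv : ∀ x, HasDerivAt w (w' x) x
  pos : ∀ x ∈ Ioo a b, 0 < w x
  closed : IsClosed S
  comparable : ∃ c, 1 ≤ c ∧ ∀ x ∈ Ioo a b, x ∈ S →
    endDist a b x ≤ c * w x ∧ w x ≤ c * endDist a b x

/-- The amplitude `P w^α h(l - log(w)/2)`. -/
def amplitude (w : ℝ → ℝ) (P h : ℝ → ℂ) (α l x : ℝ) : ℂ :=
  P x * ((w x ^ α : ℝ) : ℂ) * h (l - Real.log (w x) / 2)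

/-- The class of amplitudes is stable under differentiation at the cost of lowering α by one. A
derivative on `P` is written with an extra factor `w` to reach the same exponent, and a derivative
on `h` contributes −w'/(2w) from the logarithm. -/
theorem hasDerivAt_amplitude {w w' : ℝ → ℝ} {P P' h h' : ℝ → ℂ} {x : ℝ} (α l : ℝ)
    (hw : HasDerivAt w (w' x) x) (hpos : 0 < w x) (hP : HasDerivAt P (P' x) x)
    (hh : ∀ u, HasDerivAt h (h' u) u) :
    HasDerivAt (amplitude w P h α l)
      (amplitude w (fun x => P' x * w x + α * P x * w' x) h (α - 1) l x +
        amplitude w (fun x => -(1 / 2) * P x * w' x) h' (α - 1) l x) x := by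
  have h1 : HasDerivAt (fun x => ((w x ^ α : ℝ) : ℂ)) ((w' x * α * w x ^ (α - 1) : ℝ) : ℂ) x :=
    (hw.rpow_const (Or.inl hpos.ne')).ofReal_comp
  have h2 : HasDerivAt (fun x => l - Real.log (w x) / 2) (-(w' x / w x / 2)) x :=
    ((hw.log hpos.ne').div_const 2).const_sub l
  have h3 : HasDerivAt (fun x => h (l - Real.log (w x) / 2))
      ((-(w' x / w x / 2) : ℝ) • h' (l - Real.log (w x) / 2)) x :=
    HasDerivAt.scomp x (hh _) h2
  refine ((hP.mul h1).mul h3).congr_deriv ?_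
  have h4 : w x ^ α = w x ^ (α - 1) * w x := by
    rw [← Real.rpow_add_one hpos.ne', sub_add_cancel]
  have h5 : (w x : ℂ) ≠ 0 := by exact_mod_cast hpos.ne'
  simp only [amplitude, Pi.mul_apply, h4, Complex.real_smul]
  push_cast
  field_simp

/-- Smooth functions supported in `S`. -/
def SmoothOn (S : Set ℝ) (P : ℝ → ℂ) : Prop := ContDiff ℝ ∞ P ∧ Function.support P ⊆ S

theorem SmoothOn.mul_left {S : Set ℝ} {P Q : ℝ → ℂ} (hP : SmoothOn S P) (hQ : ContDiff ℝ ∞ Q) :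
    SmoothOn S fun x => Q x * P x :=
  ⟨hQ.mul hP.1, fun x hx => hP.2 fun h => hx (by simp [h])⟩

theorem SmoothOn.add {S : Set ℝ} {P Q : ℝ → ℂ} (hP : SmoothOn S P) (hQ : SmoothOn S Q) :
    SmoothOn S fun x => P x + Q x := by
  refine ⟨hP.1.add hQ.1, fun x hx => by_contra fun h => hx ?_⟩
  have h1 : P x = 0 := by_contra fun h' => h (hP.2 h')
  have h2 : Q x = 0 := by_contra fun h' => h (hQ.2 h')
  simp [h1, h2]

theorem SmoothOn.deriv {S : Set ℝ} (hS : IsClosed S) {P : ℝ → ℂ} (hP : SmoothOn S P) :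
    SmoothOn S (deriv P) :=
  ⟨(contDiff_infty_iff_deriv.1 hP.1).2, support_deriv_subset.trans (hS.closure_subset_iff.2 hP.2)⟩

theorem ContDiff.ofReal_comp' {w : ℝ → ℝ} (hw : ContDiff ℝ ∞ w) :
    ContDiff ℝ ∞ fun x => (w x : ℂ) :=
  Complex.ofRealCLM.contDiff.comp hw

/-- The sign of the exponent decides which of the two comparisons is used; the absolute value |α|
covers both cases. -/
theorem rpow_le_of_comparable {c d w : ℝ} (hc : 1 ≤ c) (hd : 0 < d) (hw : 0 < w)
    (h1 : d ≤ c * w) (h2 : w ≤ c * d) (α : ℝ) : w ^ α ≤ c ^ |α| * d ^ α := by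
  have hc0 : 0 < c := by linarith
  rcases le_total 0 α with h | h
  · rw [abs_of_nonneg h, ← Real.mul_rpow hc0.le hd.le]
    exact Real.rpow_le_rpow hw.le h2 h
  · rw [abs_of_nonpos h, Real.rpow_neg hc0.le, ← Real.inv_rpow hc0.le,
      ← Real.mul_rpow (by positivity) hd.le]
    refine Real.rpow_le_rpow_of_nonpos (by positivity) ?_ h
    rw [inv_mul_le_iff₀ hc0]
    exact h1

namespace IsWeight

variable {a b : ℝ} {S : Set ℝ} {w w' : ℝ → ℝ}

theorem norm_amplitude_le (hw : IsWeight a b S w w') {P h : ℝ → ℂ} (hP : SmoothOn S P)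
    (hh : ∃ K, ∀ u, ‖h u‖ ≤ K) (α : ℝ) :
    ∃ K, 0 ≤ K ∧ ∀ l, ∀ x ∈ Ioo a b, ‖amplitude w P h α l x‖ ≤ K * endDist a b x ^ α := by
  obtain ⟨K, hK⟩ := hh
  obtain ⟨M, hM⟩ := (isCompact_Icc (a := a) (b := b)).exists_bound_of_continuousOn
    hP.1.continuous.continuousOn
  obtain ⟨c, hc, hcw⟩ := hw.comparable
  have hK0 : 0 ≤ K := (norm_nonneg _).trans (hK 0)
  have hM0 : 0 ≤ M := (norm_nonneg _).trans (hM a ⟨le_rfl, by linarith [hw.len]⟩)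
  refine ⟨M * c ^ |α| * K, by positivity, fun l x hx => ?_⟩
  have hd := endDist_pos hx
  by_cases hxS : x ∈ S
  · obtain ⟨h1, h2⟩ := hcw x hx hxS
    rw [amplitude, norm_mul, norm_mul, Complex.norm_real,
      Real.norm_of_nonneg (Real.rpow_nonneg (hw.pos x hx).le _)]
    calc ‖P x‖ * w x ^ α * ‖h (l - Real.log (w x) / 2)‖
        ≤ M * (c ^ |α| * endDist a b x ^ α) * K := by
          have := Real.rpow_nonneg (hw.pos x hx).le α
          gcongr
          · exact hM x ⟨hx.1.le, hx.2.le⟩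
          · exact rpow_le_of_comparable hc hd (hw.pos x hx) h1 h2 α
          · exact hK _
      _ = _ := by ring
  · have : P x = 0 := by_contra fun h' => hxS (hP.2 h')
    rw [amplitude, this]
    simp
    positivity

theorem continuousOn_amplitude (hw : IsWeight a b S w w') {P h : ℝ → ℂ} (hP : SmoothOn S P)
    (hh : Continuous h) (α l : ℝ) : ContinuousOn (amplitude w P h α l) (Ioo a b) := by
  have hwc := hw.smooth.continuous
  intro x hx
  have h0 := (hw.pos x hx).ne'
  refine ContinuousAt.continuousWithinAt ?_
  have h1 : ContinuousAt (fun x => ((w x ^ α : ℝ) : ℂ)) x :=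
    Complex.continuous_ofReal.continuousAt.comp (hwc.continuousAt.rpow_const (Or.inl h0))
  have h2 : ContinuousAt (fun x => h (l - Real.log (w x) / 2)) x :=
    hh.continuousAt.comp (continuousAt_const.sub ((hwc.continuousAt.log h0).div_const 2))
  exact (hP.1.continuous.continuousAt.mul h1).mul h2

end IsWeight

theorem intervalIntegrable_sub_rpow {a b : ℝ} {α : ℝ} (hα : -1 < α) (c d : ℝ) :
    IntervalIntegrable (fun x => (x - a) ^ α + (b - x) ^ α) volume c d := by
  have h1 : IntervalIntegrable (fun x : ℝ => (x - a) ^ α) volume c d := by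
    simpa using (intervalIntegral.intervalIntegrable_rpow' (a := c - a) (b := d - a) hα).comp_sub_right a
  have h2 : IntervalIntegrable (fun x : ℝ => (b - x) ^ α) volume c d := by
    simpa using (intervalIntegral.intervalIntegrable_rpow' (a := b - c) (b := b - d) hα).comp_sub_left b
  exact h1.add h2

theorem integral_endDist_bound_of_lt {a b δ α : ℝ} (hα : α < -1) (hδ : 0 < δ) (hδ1 : δ ≤ 1)
    (hab : a + 2 ≤ b) :
    ∫ x in (a + δ)..(b - δ), ((x - a) ^ α + (b - x) ^ α) ≤ 2 / (-(α + 1)) * δ ^ (α + 1) := by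
  have h0 : (0 : ℝ) ∉ uIcc δ (b - a - δ) := by
    rw [uIcc_of_le (by linarith)]
    exact fun h => absurd h.1 (by linarith)
  have hI : IntervalIntegrable (fun x : ℝ => x ^ α) volume δ (b - a - δ) :=
    intervalIntegral.intervalIntegrable_rpow (Or.inr h0)
  have h1 : IntervalIntegrable (fun x : ℝ => (x - a) ^ α) volume (a + δ) (b - δ) := by
    have := hI.comp_sub_right a
    convert this using 1 <;> ring
  have h2 : IntervalIntegrable (fun x : ℝ => (b - x) ^ α) volume (a + δ) (b - δ) := by
    have := (hI.comp_sub_left b).symm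
    convert this using 1; ring
  rw [intervalIntegral.integral_add h1 h2,
    intervalIntegral.integral_comp_sub_right (fun x => x ^ α),
    intervalIntegral.integral_comp_sub_left (fun x => x ^ α),
    show a + δ - a = δ by ring, show b - δ - a = b - a - δ by ring, show b - (b - δ) = δ by ring,
    show b - (a + δ) = b - a - δ by ring, integral_rpow (Or.inr ⟨by linarith, h0⟩)]
  have h3 : 0 ≤ (b - a - δ) ^ (α + 1) := Real.rpow_nonneg (by linarith) _
  have h4 : ((b - a - δ) ^ (α + 1) - δ ^ (α + 1)) / (α + 1) ≤ δ ^ (α + 1) / (-(α + 1)) := by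
    rw [← neg_div_neg_eq, neg_sub]
    gcongr
    · linarith
    · linarith
  calc _ ≤ δ ^ (α + 1) / (-(α + 1)) + δ ^ (α + 1) / (-(α + 1)) := add_le_add h4 h4
    _ = _ := by ring

theorem inv_rpow_eq {t : ℝ} (ht : 0 ≤ t) (α : ℝ) : (t⁻¹) ^ α = t ^ (-α) := by
  rw [Real.inv_rpow ht, Real.rpow_neg ht]

namespace IsWeight

variable {a b : ℝ} {S : Set ℝ} {w w' : ℝ → ℝ}

/-- The integral over `(a + 1/|ξ|, b - 1/|ξ|)`, by repeated integration by parts. -/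
theorem norm_integral_truncated_le (hw : IsWeight a b S w w') {H : ℕ → ℝ → ℂ}
    (hHd : ∀ k u, HasDerivAt (H k) (H (k + 1) u) u) (hHb : ∀ k, ∃ K, ∀ u, ‖H k u‖ ≤ K) (k : ℕ) :
    ∀ α : ℝ, α < k - 1 → ∀ P, SmoothOn S P → ∀ j, ∃ K, 0 ≤ K ∧ ∀ l ξ : ℝ, 1 ≤ |ξ| →
      ‖∫ x in (a + |ξ|⁻¹)..(b - |ξ|⁻¹), amplitude w P (H j) α l x * eInf (-(x * ξ))‖ ≤
        K * |ξ| ^ (-1 - α) := by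
  have hHc : ∀ j, Continuous (H j) := fun j =>
    continuous_iff_continuousAt.2 fun x => (hHd j x).continuousAt
  have hlen := hw.len
  induction k with
  | zero =>
    intro α hα P hP j
    -- For α < −1 no cancellation is needed: the integral of dist^α outside the cut-off 1/|ξ| is
    -- already of size |ξ|^(−1−α).
    have hα' : α < -1 := by simpa using hα
    obtain ⟨K, hK0, hK⟩ := hw.norm_amplitude_le hP (hHb j) α
    refine ⟨K * (2 / (-(α + 1))), mul_nonneg hK0 (div_nonneg two_pos.le (by linarith)),
      fun l ξ hξ => ?_⟩
    have hξ0 : 0 < |ξ| := by linarith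
    have hδ : 0 < |ξ|⁻¹ := by positivity
    have hδ1 : |ξ|⁻¹ ≤ 1 := inv_le_one_of_one_le₀ hξ
    have hle : a + |ξ|⁻¹ ≤ b - |ξ|⁻¹ := by linarith
    have hcont : ContinuousOn (fun x => K * ((x - a) ^ α + (b - x) ^ α))
        (uIcc (a + |ξ|⁻¹) (b - |ξ|⁻¹)) := by
      rw [uIcc_of_le hle]
      refine continuousOn_const.mul (ContinuousOn.add ?_ ?_) <;>
        refine ContinuousOn.rpow_const (by fun_prop) fun x hx => Or.inl ?_ <;>
        have h1 := hx.1 <;> have h2 := hx.2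
      · have : 0 < x - a := by linarith
        exact this.ne'
      · have : 0 < b - x := by linarith
        exact this.ne'
    calc _ ≤ ∫ x in (a + |ξ|⁻¹)..(b - |ξ|⁻¹), K * ((x - a) ^ α + (b - x) ^ α) := by
          refine intervalIntegral.norm_integral_le_of_norm_le hle
            (Eventually.of_forall fun x hx => ?_) hcont.intervalIntegrable
          have hx' : x ∈ Ioo a b := ⟨by linarith [hx.1], by linarith [hx.2]⟩
          rw [norm_mul, norm_eInf, mul_one]
          exact (hK l x hx').trans (by gcongr; exact endDist_rpow_le hx' α)
      _ ≤ K * (2 / (-(α + 1)) * |ξ|⁻¹ ^ (α + 1)) := by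
          rw [intervalIntegral.integral_const_mul]
          gcongr
          exact integral_endDist_bound_of_lt hα' hδ hδ1 hlen
      _ = _ := by
          rw [inv_rpow_eq hξ0.le, show -(α + 1) = -1 - α by ring]
          ring
  | succ k ih =>
    intro α hα P hP j
    have hα' : α - 1 < k - 1 := by push_cast at hα; linarith
    have hPd : ∀ x, HasDerivAt P (deriv P x) x := fun x =>
      (hP.1.differentiable (by simp) x).hasDerivAt
    have hP1 : SmoothOn S fun x => deriv P x * w x + α * P x * w' x := by
      have h1 := (hP.deriv hw.closed).mul_left (ContDiff.ofReal_comp' hw.smooth)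
      have h2 := hP.mul_left ((contDiff_const (c := (α : ℂ))).mul (ContDiff.ofReal_comp' hw.smooth'))
      convert h1.add h2 using 2
      ring
    have hP2 : SmoothOn S fun x => -(1 / 2) * P x * w' x := by
      have h2 := hP.mul_left
        ((contDiff_const (c := (-(1 / 2) : ℂ))).mul (ContDiff.ofReal_comp' hw.smooth'))
      convert h2 using 2
      ring
    obtain ⟨K, hK0, hK⟩ := hw.norm_amplitude_le hP (hHb j) α
    -- Both pieces of the derivative have exponent α − 1, so the induction hypothesis gives |ξ|^(−α)
    -- for each; the integrated exponential supplies the missing 1/|ξ|.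
    obtain ⟨K₁, hK₁0, hK₁⟩ := ih (α - 1) hα' _ hP1 j
    obtain ⟨K₂, hK₂0, hK₂⟩ := ih (α - 1) hα' _ hP2 (j + 1)
    refine ⟨2 * K + (K₁ + K₂), by positivity, fun l ξ hξ => ?_⟩
    have hξ0 : 0 < |ξ| := by linarith
    have hξne : (ξ : ℂ) ≠ 0 := by exact_mod_cast abs_pos.1 hξ0
    have hδ : 0 < |ξ|⁻¹ := by positivity
    have hδ1 : |ξ|⁻¹ ≤ 1 := inv_le_one_of_one_le₀ hξ
    set p := a + |ξ|⁻¹ with hp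
    set q := b - |ξ|⁻¹ with hq
    have hle : p ≤ q := by linarith
    have hsub : uIcc p q ⊆ Ioo a b := by
      rw [uIcc_of_le hle]
      exact fun x hx => ⟨by linarith [hx.1], by linarith [hx.2]⟩
    set D : ℂ := -(2 * Real.pi * Complex.I * ξ) with hD
    have hDne : D ≠ 0 := by
      rw [hD, neg_ne_zero]
      simp [Real.pi_ne_zero, hξne]
    have hDn : |ξ| ≤ ‖D‖ := by
      rw [hD, norm_neg]
      simp only [norm_mul, Complex.norm_real, Complex.norm_I, Complex.norm_ofNat,
        Real.norm_eq_abs, abs_of_pos Real.pi_pos]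
      nlinarith [Real.pi_gt_three]
    have hDinv : ‖D‖⁻¹ ≤ |ξ|⁻¹ := inv_anti₀ hξ0 hDn
    set A := amplitude w P (H j) α l
    set A₁ := amplitude w (fun x => deriv P x * w x + α * P x * w' x) (H j) (α - 1) l
    set A₂ := amplitude w (fun x => -(1 / 2) * P x * w' x) (H (j + 1)) (α - 1) l
    set E : ℝ → ℂ := fun x => eInf (-(x * ξ)) with hE
    have hEc : Continuous E := continuous_eInf.comp (by fun_prop)
    have hA₁c : ContinuousOn A₁ (uIcc p q) := (hw.continuousOn_amplitude hP1 (hHc j) _ _).mono hsub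
    have hA₂c : ContinuousOn A₂ (uIcc p q) :=
      (hw.continuousOn_amplitude hP2 (hHc (j + 1)) _ _).mono hsub
    have hAd : ∀ x ∈ uIcc p q, HasDerivAt A (A₁ x + A₂ x) x := fun x hx =>
      hasDerivAt_amplitude α l (hw.hasDeriv x) (hw.pos x (hsub hx)) (hPd x) (hHd j)
    have hEd : ∀ x ∈ uIcc p q, HasDerivAt (fun x => D⁻¹ * E x) (E x) x := fun x _ => by
      refine ((hasDerivAt_eInf_neg_mul ξ x).const_mul D⁻¹).congr_deriv ?_
      rw [← mul_assoc, inv_mul_cancel₀ hDne, one_mul]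
    have hparts := intervalIntegral.integral_mul_deriv_eq_deriv_mul hAd hEd
      (hA₁c.add hA₂c).intervalIntegrable hEc.continuousOn.intervalIntegrable
    have hsplit : ∫ x in p..q, (A₁ x + A₂ x) * (D⁻¹ * E x) =
        D⁻¹ * ((∫ x in p..q, A₁ x * E x) + ∫ x in p..q, A₂ x * E x) := by
      have hi₁ : IntervalIntegrable (fun x => A₁ x * E x) volume p q :=
        (hA₁c.mul hEc.continuousOn).intervalIntegrable
      have hi₂ : IntervalIntegrable (fun x => A₂ x * E x) volume p q :=
        (hA₂c.mul hEc.continuousOn).intervalIntegrable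
      rw [← intervalIntegral.integral_add hi₁ hi₂, ← intervalIntegral.integral_const_mul]
      congr 1
      ext x
      ring
    have hpow : |ξ|⁻¹ * |ξ| ^ (-α) = |ξ| ^ (-1 - α) := by
      rw [← Real.rpow_neg_one, ← Real.rpow_add hξ0]
      ring_nf
    -- Boundary terms live at distance exactly 1/|ξ| from an end point. There the amplitude is
    -- O(|ξ|^(−α)) and the antiderivative of the exponential is O(1/|ξ|).
    have hend : ∀ x, x ∈ Ioo a b → endDist a b x = |ξ|⁻¹ → ‖A x * (D⁻¹ * E x)‖ ≤
        K * |ξ| ^ (-1 - α) := by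
      intro x hx hxd
      rw [norm_mul, norm_mul, norm_eInf, mul_one, norm_inv]
      calc ‖A x‖ * ‖D‖⁻¹ ≤ (K * |ξ|⁻¹ ^ α) * |ξ|⁻¹ := by
            gcongr
            rw [← hxd]
            exact hK l x hx
        _ = K * (|ξ|⁻¹ * |ξ| ^ (-α)) := by rw [inv_rpow_eq hξ0.le]; ring
        _ = _ := by rw [hpow]
    have hp1 := hend p (hsub left_mem_uIcc) (by
      rw [endDist, min_eq_left] <;> rw [hp] <;> linarith)
    have hq1 := hend q (hsub right_mem_uIcc) (by
      rw [endDist, min_eq_right] <;> rw [hq] <;> linarith)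
    have hpow' : |ξ| ^ (-1 - (α - 1)) = |ξ| ^ (-α) := by ring_nf
    have h₁ := hK₁ l ξ hξ
    have h₂ := hK₂ l ξ hξ
    rw [hpow'] at h₁ h₂
    calc ‖∫ x in p..q, A x * E x‖
        = ‖A q * (D⁻¹ * E q) - A p * (D⁻¹ * E p) -
          D⁻¹ * ((∫ x in p..q, A₁ x * E x) + ∫ x in p..q, A₂ x * E x)‖ := by rw [hparts, hsplit]
      _ ≤ ‖A q * (D⁻¹ * E q)‖ + ‖A p * (D⁻¹ * E p)‖ +
          ‖D⁻¹‖ * (‖∫ x in p..q, A₁ x * E x‖ + ‖∫ x in p..q, A₂ x * E x‖) := by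
          refine (norm_sub_le _ _).trans (add_le_add (norm_sub_le _ _) ?_)
          rw [norm_mul]
          gcongr
          exact norm_add_le _ _
      _ ≤ K * |ξ| ^ (-1 - α) + K * |ξ| ^ (-1 - α) +
          |ξ|⁻¹ * (K₁ * |ξ| ^ (-α) + K₂ * |ξ| ^ (-α)) := by
          rw [norm_inv]
          gcongr
      _ = (2 * K) * |ξ| ^ (-1 - α) + (K₁ + K₂) * (|ξ|⁻¹ * |ξ| ^ (-α)) := by ring
      _ = _ := by rw [hpow]; ring

theorem intervalIntegrable_amplitude (hw : IsWeight a b S w w') {P h : ℝ → ℂ} (hP : SmoothOn S P)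
    (hh : Continuous h) (hhb : ∃ K, ∀ u, ‖h u‖ ≤ K) {α : ℝ} (hα : -1 < α) (l : ℝ) :
    IntervalIntegrable (amplitude w P h α l) volume a b := by
  obtain ⟨K, hK0, hK⟩ := hw.norm_amplitude_le hP hhb α
  have hle : a ≤ b := by linarith [hw.len]
  have hi := (intervalIntegrable_sub_rpow (a := a) (b := b) hα a b).const_mul K
  rw [intervalIntegrable_iff_integrableOn_Ioo_of_le hle] at hi ⊢
  refine hi.mono' ((hw.continuousOn_amplitude hP hh α l).aestronglyMeasurable measurableSet_Ioo) ?_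
  filter_upwards [ae_restrict_mem measurableSet_Ioo] with x hx
  exact (hK l x hx).trans (by gcongr; exact endDist_rpow_le hx α)

/-- The cut at distance 1/|ξ| balances two effects: within it the size of dist^α integrates to
|ξ|^(−1−α), and outside it integration by parts gives the same power. The constants see `h` only
through bounds on its derivatives, hence the uniformity in `l`. -/
theorem norm_integral_le (hw : IsWeight a b S w w') {h : ℝ → ℂ} (hh : IsBoundedSymbol h)
    {α : ℝ} (hα : -1 < α) {P : ℝ → ℂ} (hP : SmoothOn S P) :
    ∃ K, 0 ≤ K ∧ ∀ l ξ : ℝ,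
      ‖∫ x in a..b, amplitude w P h α l x * eInf (-(x * ξ))‖ ≤ K * (1 + |ξ|) ^ (-1 - α) := by
  obtain ⟨H, rfl, hHd, hHb⟩ := hh
  have hlen := hw.len
  have hle : a ≤ b := by linarith
  have hHc : Continuous (H 0) := continuous_iff_continuousAt.2 fun x => (hHd 0 x).continuousAt
  -- The number of integrations by parts must exceed α + 1, so that the exponent ends below −1.
  obtain ⟨k, hk⟩ := exists_nat_gt (α + 1)
  obtain ⟨K₁, hK₁0, hK₁⟩ :=
    hw.norm_integral_truncated_le hHd hHb k α (by linarith) P hP 0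
  obtain ⟨K₂, hK₂0, hK₂⟩ := hw.norm_amplitude_le hP (hHb 0) α
  have hα1 : 0 < α + 1 := by linarith
  set V := ∫ x in a..b, ((x - a) ^ α + (b - x) ^ α) with hV
  have hV0 : 0 ≤ V := intervalIntegral.integral_nonneg hle fun x hx =>
    add_nonneg (Real.rpow_nonneg (sub_nonneg.2 hx.1) _) (Real.rpow_nonneg (sub_nonneg.2 hx.2) _)
  set B := K₂ * V + (K₁ + 2 * K₂ / (α + 1)) with hB
  have hB0 : 0 ≤ B := by positivity
  refine ⟨B * 2 ^ (1 + α), by positivity, fun l ξ => ?_⟩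
  have hξp : 0 < 1 + |ξ| := by positivity
  have hEc : Continuous fun x : ℝ => eInf (-(x * ξ)) := continuous_eInf.comp (by fun_prop)
  have hint : IntervalIntegrable (fun x => amplitude w P (H 0) α l x * eInf (-(x * ξ)))
      volume a b :=
    (hw.intervalIntegrable_amplitude hP hHc (hHb 0) hα l).mul_continuousOn hEc.continuousOn
  have hnorm : ∀ x ∈ Ioo a b, ‖amplitude w P (H 0) α l x * eInf (-(x * ξ))‖ ≤
      K₂ * endDist a b x ^ α := fun x hx => by
    rw [norm_mul, norm_eInf, mul_one]; exact hK₂ l x hx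
  have hnormb : ∀ x ∈ Ioo a b, ‖amplitude w P (H 0) α l x * eInf (-(x * ξ))‖ ≤
      K₂ * ((x - a) ^ α + (b - x) ^ α) := fun x hx =>
    (hnorm x hx).trans (by gcongr; exact endDist_rpow_le hx α)
  -- For |ξ| < 1 the cut-off would leave the interval; absolute integrability suffices there, since
  -- 1 + |ξ| ≤ 2.
  rcases lt_or_ge |ξ| 1 with hξ | hξ
  · have h1 : ‖∫ x in a..b, amplitude w P (H 0) α l x * eInf (-(x * ξ))‖ ≤ K₂ * V := by
      rw [hV, ← intervalIntegral.integral_const_mul]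
      refine intervalIntegral.norm_integral_le_of_norm_le hle ?_
        ((intervalIntegrable_sub_rpow hα a b).const_mul K₂)
      have hbne : ∀ᵐ x : ℝ ∂volume, x ≠ b := by simp [ae_iff]
      filter_upwards [hbne] with x hxb hx
      exact hnormb x ⟨hx.1, lt_of_le_of_ne hx.2 hxb⟩
    have h2 : (1 : ℝ) ≤ 2 ^ (1 + α) * (1 + |ξ|) ^ (-1 - α) := by
      rw [show -1 - α = -(1 + α) by ring, Real.rpow_neg hξp.le, ← div_eq_mul_inv,
        one_le_div (by positivity)]
      exact Real.rpow_le_rpow hξp.le (by linarith) (by linarith)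
    calc _ ≤ K₂ * V := h1
      _ ≤ B := by rw [hB]; exact le_add_of_nonneg_right (by positivity)
      _ ≤ B * (2 ^ (1 + α) * (1 + |ξ|) ^ (-1 - α)) := le_mul_of_one_le_right hB0 h2
      _ = _ := by ring
  · have hξ0 : 0 < |ξ| := by linarith
    have hδ : 0 < |ξ|⁻¹ := by positivity
    have hδ1 : |ξ|⁻¹ ≤ 1 := inv_le_one_of_one_le₀ hξ
    set δ := |ξ|⁻¹ with hδdef
    have hpow : δ ^ (α + 1) = |ξ| ^ (-1 - α) := by
      rw [hδdef, inv_rpow_eq hξ0.le]; ring_nf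
    have hi1 : IntervalIntegrable (fun x => amplitude w P (H 0) α l x * eInf (-(x * ξ)))
        volume a (a + δ) := hint.mono_set (by
      rw [uIcc_of_le hle, uIcc_of_le (by linarith)]; exact Icc_subset_Icc le_rfl (by linarith))
    have hi2 : IntervalIntegrable (fun x => amplitude w P (H 0) α l x * eInf (-(x * ξ)))
        volume (a + δ) (b - δ) := hint.mono_set (by
      rw [uIcc_of_le hle, uIcc_of_le (by linarith)]
      exact Icc_subset_Icc (by linarith) (by linarith))
    have hi3 : IntervalIntegrable (fun x => amplitude w P (H 0) α l x * eInf (-(x * ξ)))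
        volume (b - δ) b := hint.mono_set (by
      rw [uIcc_of_le hle, uIcc_of_le (by linarith)]; exact Icc_subset_Icc (by linarith) le_rfl)
    have hzero : (0 : ℝ) ^ (α + 1) = 0 := Real.zero_rpow hα1.ne'
    have hb1 : ‖∫ x in a..(a + δ), amplitude w P (H 0) α l x * eInf (-(x * ξ))‖ ≤
        K₂ / (α + 1) * δ ^ (α + 1) := by
      have hii : IntervalIntegrable (fun x : ℝ => (x - a) ^ α) volume a (a + δ) := by
        simpa [add_comm] using (intervalIntegral.intervalIntegrable_rpow' (a := a - a)
          (b := a + δ - a) hα).comp_sub_right a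
      calc _ ≤ ∫ x in a..(a + δ), K₂ * (x - a) ^ α := by
            refine intervalIntegral.norm_integral_le_of_norm_le (by linarith)
              (Eventually.of_forall fun x hx => ?_) (hii.const_mul K₂)
            have := hnorm x ⟨hx.1, by linarith [hx.2]⟩
            rwa [endDist, min_eq_left (by linarith [hx.2])] at this
        _ = _ := by
            rw [intervalIntegral.integral_const_mul,
              intervalIntegral.integral_comp_sub_right (fun x => x ^ α), sub_self,
              add_sub_cancel_left, integral_rpow (Or.inl hα), hzero]
            ring
    have hb3 : ‖∫ x in (b - δ)..b, amplitude w P (H 0) α l x * eInf (-(x * ξ))‖ ≤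
        K₂ / (α + 1) * δ ^ (α + 1) := by
      have hii : IntervalIntegrable (fun x : ℝ => (b - x) ^ α) volume (b - δ) b := by
        simpa using (intervalIntegral.intervalIntegrable_rpow' (a := b - (b - δ)) (b := b - b)
          hα).comp_sub_left b
      have hbne : ∀ᵐ x : ℝ ∂volume, x ≠ b := by simp [ae_iff]
      calc _ ≤ ∫ x in (b - δ)..b, K₂ * (b - x) ^ α := by
            refine intervalIntegral.norm_integral_le_of_norm_le (by linarith) ?_ (hii.const_mul K₂)
            filter_upwards [hbne] with x hxb hx
            have := hnorm x ⟨by linarith [hx.1], lt_of_le_of_ne hx.2 hxb⟩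
            rwa [endDist, min_eq_right (by linarith [hx.1])] at this
        _ = _ := by
            rw [intervalIntegral.integral_const_mul,
              intervalIntegral.integral_comp_sub_left (fun x => x ^ α), sub_self,
              sub_sub_cancel, integral_rpow (Or.inl hα), hzero]
            ring
    have h2 : |ξ| ^ (-1 - α) ≤ 2 ^ (1 + α) * (1 + |ξ|) ^ (-1 - α) := by
      rw [show -1 - α = -(1 + α) by ring, Real.rpow_neg hξp.le, Real.rpow_neg hξ0.le,
        ← div_eq_mul_inv, ← Real.div_rpow two_pos.le hξp.le, ← Real.inv_rpow hξ0.le]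
      refine Real.rpow_le_rpow (by positivity) ?_ (by linarith)
      rw [inv_eq_one_div, div_le_div_iff₀ hξ0 hξp]
      linarith
    rw [← intervalIntegral.integral_add_adjacent_intervals hi1 (hi2.trans hi3),
      ← intervalIntegral.integral_add_adjacent_intervals hi2 hi3]
    calc _ ≤ K₂ / (α + 1) * δ ^ (α + 1) + (K₁ * |ξ| ^ (-1 - α) + K₂ / (α + 1) * δ ^ (α + 1)) :=
          (norm_add_le _ _).trans (add_le_add hb1 ((norm_add_le _ _).trans
            (add_le_add (hK₁ l ξ hξ) hb3)))
      _ = (K₁ + 2 * K₂ / (α + 1)) * |ξ| ^ (-1 - α) := by rw [hpow]; ring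
      _ ≤ B * |ξ| ^ (-1 - α) := by
          gcongr
          rw [hB]
          exact le_add_of_nonneg_left (by positivity)
      _ ≤ B * (2 ^ (1 + α) * (1 + |ξ|) ^ (-1 - α)) := by gcongr
      _ = _ := by ring

end IsWeight

/-! ### The archimedean integral -/

/-- The archimedean factor `|x² - s|^α φ(x) h(l - log|x² - s|/2)`. -/
def realTerm (s : ℝ) (φ h : ℝ → ℂ) (α l x : ℝ) : ℂ :=
  ((|x ^ 2 - s| ^ α : ℝ) : ℂ) * φ x * h (l - Real.log |x ^ 2 - s| / 2)

theorem isWeight_one_sub_sq : IsWeight (-1) 1 univ (fun x => 1 - x ^ 2) (fun x => -(2 * x)) where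
  len := by norm_num
  smooth := by fun_prop
  smooth' := by fun_prop
  hasDeriv x := by simpa using (hasDerivAt_pow 2 x).const_sub 1
  pos x hx := by nlinarith [hx.1, hx.2]
  closed := isClosed_univ
  comparable := by
    refine ⟨2, by norm_num, fun x hx _ => ?_⟩
    have h1 : 0 < x - -1 := by linarith [hx.1]
    have h2 : 0 < 1 - x := by linarith [hx.2]
    rcases le_total (x - -1) (1 - x) with h | h
    · rw [endDist, min_eq_left h]; constructor <;> nlinarith
    · rw [endDist, min_eq_right h]; constructor <;> nlinarith

/-- Here `w` does not vanish at ±R. Comparability with the distance to the end points is only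
required on the support of the amplitude, which stays 1 away from them. -/
theorem isWeight_sq_add_one {R : ℝ} (hR : 3 ≤ R) :
    IsWeight (-R) R (Icc (-(R - 1)) (R - 1)) (fun x => x ^ 2 + 1) (fun x => 2 * x) where
  len := by linarith
  smooth := by fun_prop
  smooth' := by fun_prop
  hasDeriv x := by simpa using (hasDerivAt_pow 2 x).add_const 1
  pos x _ := by positivity
  closed := isClosed_Icc
  comparable := by
    refine ⟨R ^ 2 + R, by nlinarith, fun x hx hxS => ?_⟩
    have h1 : 1 ≤ x - -R := by linarith [hxS.1]
    have h2 : 1 ≤ R - x := by linarith [hxS.2]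
    have h3 : x ^ 2 ≤ R ^ 2 := sq_le_sq' hx.1.le hx.2.le
    have h4 : 1 ≤ endDist (-R) R x := le_min h1 h2
    have h5 : endDist (-R) R x ≤ 2 * R := (min_le_left _ _).trans (by linarith [hx.2])
    constructor <;> nlinarith [sq_nonneg x]

/-- Only the end point 1 is a genuine zero of the weight; the end point R is artificial and is kept
away from the support by `S`. -/
theorem isWeight_sq_sub_one {R : ℝ} (hR : 3 ≤ R) :
    IsWeight 1 R (Iic (R - 1)) (fun x => x ^ 2 - 1) (fun x => 2 * x) where
  len := by linarith
  smooth := by fun_prop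
  smooth' := by fun_prop
  hasDeriv x := by simpa using (hasDerivAt_pow 2 x).sub_const 1
  pos x hx := by nlinarith [hx.1]
  closed := isClosed_Iic
  comparable := by
    refine ⟨(R + 1) * R, by nlinarith, fun x hx hxS => ?_⟩
    have h1 : 0 < x - 1 := by linarith [hx.1]
    have h2 : 1 ≤ R - x := by have : x ≤ R - 1 := hxS; linarith
    have h4 : x - 1 ≤ R * endDist 1 R x := by
      rcases le_total (x - 1) (R - x) with h | h
      · rw [endDist, min_eq_left h]; nlinarith
      · rw [endDist, min_eq_right h]; nlinarith [hx.2]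
    have h5 : endDist 1 R x ≤ x - 1 := min_le_left _ _
    have h6 : 1 ≤ (R + 1) * R := by nlinarith
    have hw : x ^ 2 - 1 = (x + 1) * (x - 1) := by ring
    have hw1 : x - 1 ≤ x ^ 2 - 1 := by rw [hw]; nlinarith
    have hw2 : x ^ 2 - 1 ≤ (R + 1) * (x - 1) := by rw [hw]; nlinarith [hx.2]
    exact ⟨by nlinarith, by nlinarith⟩

theorem IsWeight.neg {a b : ℝ} {S : Set ℝ} {w w' : ℝ → ℝ} (hw : IsWeight a b S w w') :
    IsWeight (-b) (-a) (-S) (fun x => w (-x)) (fun x => -w' (-x)) where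
  len := by linarith [hw.len]
  smooth := hw.smooth.comp contDiff_neg
  smooth' := (hw.smooth'.comp contDiff_neg).neg
  hasDeriv x := by
    simpa using! (hw.hasDeriv (-x)).scomp x (hasDerivAt_neg x)
  pos x hx := hw.pos (-x) ⟨by linarith [hx.2], by linarith [hx.1]⟩
  closed := hw.closed.neg
  comparable := by
    obtain ⟨c, hc, h⟩ := hw.comparable
    refine ⟨c, hc, fun x hx hxS => ?_⟩
    have := h (-x) ⟨by linarith [hx.2], by linarith [hx.1]⟩ hxS
    have he : endDist (-b) (-a) x = endDist a b (-x) := by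
      rw [endDist, endDist, min_comm]
      congr 1 <;> ring
    rwa [he]

theorem IsWeight.realTerm_bound {a b s : ℝ} {S : Set ℝ} {w w' : ℝ → ℝ} (hw : IsWeight a b S w w')
    {P φ h : ℝ → ℂ} (hP : SmoothOn S P)
    (heq : ∀ x ∈ Ioo a b, |x ^ 2 - s| = w x ∧ φ x = P x) (hh : IsBoundedSymbol h) {α : ℝ}
    (hα : -1 < α) :
    (∀ l, IntervalIntegrable (realTerm s φ h α l) volume a b) ∧
    ∃ K, 0 ≤ K ∧ ∀ l ξ : ℝ,
      ‖∫ x in a..b, realTerm s φ h α l x * eInf (-(x * ξ))‖ ≤ K * (1 + |ξ|) ^ (-1 - α) := by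
  have hle : a ≤ b := by linarith [hw.len]
  have hcongr : ∀ l, EqOn (amplitude w P h α l) (realTerm s φ h α l) (Ioo a b) := by
    intro l x hx
    obtain ⟨h1, h2⟩ := heq x hx
    rw [realTerm, amplitude, h1, h2]
    ring
  have hbne : ∀ᵐ x : ℝ ∂volume, x ≠ b := by simp [ae_iff]
  refine ⟨fun l => ?_, ?_⟩
  · obtain ⟨H, rfl, hHd, hHb⟩ := hh
    have := hw.intervalIntegrable_amplitude hP
      (continuous_iff_continuousAt.2 fun x => (hHd 0 x).continuousAt) (hHb 0) hα l
    rw [intervalIntegrable_iff_integrableOn_Ioo_of_le hle] at this ⊢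
    exact this.congr_fun (hcongr l) measurableSet_Ioo
  · obtain ⟨K, hK0, hK⟩ := hw.norm_integral_le hh hα hP
    refine ⟨K, hK0, fun l ξ => ?_⟩
    rw [← intervalIntegral.integral_congr_ae (f := fun x => amplitude w P h α l x * eInf (-(x * ξ)))]
    · exact hK l ξ
    · filter_upwards [hbne] with x hxb hx
      rw [uIoc_of_le hle] at hx
      rw [hcongr l ⟨hx.1, lt_of_le_of_ne hx.2 hxb⟩]

/-- The Fourier transform of the archimedean factor decays like `(1 + |ξ|)^(-1 - α)`, uniformly
in the shift `l`. -/
theorem realTerm_fourier_bound {sgn : ℤˣ} {φ : ℝ → ℂ} (hφ : SmoothUpToBoundary sgn φ) {h : ℝ → ℂ}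
    (hh : IsBoundedSymbol h) {α : ℝ} (hα : -1 < α) :
    (∀ l, Integrable (realTerm ((sgn : ℤ) : ℝ) φ h α l)) ∧
    ∃ K, 0 ≤ K ∧ ∀ l ξ : ℝ,
      ‖∫ x, realTerm ((sgn : ℤ) : ℝ) φ h α l x * eInf (-(x * ξ))‖ ≤ K * (1 + |ξ|) ^ (-1 - α) := by
  obtain ⟨g₀, hg₀, hc₀, he₀⟩ := hφ 0
  obtain ⟨g₁, hg₁, hc₁, he₁⟩ := hφ 1
  simp only [regionX, if_true] at he₀
  simp only [regionX, one_ne_zero, if_false] at he₁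
  obtain ⟨R₀, hR₀⟩ := hc₀.isCompact.isBounded.subset_closedBall 0
  -- The summand 1 leaves a margin between the support and ±R; the value 3 makes (1, R) of length at
  -- least 2.
  set R := max (R₀ + 1) 3 with hR
  have hR3 : 3 ≤ R := le_max_right _ _
  have hsupp : Function.support g₀ ⊆ Icc (-(R - 1)) (R - 1) := by
    intro x hx
    have := hR₀ (subset_tsupport _ hx)
    rw [Metric.mem_closedBall, dist_zero_right, Real.norm_eq_abs] at this
    exact abs_le.1 (by linarith [le_max_left (R₀ + 1) 3])
  have hEc : ∀ ξ : ℝ, Continuous fun x : ℝ => eInf (-(x * ξ)) := fun ξ =>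
    continuous_eInf.comp (by fun_prop)
  have hone : |((sgn : ℤ) : ℝ)| = 1 := by
    rcases Int.units_eq_one_or sgn with rfl | rfl <;> simp
  have hφ0 : ∀ x, x ∉ Ioc (-R) R → φ x = 0 := by
    intro x hx
    have hxR : R ≤ |x| := by
      by_contra! hlt
      exact hx ⟨(abs_lt.1 hlt).1, (abs_lt.1 hlt).2.le⟩
    have hpos : 0 < x ^ 2 - ((sgn : ℤ) : ℝ) := by
      have := (abs_le.1 hone.le).2
      have : 9 ≤ x ^ 2 := by rw [← sq_abs]; nlinarith
      linarith
    rw [he₀ hpos]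
    by_contra hne
    have := hsupp hne
    have := abs_le.2 this
    linarith
  have hsup : ∀ l, Function.support (realTerm ((sgn : ℤ) : ℝ) φ h α l) ⊆ Ioc (-R) R := by
    intro l x hx
    by_contra hne
    exact hx (by simp [realTerm, hφ0 x hne])
  suffices H : (∀ l, IntervalIntegrable (realTerm ((sgn : ℤ) : ℝ) φ h α l) volume (-R) R) ∧
      ∃ K, 0 ≤ K ∧ ∀ l ξ : ℝ, ‖∫ x in (-R)..R, realTerm ((sgn : ℤ) : ℝ) φ h α l x *
        eInf (-(x * ξ))‖ ≤ K * (1 + |ξ|) ^ (-1 - α) by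
    refine ⟨fun l => ?_, ?_⟩
    · have := H.1 l
      rw [intervalIntegrable_iff_integrableOn_Ioc_of_le (by linarith)] at this
      exact (integrableOn_iff_integrable_of_support_subset (hsup l)).1 this
    · obtain ⟨K, hK0, hK⟩ := H.2
      refine ⟨K, hK0, fun l ξ => ?_⟩
      rw [← intervalIntegral.integral_eq_integral_of_support_subset
        ((Function.support_mul_subset_left _ _).trans (hsup l))]
      exact hK l ξ
  -- For the sign + the weight vanishes at ±1, and the line splits into (−R, −1), (−1, 1) and (1,
  -- R). For the sign − it never vanishes, the second region is empty, and one interval suffices.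
  rcases Int.units_eq_one_or sgn with rfl | rfl
  · simp only [Units.val_one, Int.cast_one] at he₀ he₁ ⊢
    have hP0 : SmoothOn (Iic (R - 1)) g₀ := ⟨hg₀, hsupp.trans Icc_subset_Iic_self⟩
    have hP0' : SmoothOn (-Iic (R - 1)) g₀ := ⟨hg₀, hsupp.trans fun x hx => by
      simp only [Set.mem_neg, mem_Iic]; linarith [hx.1]⟩
    have hP1 : SmoothOn univ g₁ := ⟨hg₁, subset_univ _⟩
    obtain ⟨hi₁, K₁, hK₁0, hK₁⟩ := (isWeight_sq_sub_one hR3).neg.realTerm_bound (s := 1) (φ := φ)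
      hP0' (fun x hx => by
        have : 0 < x ^ 2 - 1 := by nlinarith [hx.2]
        exact ⟨by rw [abs_of_pos this]; ring, he₀ this⟩) hh hα
    obtain ⟨hi₂, K₂, hK₂0, hK₂⟩ := isWeight_one_sub_sq.realTerm_bound (s := 1) (φ := φ)
      hP1 (fun x hx => by
        have : x ^ 2 - 1 < 0 := by nlinarith [hx.1, hx.2]
        exact ⟨by rw [abs_of_neg this]; ring, he₁ this⟩) hh hα
    obtain ⟨hi₃, K₃, hK₃0, hK₃⟩ := (isWeight_sq_sub_one hR3).realTerm_bound (s := 1) (φ := φ)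
      hP0 (fun x hx => by
        have : 0 < x ^ 2 - 1 := by nlinarith [hx.1]
        exact ⟨abs_of_pos this, he₀ this⟩) hh hα
    refine ⟨fun l => ((hi₁ l).trans (hi₂ l)).trans (hi₃ l), K₁ + (K₂ + K₃), by positivity,
      fun l ξ => ?_⟩
    have hj₁ := (hi₁ l).mul_continuousOn (hEc ξ).continuousOn
    have hj₂ := (hi₂ l).mul_continuousOn (hEc ξ).continuousOn
    have hj₃ := (hi₃ l).mul_continuousOn (hEc ξ).continuousOn
    rw [← intervalIntegral.integral_add_adjacent_intervals hj₁ (hj₂.trans hj₃),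
      ← intervalIntegral.integral_add_adjacent_intervals hj₂ hj₃, add_mul, add_mul]
    exact (norm_add_le _ _).trans (add_le_add (hK₁ l ξ) ((norm_add_le _ _).trans
      (add_le_add (hK₂ l ξ) (hK₃ l ξ))))
  · simp only [Units.val_neg, Units.val_one, Int.cast_neg, Int.cast_one] at he₀ ⊢
    exact (isWeight_sq_add_one hR3).realTerm_bound (s := -1) (φ := φ) ⟨hg₀, hsupp⟩ (fun x hx => by
        have : 0 < x ^ 2 - -1 := by nlinarith [sq_nonneg x]
        exact ⟨by rw [abs_of_pos this]; ring, he₀ this⟩) hh hα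

theorem integrable_abs_rpow_mul {sgn : ℤˣ} {φ : ℝ → ℂ} (hφ : SmoothUpToBoundary sgn φ) {α : ℝ}
    (hα : -1 < α) :
    Integrable fun x : ℝ => ((|x ^ 2 - ((sgn : ℤ) : ℝ)| ^ α : ℝ) : ℂ) * φ x := by
  refine ((realTerm_fourier_bound hφ (isBoundedSymbol_const 1) hα).1 0).congr
    (Eventually.of_forall fun x => ?_)
  simp [realTerm]

/-- A smooth compactly supported function has Fourier transform `O((1 + |ξ|)^(-2))`. -/
theorem fourier_bound_of_smooth {φ : ℝ → ℂ} (hφ : ContDiff ℝ ∞ φ) (hc : HasCompactSupport φ) :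
    ∃ K, 0 ≤ K ∧ ∀ ξ : ℝ, ‖∫ x, φ x * eInf (-(x * ξ))‖ ≤ K * (1 + |ξ|) ^ (-2 : ℝ) := by
  have hne : ∀ x : ℝ, (x : ℂ) ^ 2 + 1 ≠ 0 := fun x => by
    exact_mod_cast (by positivity : x ^ 2 + 1 ≠ 0)
  -- Dividing by x² + 1, which has no real zero, presents `φ` as an amplitude with α = 1 for the
  -- sign −. The exponent −1 − α is then −2.
  have h1 : SmoothUpToBoundary (-1) fun x => φ x * ((x : ℂ) ^ 2 + 1)⁻¹ := by
    intro i
    refine ⟨_, ?_, hc.mul_right, fun x _ => rfl⟩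
    have : ContDiff ℝ ∞ fun x : ℝ => (x : ℂ) := Complex.ofRealCLM.contDiff
    exact hφ.mul (((this.pow 2).add contDiff_const).inv hne)
  obtain ⟨-, K, hK0, hK⟩ := realTerm_fourier_bound h1 (isBoundedSymbol_const 1)
    (α := 1) (by norm_num)
  refine ⟨K, hK0, fun ξ => ?_⟩
  have h2 := hK 0 ξ
  norm_num [realTerm] at h2
  rw [Real.rpow_neg (by positivity), Real.rpow_two]
  convert h2 using 4 with x
  have h3 : |x ^ 2 + 1| = x ^ 2 + 1 := abs_of_pos (by positivity)
  rw [h3]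
  push_cast
  field_simp [hne x]

/-- If `φ` is smooth on `ℝ` and smooth up to the boundary, then it has compact support. -/
theorem SmoothUpToBoundary.hasCompactSupport {sgn : ℤˣ} {φ : ℝ → ℂ}
    (hφ : SmoothUpToBoundary sgn φ) : HasCompactSupport φ := by
  obtain ⟨g, -, hc, he⟩ := hφ 0
  refine HasCompactSupport.intro (K := tsupport g ∪ Icc (-1) 1)
    (hc.isCompact.union isCompact_Icc) fun x hx => ?_
  simp only [mem_union, not_or] at hx
  have h1 : 1 < x ^ 2 := by
    by_contra! hle
    exact hx.2 (abs_le.1 (by rwa [← sq_le_one_iff_abs_le_one]))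
  have h2 : x ∈ regionX sgn 0 := by
    simp only [regionX, if_true, mem_ofPred_eq]
    rcases Int.units_eq_one_or sgn with rfl | rfl <;> push_cast <;> linarith
  rw [he h2]
  exact image_eq_zero_of_notMem_tsupport hx.1

/-! ### The additive character of `ℚ_p` -/

theorem eInf_add (x y : ℝ) : eInf (x + y) = eInf x * eInf y := by
  rw [eInf, eInf, eInf, ← Complex.exp_add]
  congr 1
  push_cast
  ring

theorem eInf_eq_one_iff (x : ℝ) : eInf x = 1 ↔ ∃ m : ℤ, x = m := by
  rw [eInf, Complex.exp_eq_one_iff]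
  refine exists_congr fun m => ⟨fun h => ?_, fun h => by rw [h]; push_cast; ring⟩
  have h1 : (2 * Real.pi * Complex.I : ℂ) ≠ 0 := by simp [Real.pi_ne_zero]
  have h2 : (x : ℂ) = m := mul_left_cancel₀ h1 (by rw [h]; ring)
  exact_mod_cast h2

section Padic

variable {p : ℕ} [Fact p.Prime]

theorem prime_pos' : (0 : ℝ) < p := by exact_mod_cast (Fact.out : p.Prime).pos

theorem one_lt_prime' : (1 : ℝ) < p := by exact_mod_cast (Fact.out : p.Prime).one_lt

/-- Multiplication by p^k with k = max(0, −v(x)) makes `x` integral, and its first k digits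
approximate it to within p^(−k). Dividing back by p^k leaves an error of norm at most 1. -/
theorem padicFract_spec (x : ℚ_[p]) :
    ∃ a k : ℕ, padicFract p x = (a : ℚ) / (p : ℚ) ^ k ∧
      ‖x - ((padicFract p x : ℚ) : ℚ_[p])‖ ≤ 1 := by
  set k : ℕ := (-x.valuation).toNat with hk
  have hp0 : (p : ℚ_[p]) ≠ 0 := by exact_mod_cast (Fact.out : p.Prime).ne_zero
  have hz : ‖(p : ℚ_[p]) ^ k * x‖ ≤ 1 := by
    rcases eq_or_ne x 0 with rfl | hx
    · simp
    · rw [norm_mul, norm_pow, Padic.norm_p, Padic.norm_eq_zpow_neg_valuation hx, inv_pow,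
        ← zpow_natCast, ← zpow_neg, ← zpow_add₀ prime_pos'.ne']
      refine zpow_le_one_of_nonpos₀ one_lt_prime'.le ?_
      have := Int.self_le_toNat (-x.valuation)
      omega
  have hfr : padicFract p x =
      (PadicInt.appr (⟨(p : ℚ_[p]) ^ k * x, hz⟩ : ℤ_[p]) k : ℚ) / (p : ℚ) ^ k := by
    simp only [padicFract]
    exact dif_pos hz
  refine ⟨_, k, hfr, ?_⟩
  set z : ℤ_[p] := ⟨(p : ℚ_[p]) ^ k * x, hz⟩ with hzdef
  have h1 : ‖z - (z.appr k : ℤ_[p])‖ ≤ (p : ℝ) ^ (-(k : ℤ)) :=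
    (PadicInt.norm_le_pow_iff_mem_span_pow _ _).2 (PadicInt.appr_spec k z)
  have h2 : x - ((padicFract p x : ℚ) : ℚ_[p]) =
      ((z - (z.appr k : ℤ_[p]) : ℤ_[p]) : ℚ_[p]) / (p : ℚ_[p]) ^ k := by
    rw [hfr, eq_div_iff (pow_ne_zero _ hp0)]
    push_cast
    rw [sub_mul, div_mul_cancel₀ _ (pow_ne_zero _ hp0), hzdef]
    simp [mul_comm]
  rw [h2, norm_div, norm_pow, Padic.norm_p, PadicInt.norm_def.symm, div_le_one (by
    have := prime_pos' (p := p); positivity), inv_pow, ← zpow_natCast, ← zpow_neg]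
  exact h1

/-- A rational number with `p`-power denominator that is a `p`-adic integer is an integer. -/
theorem exists_int_of_norm_le_one {w : ℚ} {m : ℤ} {k : ℕ} (hw : w = m / (p : ℚ) ^ k)
    (h : ‖(w : ℚ_[p])‖ ≤ 1) : ∃ j : ℤ, w = j := by
  have hp0 : (p : ℚ) ≠ 0 := by exact_mod_cast (Fact.out : p.Prime).ne_zero
  have hpp := prime_pos' (p := p)
  have h1 : ‖(m : ℚ_[p])‖ ≤ (p : ℝ) ^ (-(k : ℤ)) := by
    rw [hw] at h
    push_cast at h
    rw [norm_div, norm_pow, Padic.norm_p, div_le_one (by positivity), inv_pow] at h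
    rwa [zpow_neg, zpow_natCast]
  obtain ⟨j, hj⟩ := (Padic.norm_int_le_pow_iff_dvd m k).1 h1
  refine ⟨j, ?_⟩
  rw [hw, hj]
  push_cast
  field_simp

/-- The defect of additivity of the fractional part is a rational number with p-power denominator
that is also a p-adic integer, hence an integer, and `eInf` does not see it. -/
theorem ePadic_add (x y : ℚ_[p]) : ePadic p (x + y) = ePadic p x * ePadic p y := by
  obtain ⟨a, k, ha, hx⟩ := padicFract_spec x
  obtain ⟨b, l, hb, hy⟩ := padicFract_spec y
  obtain ⟨c, m, hc, hxy⟩ := padicFract_spec (x + y)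
  have hp0 : (p : ℚ) ≠ 0 := by exact_mod_cast (Fact.out : p.Prime).ne_zero
  obtain ⟨j, hj⟩ := exists_int_of_norm_le_one (p := p)
    (w := padicFract p x + padicFract p y - padicFract p (x + y))
    (m := a * p ^ (l + m) + b * p ^ (k + m) - c * p ^ (k + l)) (k := k + l + m)
    (by
      rw [ha, hb, hc]
      push_cast
      field_simp
      ring)
    (by
      have h1 : ((padicFract p x + padicFract p y - padicFract p (x + y) : ℚ) : ℚ_[p]) =
          (x + y - ((padicFract p (x + y) : ℚ) : ℚ_[p])) +
          -((x - ((padicFract p x : ℚ) : ℚ_[p])) + (y - ((padicFract p y : ℚ) : ℚ_[p]))) := by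
        push_cast
        ring
      rw [h1]
      refine (Padic.nonarchimedean _ _).trans (max_le hxy ?_)
      rw [norm_neg]
      exact (Padic.nonarchimedean _ _).trans (max_le hx hy))
  have h2 : -((padicFract p (x + y) : ℚ) : ℝ) =
      -((padicFract p x : ℚ) : ℝ) + -((padicFract p y : ℚ) : ℝ) + (j : ℝ) := by
    have : padicFract p (x + y) = padicFract p x + padicFract p y - j := by linarith
    rw [this]
    push_cast
    ring
  rw [ePadic, ePadic, ePadic, h2, eInf_add, eInf_add, (eInf_eq_one_iff j).2 ⟨j, rfl⟩, mul_one]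

/-- An argument differs from its fractional part by a p-adic integer. The kernel being exactly ℤ_p
serves twice: it gives local constancy of the character, and it supplies translations on which the
character is nontrivial. -/
theorem ePadic_eq_one_iff (x : ℚ_[p]) : ePadic p x = 1 ↔ ‖x‖ ≤ 1 := by
  obtain ⟨a, k, ha, hx⟩ := padicFract_spec x
  constructor
  · intro h
    obtain ⟨m, hm⟩ := (eInf_eq_one_iff _).1 h
    have h1 : padicFract p x = ((-m : ℤ) : ℚ) := by
      have : ((padicFract p x : ℚ) : ℝ) = ((-m : ℤ) : ℝ) := by push_cast; linarith
      exact_mod_cast this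
    have h2 : ‖((padicFract p x : ℚ) : ℚ_[p])‖ ≤ 1 := by
      rw [h1, Rat.cast_intCast]
      exact Padic.norm_int_le_one _
    rw [← sub_add_cancel x ((padicFract p x : ℚ) : ℚ_[p])]
    exact (Padic.nonarchimedean _ _).trans (max_le hx h2)
  · intro h
    obtain ⟨j, hj⟩ := exists_int_of_norm_le_one (p := p) (w := padicFract p x) (m := a) (k := k)
      (by rw [ha]; push_cast; rfl) (by
        have h1 : ((padicFract p x : ℚ) : ℚ_[p]) = x + -(x - ((padicFract p x : ℚ) : ℚ_[p])) := by
          ring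
        rw [h1]
        exact (Padic.nonarchimedean _ _).trans (max_le h (by rwa [norm_neg])))
    rw [ePadic, eInf_eq_one_iff]
    exact ⟨-j, by rw [hj]; push_cast; rfl⟩

theorem norm_ePadic (x : ℚ_[p]) : ‖ePadic p x‖ = 1 := norm_eInf _

theorem continuous_ePadic : Continuous (ePadic p) := by
  refine IsLocallyConstant.continuous ((IsLocallyConstant.iff_eventually_eq _).2 fun x => ?_)
  filter_upwards [Metric.closedBall_mem_nhds x one_pos] with y hy
  rw [Metric.mem_closedBall, dist_eq_norm] at hy
  rw [← sub_add_cancel y x, ePadic_add, (ePadic_eq_one_iff _).2 hy, one_mul]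

/-! ### Local constancy of the modified norm and of the symbol -/

/-- `D'` is so close to `D` that `D'/D` is a square. -/
def PadicClose (D D' : ℚ_[p]) : Prop := D ≠ 0 ∧ ‖D' - D‖ ≤ ‖D‖ * (p : ℝ) ^ (-3 : ℤ)

theorem zpow_neg_three_lt_one : (p : ℝ) ^ (-3 : ℤ) < 1 :=
  zpow_lt_one_of_neg₀ one_lt_prime' (by norm_num)

namespace PadicClose

variable {D D' : ℚ_[p]}

theorem norm_eq (h : PadicClose D D') : ‖D'‖ = ‖D‖ := by
  have h0 : 0 < ‖D‖ := norm_pos_iff.2 h.1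
  have h1 : ‖D' - D‖ < ‖D‖ := h.2.trans_lt (mul_lt_of_lt_one_right h0 zpow_neg_three_lt_one)
  have h2 := Padic.add_eq_max_of_ne (q := D' - D) (r := D) h1.ne
  rwa [sub_add_cancel, max_eq_right h1.le] at h2

theorem ne_zero (h : PadicClose D D') : D' ≠ 0 := by
  rw [← norm_pos_iff, h.norm_eq]
  exact norm_pos_iff.2 h.1

theorem valuation_eq (h : PadicClose D D') : D'.valuation = D.valuation := by
  have h1 := h.norm_eq
  rw [Padic.norm_eq_zpow_neg_valuation h.1, Padic.norm_eq_zpow_neg_valuation h.ne_zero] at h1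
  have := zpow_right_injective₀ prime_pos' one_lt_prime'.ne' h1
  simpa using this

theorem norm_mul_zpow (h : PadicClose D D') :
    ‖D' * (p : ℚ_[p]) ^ (-D.valuation) - D * (p : ℚ_[p]) ^ (-D.valuation)‖ ≤
      (p : ℝ) ^ (-3 : ℤ) := by
  rw [← sub_mul, norm_mul, Padic.norm_p_zpow, neg_neg]
  have hpp := prime_pos' (p := p)
  calc ‖D' - D‖ * (p : ℝ) ^ D.valuation ≤ (‖D‖ * (p : ℝ) ^ (-3 : ℤ)) * (p : ℝ) ^ D.valuation := by
        gcongr; exact h.2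
    _ = _ := by
        rw [Padic.norm_eq_zpow_neg_valuation h.1, mul_right_comm, ← zpow_add₀ hpp.ne',
          neg_add_cancel, zpow_zero, one_mul]

theorem modNormExp_eq (h : PadicClose D D') : modNormExp p D' = modNormExp p D := by
  unfold modNormExp
  rw [h.valuation_eq]
  split_ifs with h2 _ h3 h4 h4
  · rfl
  · exfalso
    refine h4 ?_
    -- For p = 2 the unit parts differ by at most 2^(−3) ≤ 1/4, so the residue modulo 4 cannot
    -- change.
    have : D * (p : ℚ_[p]) ^ (-D.valuation) - 1 =
        -(D' * (p : ℚ_[p]) ^ (-D.valuation) - D * (p : ℚ_[p]) ^ (-D.valuation)) +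
        (D' * (p : ℚ_[p]) ^ (-D.valuation) - 1) := by ring
    rw [this]
    refine (Padic.nonarchimedean _ _).trans (max_le ?_ h3)
    rw [norm_neg]
    refine h.norm_mul_zpow.trans ?_
    rw [h2]
    norm_num
  · exfalso
    refine h3 ?_
    have : D' * (p : ℚ_[p]) ^ (-D.valuation) - 1 =
        (D' * (p : ℚ_[p]) ^ (-D.valuation) - D * (p : ℚ_[p]) ^ (-D.valuation)) +
        (D * (p : ℚ_[p]) ^ (-D.valuation) - 1) := by ring
    rw [this]
    refine (Padic.nonarchimedean _ _).trans (max_le (h.norm_mul_zpow.trans ?_) h4)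
    rw [h2]
    norm_num
  all_goals rfl

theorem modNorm_eq (h : PadicClose D D') : modNorm p D' = modNorm p D := by
  rw [modNorm, modNorm, if_neg h.1, if_neg h.ne_zero, h.modNormExp_eq]

end PadicClose

/-- The symbol only sees the residue modulo p for odd p and modulo 8 for p = 2; agreement modulo p³
covers both. -/
theorem kroneckerPadic_congr {x y : ℤ_[p]} (h : ‖x - y‖ ≤ (p : ℝ) ^ (-3 : ℤ)) :
    kroneckerPadic p x = kroneckerPadic p y := by
  have h1 : x.appr 3 = y.appr 3 := by
    have h2 : PadicInt.toZModPow 3 x = PadicInt.toZModPow 3 y := by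
      rw [← sub_eq_zero, ← map_sub, ← RingHom.mem_ker, PadicInt.ker_toZModPow]
      exact (PadicInt.norm_le_pow_iff_mem_span_pow _ _).1 (by simpa using h)
    have h3 : ((x.appr 3 : ℕ) : ZMod (p ^ 3)) = ((y.appr 3 : ℕ) : ZMod (p ^ 3)) := h2
    rw [ZMod.natCast_eq_natCast_iff] at h3
    exact Nat.ModEq.eq_of_lt_of_lt h3 (PadicInt.appr_lt x 3) (PadicInt.appr_lt y 3)
  have h4 : PadicInt.toZMod x = PadicInt.toZMod y := by
    rw [← sub_eq_zero, ← map_sub, ← RingHom.mem_ker, PadicInt.ker_toZMod,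
      IsLocalRing.mem_maximalIdeal, PadicInt.mem_nonunits]
    exact h.trans_lt zpow_neg_three_lt_one
  unfold kroneckerPadic
  rw [h1, h4]

/-- The symbol `ω` as a function of the discriminant. -/
def discSymbol (p : ℕ) [Fact p.Prime] (D : ℚ_[p]) : ℤ :=
  if h : ‖D * (p : ℚ_[p]) ^ modNormExp p D‖ ≤ 1 then
    kroneckerPadic p ⟨D * (p : ℚ_[p]) ^ modNormExp p D, h⟩ else 0

/-- When the normalised discriminant is integral, a relative error p^(−3) is an absolute error of at
most p^(−3), which the Kronecker symbol ignores. -/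
theorem PadicClose.discSymbol_eq {D D' : ℚ_[p]} (h : PadicClose D D') :
    discSymbol p D' = discSymbol p D := by
  have hn : ‖D' * (p : ℚ_[p]) ^ modNormExp p D'‖ = ‖D * (p : ℚ_[p]) ^ modNormExp p D‖ := by
    rw [h.modNormExp_eq, norm_mul, norm_mul, h.norm_eq]
  unfold discSymbol
  by_cases h1 : ‖D * (p : ℚ_[p]) ^ modNormExp p D‖ ≤ 1
  · rw [dif_pos h1, dif_pos (hn.trans_le h1)]
    refine kroneckerPadic_congr ?_
    change ‖D' * (p : ℚ_[p]) ^ modNormExp p D' - D * (p : ℚ_[p]) ^ modNormExp p D‖ ≤ _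
    have hp3 : (0 : ℝ) ≤ (p : ℝ) ^ (-3 : ℤ) := zpow_nonneg prime_pos'.le _
    rw [h.modNormExp_eq, ← sub_mul, norm_mul]
    calc _ ≤ (‖D‖ * (p : ℝ) ^ (-3 : ℤ)) * ‖(p : ℚ_[p]) ^ modNormExp p D‖ := by
          gcongr; exact h.2
      _ = ‖D * (p : ℚ_[p]) ^ modNormExp p D‖ * (p : ℝ) ^ (-3 : ℤ) := by rw [norm_mul]; ring
      _ ≤ 1 * (p : ℝ) ^ (-3 : ℤ) := by gcongr
      _ = _ := one_mul _
  · rw [dif_neg h1, dif_neg (by rwa [hn])]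

theorem mem_regionY {N : ℚ} {e : ℤ} {y : ℚ_[p]} :
    y ∈ regionY p N e ↔ y ^ 2 - 4 * (N : ℚ_[p]) ≠ 0 ∧ discSymbol p (y ^ 2 - 4 * (N : ℚ_[p])) = e := by
  rw [sub_ne_zero]
  rfl

/-- Such a function is locally constant, hence continuous, away from 0, and one point does not
affect measurability. -/
theorem measurable_of_padicClose {β : Type*} [TopologicalSpace β] [MeasurableSpace β]
    [BorelSpace β] {f : ℚ_[p] → β} (h : ∀ D D', PadicClose D D' → f D' = f D) : Measurable f := by
  refine measurable_of_continuousOn_compl_singleton 0 fun D hD => ?_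
  have hD0 : 0 < ‖D‖ := norm_pos_iff.2 hD
  have hr : 0 < ‖D‖ * (p : ℝ) ^ (-3 : ℤ) := mul_pos hD0 (zpow_pos prime_pos' _)
  refine (ContinuousAt.congr (f := fun _ => f D) continuousAt_const ?_).continuousWithinAt
  filter_upwards [Metric.closedBall_mem_nhds D hr] with D' hD'
  rw [Metric.mem_closedBall, dist_eq_norm] at hD'
  exact (h D D' ⟨hD, hD'⟩).symm

theorem measurable_modNorm : Measurable (modNorm p) :=
  measurable_of_padicClose fun _ _ h => h.modNorm_eq

theorem measurable_discSymbol : Measurable (discSymbol p) :=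
  measurable_of_padicClose fun _ _ h => h.discSymbol_eq

theorem continuous_disc (N : ℚ) : Continuous fun y : ℚ_[p] => y ^ 2 - 4 * (N : ℚ_[p]) := by
  fun_prop

theorem measurableSet_regionY (N : ℚ) (e : ℤ) : MeasurableSet (regionY p N e) := by
  have h1 : regionY p N e = (fun y : ℚ_[p] => y ^ 2 - 4 * (N : ℚ_[p])) ⁻¹'
      ({0}ᶜ ∩ discSymbol p ⁻¹' {e}) := by
    ext y
    rw [mem_regionY]
    rfl
  rw [h1]
  exact (continuous_disc N).measurable ((measurableSet_singleton 0).compl.inter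
    (measurable_discSymbol (measurableSet_singleton e)))

/-- In every case of the definition the exponent exceeds −v(D) by an integer between 0 and 3. -/
theorem modNorm_comparable {D : ℚ_[p]} (hD : D ≠ 0) :
    ‖D‖ ≤ (p : ℝ) ^ 3 * modNorm p D ∧ modNorm p D ≤ (p : ℝ) ^ 3 * ‖D‖ := by
  have hpp := prime_pos' (p := p)
  have hp1 := one_lt_prime' (p := p)
  have h1 : 0 ≤ modNormExp p D + D.valuation ∧ modNormExp p D + D.valuation ≤ 3 := by
    unfold modNormExp
    split_ifs <;> omega
  rw [modNorm, if_neg hD, Padic.norm_eq_zpow_neg_valuation hD, ← zpow_natCast,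
    ← zpow_add₀ hpp.ne', ← zpow_add₀ hpp.ne']
  constructor <;> refine zpow_le_zpow_right₀ hp1.le ?_ <;> push_cast <;> omega

theorem modNorm_pos {D : ℚ_[p]} (hD : D ≠ 0) : 0 < modNorm p D := by
  rw [modNorm, if_neg hD]
  exact zpow_pos prime_pos' _

theorem modNorm_nonneg (D : ℚ_[p]) : 0 ≤ modNorm p D := by
  rcases eq_or_ne D 0 with rfl | hD
  · simp [modNorm]
  · exact (modNorm_pos hD).le

theorem modNorm_rpow_le {D : ℚ_[p]} (hD : D ≠ 0) (s : ℝ) :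
    modNorm p D ^ s ≤ ((p : ℝ) ^ 3) ^ |s| * ‖D‖ ^ s :=
  rpow_le_of_comparable (one_le_pow₀ one_lt_prime'.le) (norm_pos_iff.2 hD) (modNorm_pos hD)
    (modNorm_comparable hD).1 (modNorm_comparable hD).2 s

end Padic

section Volume

variable {p : ℕ} [Fact p.Prime]

/-! ### Volumes in `ℚ_p` -/

theorem padicHaar_unitBall : padicHaar p (Metric.closedBall 0 1) = 1 :=
  Measure.addHaarMeasure_self (K₀ := padicUnitBall p)

/-- The translates of p^k ℤ_p by 0, …, p^k − 1 are disjoint, of equal volume, and contained in ℤ_p.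
-/
theorem padicHaar_closedBall_pow_le (k : ℕ) :
    padicHaar p (Metric.closedBall 0 ((p : ℝ) ^ (-(k : ℤ)))) ≤
      ENNReal.ofReal ((p : ℝ) ^ (-(k : ℤ))) := by
  have hpp := prime_pos' (p := p)
  set A : Set ℚ_[p] := Metric.closedBall 0 ((p : ℝ) ^ (-(k : ℤ))) with hA
  set T : ℕ → Set ℚ_[p] := fun i => (fun y => -(i : ℚ_[p]) + y) ⁻¹' A with hT
  have hTm : ∀ i, MeasurableSet (T i) := fun i =>
    (measurable_const_add _) Metric.isClosed_closedBall.measurableSet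
  have hmem : ∀ i y, y ∈ T i ↔ ‖-(i : ℚ_[p]) + y‖ ≤ (p : ℝ) ^ (-(k : ℤ)) := fun i y => by
    rw [hT, mem_preimage, hA, Metric.mem_closedBall, dist_zero_right]
  have hdisj : ((Finset.range (p ^ k) : Finset ℕ) : Set ℕ).PairwiseDisjoint T := by
    intro i hi j hj hij
    refine Set.disjoint_left.2 fun y hyi hyj => hij ?_
    rw [hmem] at hyi hyj
    have h1 : ‖(((j : ℤ) - (i : ℤ) : ℤ) : ℚ_[p])‖ ≤ (p : ℝ) ^ (-(k : ℤ)) := by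
      have : (((j : ℤ) - (i : ℤ) : ℤ) : ℚ_[p]) =
          (-(i : ℚ_[p]) + y) + -(-(j : ℚ_[p]) + y) := by push_cast; ring
      rw [this]
      exact (Padic.nonarchimedean _ _).trans (max_le hyi (by rwa [norm_neg]))
    rw [Padic.norm_int_le_pow_iff_dvd] at h1
    have h2 : i ≡ j [MOD p ^ k] := by
      rw [Nat.modEq_iff_dvd]
      exact_mod_cast h1
    exact Nat.ModEq.eq_of_lt_of_lt h2 (by simpa using hi) (by simpa using hj)
  have hsub : (⋃ i ∈ Finset.range (p ^ k), T i) ⊆ Metric.closedBall 0 1 := by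
    intro y hy
    simp only [mem_iUnion] at hy
    obtain ⟨i, -, hi⟩ := hy
    rw [hmem] at hi
    rw [Metric.mem_closedBall, dist_zero_right]
    have : y = (i : ℚ_[p]) + (-(i : ℚ_[p]) + y) := by ring
    rw [this]
    refine (Padic.nonarchimedean _ _).trans (max_le ?_ (hi.trans ?_))
    · exact_mod_cast Padic.norm_int_le_one (i : ℤ)
    · exact zpow_le_one_of_nonpos₀ one_lt_prime'.le (by simp)
  have h1 := measure_mono (μ := padicHaar p) hsub
  rw [measure_biUnion_finset hdisj fun i _ => hTm i, padicHaar_unitBall] at h1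
  simp only [hT, measure_preimage_add, Finset.sum_const, Finset.card_range, nsmul_eq_mul] at h1
  rw [zpow_neg, zpow_natCast, ENNReal.ofReal_inv_of_pos (by positivity),
    ENNReal.ofReal_pow hpp.le, ENNReal.ofReal_natCast]
  rw [ENNReal.le_inv_iff_mul_le, mul_comm]
  exact_mod_cast h1

theorem padicHaar_closedBall_le (x : ℚ_[p]) {δ : ℝ} (hδ : 0 < δ) (hδ1 : δ ≤ 1) :
    padicHaar p (Metric.closedBall x δ) ≤ ENNReal.ofReal (p * δ) := by
  have hpp := prime_pos' (p := p)
  have hx : padicHaar p (Metric.closedBall x δ) = padicHaar p (Metric.closedBall 0 δ) := by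
    rw [← measure_preimage_add (padicHaar p) x (Metric.closedBall x δ)]
    congr 1
    ext y
    simp [dist_eq_norm]
  rw [hx]
  obtain ⟨k, hk1, hk2⟩ := exists_nat_pow_near_of_lt_one hδ hδ1 (inv_pos.2 hpp)
    (inv_lt_one_of_one_lt₀ one_lt_prime')
  have h1 : δ ≤ (p : ℝ) ^ (-(k : ℤ)) := by rwa [zpow_neg, zpow_natCast, ← inv_pow]
  refine (measure_mono (Metric.closedBall_subset_closedBall h1)).trans
    ((padicHaar_closedBall_pow_le k).trans (ENNReal.ofReal_le_ofReal ?_))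
  rw [zpow_neg, zpow_natCast, ← inv_pow]
  rw [pow_succ] at hk1
  calc ((p : ℝ)⁻¹) ^ k = p * ((p : ℝ)⁻¹ ^ k * (p : ℝ)⁻¹) := by field_simp
    _ ≤ p * δ := by gcongr

/-- The part of the ball of radius `B` on which the discriminant is small has small volume. -/
theorem volume_disc_le {κ : ℝ} (hκ : 0 < κ) (B : ℝ) :
    ∃ K, 0 ≤ K ∧ ∀ N : ℚ, ‖(N : ℚ_[p])‖ = κ → ∀ δ : ℝ, 0 < δ →
      padicHaar p {y : ℚ_[p] | ‖y‖ ≤ B ∧ ‖y ^ 2 - 4 * (N : ℚ_[p])‖ ≤ δ} ≤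
        ENNReal.ofReal (K * δ) := by
  have hpp := prime_pos' (p := p)
  set κ4 : ℝ := ‖(4 : ℚ_[p])‖ * κ with hκ4
  have h4 : 0 < κ4 := mul_pos (norm_pos_iff.2 (by norm_num)) hκ
  set m : ℝ := ‖(2 : ℚ_[p])‖ * √κ4 with hm
  have hm0 : 0 < m := mul_pos (norm_pos_iff.2 (by norm_num)) (Real.sqrt_pos.2 h4)
  set V : ℝ := (padicHaar p (Metric.closedBall 0 B)).toReal with hV
  have hV0 : 0 ≤ V := ENNReal.toReal_nonneg
  have hVB : padicHaar p (Metric.closedBall 0 B) = ENNReal.ofReal V :=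
    (ENNReal.ofReal_toReal (isCompact_closedBall (0 : ℚ_[p]) B).measure_lt_top.ne).symm
  -- One summand for each regime: δ at least |4N|, δ larger than m, and δ small. In the first two
  -- the volume of the whole ball is a good enough bound.
  refine ⟨V / κ4 + V / m + 2 * p / m, by positivity, fun N hN δ hδ => ?_⟩
  have htriv : padicHaar p {y : ℚ_[p] | ‖y‖ ≤ B ∧ ‖y ^ 2 - 4 * (N : ℚ_[p])‖ ≤ δ} ≤
      ENNReal.ofReal V := by
    rw [← hVB]
    exact measure_mono fun y hy => by simpa using hy.1
  rcases le_or_gt κ4 δ with h | h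
  · refine htriv.trans (ENNReal.ofReal_le_ofReal ?_)
    calc V = V / κ4 * κ4 := by field_simp
      _ ≤ (V / κ4 + V / m + 2 * p / m) * δ := by
        gcongr
        rw [add_assoc]
        exact le_add_of_nonneg_right (by positivity)
  rcases lt_or_ge m δ with h' | h'
  · refine htriv.trans (ENNReal.ofReal_le_ofReal ?_)
    calc V = V / m * m := by field_simp
      _ ≤ (V / κ4 + V / m + 2 * p / m) * δ := by
        gcongr
        rw [add_right_comm, add_comm]
        exact le_add_of_nonneg_right (by positivity)
  by_cases hne : ∃ y₁ : ℚ_[p], ‖y₁ ^ 2 - 4 * (N : ℚ_[p])‖ ≤ δ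
  · obtain ⟨y₁, hy₁⟩ := hne
    have hnorm4 : ‖4 * (N : ℚ_[p])‖ = κ4 := by rw [norm_mul, hN]
    -- The difference y₁² − 4N is smaller than 4N, so the ultrametric inequality forces |y₁|² =
    -- |4N|.
    have hy₁n : ‖y₁‖ = √κ4 := by
      have h1 : ‖y₁ ^ 2‖ = κ4 := by
        have h2 := Padic.add_eq_max_of_ne (q := y₁ ^ 2 - 4 * (N : ℚ_[p])) (r := 4 * (N : ℚ_[p]))
          (by rw [hnorm4]; exact (hy₁.trans_lt h).ne)
        rwa [sub_add_cancel, hnorm4, max_eq_right (hy₁.trans h.le)] at h2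
      rw [← h1, norm_pow, Real.sqrt_sq (norm_nonneg _)]
    have h2y : ‖2 * y₁‖ = m := by rw [norm_mul, hy₁n]
    have hsub : {y : ℚ_[p] | ‖y‖ ≤ B ∧ ‖y ^ 2 - 4 * (N : ℚ_[p])‖ ≤ δ} ⊆
        Metric.closedBall y₁ (δ / m) ∪ Metric.closedBall (-y₁) (δ / m) := by
      rintro y ⟨-, hy⟩
      have h1 : ‖y - y₁‖ * ‖y + y₁‖ ≤ δ := by
        rw [← norm_mul]
        have : (y - y₁) * (y + y₁) =
            (y ^ 2 - 4 * (N : ℚ_[p])) + -(y₁ ^ 2 - 4 * (N : ℚ_[p])) := by ring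
        rw [this]
        exact (Padic.nonarchimedean _ _).trans (max_le hy (by rwa [norm_neg]))
      -- One of y ± y₁ has norm at least |2y₁| = m. Since the product of the two has norm at most δ,
      -- the other is at most δ/m, so `y` lies near y₁ or −y₁.
      have h2 : m ≤ max ‖y + y₁‖ ‖y - y₁‖ := by
        rw [← h2y]
        have : 2 * y₁ = (y + y₁) + -(y - y₁) := by ring
        rw [this]
        refine (Padic.nonarchimedean _ _).trans (by rw [norm_neg])
      rw [mem_union, Metric.mem_closedBall, Metric.mem_closedBall, dist_eq_norm, dist_eq_norm,
        sub_neg_eq_add, le_div_iff₀ hm0, le_div_iff₀ hm0]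
      rcases le_max_iff.1 h2 with h3 | h3
      · left
        exact (mul_le_mul_of_nonneg_left h3 (norm_nonneg _)).trans h1
      · right
        rw [mul_comm] at h1
        exact (mul_le_mul_of_nonneg_left h3 (norm_nonneg _)).trans h1
    have hδm : 0 < δ / m := by positivity
    have hδm1 : δ / m ≤ 1 := (div_le_one hm0).2 h'
    refine (measure_mono hsub).trans ((measure_union_le _ _).trans ?_)
    refine (add_le_add (padicHaar_closedBall_le _ hδm hδm1)
      (padicHaar_closedBall_le _ hδm hδm1)).trans ?_
    rw [← ENNReal.ofReal_add (by positivity) (by positivity)]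
    refine ENNReal.ofReal_le_ofReal ?_
    calc p * (δ / m) + p * (δ / m) = (2 * p / m) * δ := by ring
      _ ≤ _ := by
        gcongr
        exact le_add_of_nonneg_left (by positivity)
  · have : {y : ℚ_[p] | ‖y‖ ≤ B ∧ ‖y ^ 2 - 4 * (N : ℚ_[p])‖ ≤ δ} = ∅ := by
      ext y
      simp only [mem_ofPred_eq, mem_empty_iff_false, iff_false, not_and]
      exact fun _ hy => hne ⟨y, hy⟩
    rw [this, measure_empty]
    exact zero_le

/-- The region on which the discriminant is at most `T`. -/
def smallDisc (p : ℕ) [Fact p.Prime] (N : ℚ) (B T : ℝ) : Set ℚ_[p] :=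
  {y : ℚ_[p] | ‖y‖ ≤ B ∧ ‖y ^ 2 - 4 * (N : ℚ_[p])‖ ≤ T}

theorem measurableSet_smallDisc (N : ℚ) (B T : ℝ) : MeasurableSet (smallDisc p N B T) :=
  ((isClosed_le continuous_norm continuous_const).inter
    (isClosed_le (continuous_disc N).norm continuous_const)).measurableSet

/-- For s ≥ 0 the integrand is at most T^s on a set of volume O(T). For s < 0 the set is cut into
dyadic shells |D| ≈ T·2^(−j), whose contributions form a geometric series of ratio 2^(−(1+s)),
convergent because s > −1. -/
theorem lintegral_disc_rpow_le {κ : ℝ} (hκ : 0 < κ) (B : ℝ) {s : ℝ} (hs : -1 < s) :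
    ∃ K, 0 ≤ K ∧ ∀ N : ℚ, ‖(N : ℚ_[p])‖ = κ → ∀ T : ℝ, 0 < T →
      ∫⁻ y in smallDisc p N B T, ENNReal.ofReal (‖y ^ 2 - 4 * (N : ℚ_[p])‖ ^ s) ∂padicHaar p ≤
        ENNReal.ofReal (K * T ^ (1 + s)) := by
  obtain ⟨K, hK0, hK⟩ := volume_disc_le (p := p) hκ B
  rcases le_or_gt 0 s with h | h
  · refine ⟨K, hK0, fun N hN T hT => ?_⟩
    calc _ ≤ ∫⁻ y in smallDisc p N B T, ENNReal.ofReal (T ^ s) ∂padicHaar p := by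
          refine setLIntegral_mono measurable_const fun y hy => ENNReal.ofReal_le_ofReal ?_
          exact Real.rpow_le_rpow (norm_nonneg _) hy.2 h
      _ = ENNReal.ofReal (T ^ s) * padicHaar p (smallDisc p N B T) := by
          rw [lintegral_const, Measure.restrict_apply_univ]
      _ ≤ ENNReal.ofReal (T ^ s) * ENNReal.ofReal (K * T) := by gcongr; exact hK N hN T hT
      _ = _ := by
          rw [← ENNReal.ofReal_mul (by positivity), add_comm, Real.rpow_add_one hT.ne']
          congr 1
          ring
  · set ρ : ℝ := (2 : ℝ) ^ (-(1 + s)) with hρ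
    have hρ0 : 0 < ρ := by positivity
    have hρ1 : ρ < 1 := Real.rpow_lt_one_of_one_lt_of_neg one_lt_two (by linarith)
    have hsum : Summable fun j : ℕ => ρ ^ j := summable_geometric_of_lt_one hρ0.le hρ1
    refine ⟨K * 2 ^ (-s) * (1 - ρ)⁻¹, mul_nonneg (by positivity)
      (inv_nonneg.2 (by linarith)), fun N hN T hT => ?_⟩
    set c : ℕ → ENNReal := fun j => ENNReal.ofReal ((T * (1 / 2) ^ (j + 1)) ^ s)
    have hpt : ∀ y ∈ smallDisc p N B T, ENNReal.ofReal (‖y ^ 2 - 4 * (N : ℚ_[p])‖ ^ s) ≤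
        ∑' j : ℕ, (smallDisc p N B (T * (1 / 2) ^ j)).indicator (fun _ => c j) y := by
      intro y hy
      rcases eq_or_ne (y ^ 2 - 4 * (N : ℚ_[p])) 0 with h0 | h0
      -- At a zero of the discriminant the negative power has the conventional value 0, so such
      -- points need no shell.
      · rw [h0, norm_zero, Real.zero_rpow h.ne, ENNReal.ofReal_zero]
        exact zero_le
      · have hn := norm_pos_iff.2 h0
        obtain ⟨j, hj1, hj2⟩ := exists_nat_pow_near_of_lt_one (x := ‖y ^ 2 - 4 * (N : ℚ_[p])‖ / T)
          (y := (1 / 2 : ℝ)) (by positivity) ((div_le_one hT).2 hy.2) (by norm_num) (by norm_num)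
        rw [lt_div_iff₀ hT, mul_comm _ T] at hj1
        rw [div_le_iff₀ hT, mul_comm _ T] at hj2
        refine le_trans ?_ (ENNReal.le_tsum j)
        have hmem : y ∈ smallDisc p N B (T * (1 / 2) ^ j) := ⟨hy.1, hj2⟩
        rw [indicator_of_mem hmem]
        exact ENNReal.ofReal_le_ofReal (Real.rpow_le_rpow_of_nonpos (by positivity) hj1.le h.le)
    calc _ ≤ ∫⁻ y in smallDisc p N B T,
            ∑' j : ℕ, (smallDisc p N B (T * (1 / 2) ^ j)).indicator (fun _ => c j) y ∂padicHaar p :=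
          setLIntegral_mono' (measurableSet_smallDisc N B T) hpt
      _ ≤ ∫⁻ y, ∑' j : ℕ, (smallDisc p N B (T * (1 / 2) ^ j)).indicator (fun _ => c j) y
            ∂padicHaar p := setLIntegral_le_lintegral _ _
      _ = ∑' j : ℕ, c j * padicHaar p (smallDisc p N B (T * (1 / 2) ^ j)) := by
          rw [lintegral_tsum fun j => (measurable_const.indicator
            (measurableSet_smallDisc N B _)).aemeasurable]
          simp_rw [lintegral_indicator_const (measurableSet_smallDisc N B _)]
      _ ≤ ∑' j : ℕ, ENNReal.ofReal (K * 2 ^ (-s) * T ^ (1 + s) * ρ ^ j) := by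
          refine ENNReal.tsum_le_tsum fun j => ?_
          calc c j * padicHaar p (smallDisc p N B (T * (1 / 2) ^ j))
              ≤ c j * ENNReal.ofReal (K * (T * (1 / 2) ^ j)) := by
                gcongr; exact hK N hN _ (by positivity)
            _ = _ := by
                rw [← ENNReal.ofReal_mul (by positivity)]
                congr 1
                have e1 : (T * (1 / 2) ^ (j + 1)) ^ s =
                    T ^ s * (2 ^ (-s) * ((1 / 2 : ℝ) ^ j) ^ s) := by
                  rw [Real.mul_rpow hT.le (by positivity), pow_succ, Real.mul_rpow (by positivity)
                    (by norm_num), one_div, Real.inv_rpow two_pos.le, ← Real.rpow_neg two_pos.le]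
                  ring
                have e2 : ((2 : ℝ) ^ (-(1 + s))) ^ j = ((1 / 2 : ℝ) ^ j) ^ s * (1 / 2) ^ j := by
                  rw [← Real.rpow_add_one (by positivity), ← Real.rpow_natCast,
                    ← Real.rpow_natCast, ← Real.rpow_mul two_pos.le, ← Real.rpow_mul (by norm_num), one_div, Real.inv_rpow two_pos.le,
                    ← Real.rpow_neg two_pos.le]
                  congr 1
                  ring
                rw [e1, hρ, e2, add_comm 1 s, Real.rpow_add_one hT.ne']
                ring
      _ = _ := by
          rw [← ENNReal.ofReal_tsum_of_nonneg (fun j => by positivity) (hsum.mul_left _),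
            tsum_mul_left, tsum_geometric_of_lt_one hρ0.le hρ1]
          congr 1
          ring

/-! ### The local factors -/

/-- The local factor `|y² - 4N|'^s ψ(y)` on `Y_e`. -/
def localFactor (N : ℚ) (e : ℤ) (ψ : ℚ_[p] → ℂ) (s : ℝ) : ℚ_[p] → ℂ :=
  (regionY p N e).indicator fun y => ((modNorm p (y ^ 2 - 4 * (N : ℚ_[p])) ^ s : ℝ) : ℂ) * ψ y

theorem measurable_localFactor (N : ℚ) (e : ℤ) {ψ : ℚ_[p] → ℂ} (hψ : Continuous ψ) (s : ℝ) :
    Measurable (localFactor N e ψ s) := by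
  refine Measurable.indicator (Measurable.mul ?_ hψ.measurable) (measurableSet_regionY N e)
  exact Complex.measurable_ofReal.comp
    ((measurable_modNorm.comp (continuous_disc N).measurable).pow_const s)

/-- Only |N| enters the constant, not `N`; this gives uniformity in `n`. The modified norm is
replaced by the comparable |D|. -/
theorem localFactor_bound {κ : ℝ} (hκ : 0 < κ) (B : ℝ) {ψ : ℚ_[p] → ℂ} (hψ : Continuous ψ)
    (hb : ∃ M, ∀ y, ‖ψ y‖ ≤ M) (e : ℤ) {s : ℝ} (hs : -1 < s) :
    ∃ K, 0 ≤ K ∧ ∀ N : ℚ, ‖(N : ℚ_[p])‖ = κ → ∀ T : ℝ, 0 < T →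
      Integrable ((smallDisc p N B T).indicator (localFactor N e ψ s)) (padicHaar p) ∧
      ∫ y, ‖(smallDisc p N B T).indicator (localFactor N e ψ s) y‖ ∂padicHaar p ≤
        K * T ^ (1 + s) := by
  obtain ⟨M, hM⟩ := hb
  have hM0 : 0 ≤ M := (norm_nonneg _).trans (hM 0)
  have hpp := prime_pos' (p := p)
  obtain ⟨K, hK0, hK⟩ := lintegral_disc_rpow_le (p := p) hκ B hs
  set c : ℝ := ((p : ℝ) ^ 3) ^ |s| * M with hc
  have hc0 : 0 ≤ c := by positivity
  refine ⟨c * K, by positivity, fun N hN T hT => ?_⟩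
  set F := (smallDisc p N B T).indicator (localFactor N e ψ s) with hF
  have hmeas : Measurable F :=
    (measurable_localFactor N e hψ s).indicator (measurableSet_smallDisc N B T)
  have hpt : ∀ y ∈ smallDisc p N B T, ‖localFactor N e ψ s y‖ₑ ≤
      ENNReal.ofReal c * ENNReal.ofReal (‖y ^ 2 - 4 * (N : ℚ_[p])‖ ^ s) := by
    intro y _
    rw [← ENNReal.ofReal_mul hc0, ← ofReal_norm]
    refine ENNReal.ofReal_le_ofReal ?_
    by_cases hy : y ∈ regionY p N e
    · rw [localFactor, indicator_of_mem hy, norm_mul, Complex.norm_real,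
        Real.norm_of_nonneg (Real.rpow_nonneg (modNorm_nonneg _) _), hc]
      calc _ ≤ (((p : ℝ) ^ 3) ^ |s| * ‖y ^ 2 - 4 * (N : ℚ_[p])‖ ^ s) * M := by
            gcongr
            · exact modNorm_rpow_le (mem_regionY.1 hy).1 s
            · exact hM y
        _ = _ := by ring
    · rw [localFactor, indicator_of_notMem hy, norm_zero]
      positivity
  have hlint : ∫⁻ y, ‖F y‖ₑ ∂padicHaar p ≤ ENNReal.ofReal (c * K * T ^ (1 + s)) := by
    have h1 : ∀ y, ‖F y‖ₑ = (smallDisc p N B T).indicator (fun y => ‖localFactor N e ψ s y‖ₑ) y :=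
      fun y => enorm_indicator_eq_indicator_enorm _ _
    simp_rw [h1]
    rw [lintegral_indicator (measurableSet_smallDisc N B T)]
    calc _ ≤ ∫⁻ y in smallDisc p N B T,
            ENNReal.ofReal c * ENNReal.ofReal (‖y ^ 2 - 4 * (N : ℚ_[p])‖ ^ s) ∂padicHaar p :=
          setLIntegral_mono' (measurableSet_smallDisc N B T) hpt
      _ = ENNReal.ofReal c * ∫⁻ y in smallDisc p N B T,
            ENNReal.ofReal (‖y ^ 2 - 4 * (N : ℚ_[p])‖ ^ s) ∂padicHaar p :=
          lintegral_const_mul' _ _ ENNReal.ofReal_ne_top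
      _ ≤ ENNReal.ofReal c * ENNReal.ofReal (K * T ^ (1 + s)) := by gcongr; exact hK N hN T hT
      _ = _ := by rw [← ENNReal.ofReal_mul hc0, mul_assoc c K]
  refine ⟨⟨hmeas.aestronglyMeasurable, hlint.trans_lt ENNReal.ofReal_lt_top⟩, ?_⟩
  rw [integral_norm_eq_lintegral_enorm hmeas.aestronglyMeasurable]
  exact ENNReal.toReal_le_of_le_ofReal (by positivity) hlint

/-! ### Translations that change only the additive character. -/

/-- Where the discriminant is large compared with `1/|η|`, some translation preserves everything
but the additive character. -/
theorem exists_translation {κ : ℝ} (hκ : 0 < κ) {ψ : ℚ_[p] → ℂ} (hψ : IsLocallyConstant ψ)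
    (hc : HasCompactSupport ψ) :
    ∃ B K : ℝ, 0 < K ∧ (∀ y, B < ‖y‖ → ψ y = 0) ∧
      ∀ N : ℚ, ‖(N : ℚ_[p])‖ = κ →
        (∀ y : ℚ_[p], ‖y‖ ≤ B → ‖y ^ 2 - 4 * (N : ℚ_[p])‖ ≤ K) ∧
        ∀ η : ℚ_[p], ∃ h : ℚ_[p], ∃ χ : ℂ, χ ≠ 1 ∧
          (∀ y : ℚ_[p], (‖y‖ ≤ B ∧ K / (1 + ‖η‖) < ‖y ^ 2 - 4 * (N : ℚ_[p])‖) ↔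
            (‖y + h‖ ≤ B ∧ K / (1 + ‖η‖) < ‖(y + h) ^ 2 - 4 * (N : ℚ_[p])‖)) ∧
          ∀ y : ℚ_[p], ‖y‖ ≤ B → K / (1 + ‖η‖) < ‖y ^ 2 - 4 * (N : ℚ_[p])‖ →
            PadicClose (y ^ 2 - 4 * (N : ℚ_[p])) ((y + h) ^ 2 - 4 * (N : ℚ_[p])) ∧
            ψ (y + h) = ψ y ∧ ePadic p (-((y + h) * η)) = χ * ePadic p (-(y * η)) := by
  have hpp := prime_pos' (p := p)
  have hp1 := one_lt_prime' (p := p)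
  obtain ⟨B₀, hB₀⟩ := hc.isCompact.isBounded.subset_closedBall 0
  set B := max B₀ 1 with hBdef
  have hB1 : 1 ≤ B := le_max_right _ _
  have hsupp : ∀ y, B < ‖y‖ → ψ y = 0 := by
    intro y hy
    by_contra hne
    have := hB₀ (subset_tsupport _ hne)
    rw [Metric.mem_closedBall, dist_zero_right] at this
    linarith [le_max_left B₀ 1]
  -- A Lebesgue number makes local constancy uniform on the compact ball: shifts smaller than ρ do
  -- not change `ψ`.
  obtain ⟨ρ, hρ, hρψ⟩ := lebesgue_number_lemma_of_metric (isCompact_closedBall (0 : ℚ_[p]) B)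
    (c := fun z : ℂ => ψ ⁻¹' {z}) (fun z => hψ.isOpen_fiber z)
    (fun y _ => mem_iUnion.2 ⟨ψ y, rfl⟩)
  have hψh : ∀ y h : ℚ_[p], ‖y‖ ≤ B → ‖h‖ < ρ → ψ (y + h) = ψ y := by
    intro y h hy hh
    obtain ⟨z, hz⟩ := hρψ y (by simpa using hy)
    have h1 : ψ y = z := hz (Metric.mem_ball_self hρ)
    have h2 : ψ (y + h) = z := hz (by simpa [dist_eq_norm] using hh)
    rw [h1, h2]
  set κ4 : ℝ := ‖(4 : ℚ_[p])‖ * κ with hκ4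
  have h4 : 0 < κ4 := mul_pos (norm_pos_iff.2 (by norm_num)) hκ
  set D₀ : ℝ := max (B ^ 2) κ4 with hD₀
  have hD₀0 : 0 < D₀ := lt_max_of_lt_right h4
  set t : ℝ := (p : ℝ) ^ (-3 : ℤ) with ht
  have ht0 : 0 < t := zpow_pos hpp _
  have ht1 : t < 1 := zpow_neg_three_lt_one
  -- translations by `h` with `|h| < c |D|` are harmless
  set c : ℝ := min (min ρ 1 / D₀) (t / B) with hcdef
  have hc0 : 0 < c := lt_min (div_pos (lt_min hρ one_pos) hD₀0) (by positivity)
  have hcD : c * D₀ ≤ min ρ 1 := by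
    calc c * D₀ ≤ min ρ 1 / D₀ * D₀ := by gcongr; exact min_le_left _ _
      _ = _ := div_mul_cancel₀ _ hD₀0.ne'
  have hcB : c * B ≤ t := by
    calc c * B ≤ t / B * B := by gcongr; exact min_le_right _ _
      _ = _ := div_mul_cancel₀ _ (by positivity)
  -- The first entry makes the large-discriminant region empty when |η| ≤ 1. The second ensures that
  -- a shift of norm p/|η| is smaller than c|D| there when |η| > 1.
  set K : ℝ := max (2 * D₀) (2 * p / c) with hK
  have hK0 : 0 < K := lt_max_of_lt_left (by positivity)
  refine ⟨B, K, hK0, hsupp, fun N hN => ?_⟩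
  have hDle : ∀ y : ℚ_[p], ‖y‖ ≤ B → ‖y ^ 2 - 4 * (N : ℚ_[p])‖ ≤ D₀ := by
    intro y hy
    rw [sub_eq_add_neg]
    refine (Padic.nonarchimedean _ _).trans (max_le_max ?_ ?_)
    · rw [norm_pow]; gcongr
    · rw [norm_neg, norm_mul, hN]
  have hmove : ∀ y h : ℚ_[p], ‖y‖ ≤ B → ‖h‖ < c * ‖y ^ 2 - 4 * (N : ℚ_[p])‖ →
      ‖y + h‖ ≤ B ∧ ‖h‖ < ρ ∧
        PadicClose (y ^ 2 - 4 * (N : ℚ_[p])) ((y + h) ^ 2 - 4 * (N : ℚ_[p])) := by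
    intro y h hy hh
    have h1 : ‖h‖ < min ρ 1 :=
      hh.trans_le ((mul_le_mul_of_nonneg_left (hDle y hy) hc0.le).trans hcD)
    have hhB : ‖h‖ ≤ B := (h1.le.trans (min_le_right _ _)).trans hB1
    refine ⟨(Padic.nonarchimedean _ _).trans (max_le hy hhB), h1.trans_le (min_le_left _ _),
      ?_, ?_⟩
    · intro h0
      rw [h0, norm_zero, mul_zero] at hh
      exact absurd hh (not_lt.2 (norm_nonneg _))
    · have h2 : (y + h) ^ 2 - 4 * (N : ℚ_[p]) - (y ^ 2 - 4 * (N : ℚ_[p])) =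
          h * (2 * y + h) := by ring
      have h3 : ‖2 * y + h‖ ≤ B := by
        refine (Padic.nonarchimedean _ _).trans (max_le ?_ hhB)
        rw [norm_mul]
        have h5 : ‖(2 : ℚ_[p])‖ ≤ 1 := by exact_mod_cast Padic.norm_int_le_one (p := p) 2
        calc ‖(2 : ℚ_[p])‖ * ‖y‖ ≤ 1 * B := by gcongr
          _ = B := one_mul _
      rw [h2, norm_mul]
      calc ‖h‖ * ‖2 * y + h‖ ≤ (c * ‖y ^ 2 - 4 * (N : ℚ_[p])‖) * B := by gcongr
        _ = ‖y ^ 2 - 4 * (N : ℚ_[p])‖ * (c * B) := by ring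
        _ ≤ ‖y ^ 2 - 4 * (N : ℚ_[p])‖ * t := by gcongr
  refine ⟨fun y hy => (hDle y hy).trans ?_, fun η => ?_⟩
  · exact (le_mul_of_one_le_left hD₀0.le one_le_two).trans (le_max_left _ _)
  rcases le_or_gt ‖η‖ 1 with hη | hη
  -- The region is empty here, so the shift and the factor are arbitrary.
  · refine ⟨0, 0, zero_ne_one, fun y => by simp, fun y hy hlt => absurd (hDle y hy) (not_le.2 ?_)⟩
    refine lt_of_le_of_lt ?_ hlt
    rw [le_div_iff₀ (by positivity)]
    calc D₀ * (1 + ‖η‖) ≤ D₀ * 2 := by gcongr; linarith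
      _ = 2 * D₀ := mul_comm _ _
      _ ≤ K := le_max_left _ _
  · have hη0 : 0 < ‖η‖ := by linarith
    have hηne : η ≠ 0 := norm_pos_iff.1 hη0
    have hpne : (p : ℚ_[p]) ≠ 0 := by exact_mod_cast (Fact.out : p.Prime).ne_zero
    -- Then hη = 1/p, which has norm p > 1 and so lies just outside the kernel of the character.
    set h : ℚ_[p] := (p : ℚ_[p])⁻¹ * η⁻¹ with hh
    have hhn : ‖h‖ = p / ‖η‖ := by
      rw [hh, norm_mul, norm_inv, norm_inv, Padic.norm_p, inv_inv, div_eq_mul_inv]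
    have hlarge : ∀ y : ℚ_[p], K / (1 + ‖η‖) < ‖y ^ 2 - 4 * (N : ℚ_[p])‖ →
        ‖h‖ < c * ‖y ^ 2 - 4 * (N : ℚ_[p])‖ := by
      intro y hy
      have h1 : ‖h‖ / c ≤ K / (1 + ‖η‖) := by
        rw [hhn, div_div, div_le_div_iff₀ (by positivity) (by positivity)]
        calc (p : ℝ) * (1 + ‖η‖) ≤ p * (2 * ‖η‖) := by gcongr; linarith
          _ = 2 * p / c * (‖η‖ * c) := by field_simp
          _ ≤ K * (‖η‖ * c) := by gcongr; exact le_max_right _ _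
      have h2 := h1.trans_lt hy
      rwa [div_lt_iff₀ hc0, mul_comm] at h2
    refine ⟨h, ePadic p (-(h * η)), ?_, fun y => ⟨fun hy => ?_, fun hy => ?_⟩, fun y hy hlt => ?_⟩
    · rw [Ne, ePadic_eq_one_iff, norm_neg, norm_mul, hhn, div_mul_cancel₀ _ hη0.ne', not_le]
      exact hp1
    · obtain ⟨h1, -, h2⟩ := hmove y h hy.1 (hlarge y hy.2)
      exact ⟨h1, h2.norm_eq.symm ▸ hy.2⟩
    · obtain ⟨h1, -, h2⟩ := hmove (y + h) (-h) hy.1 (by rw [norm_neg]; exact hlarge _ hy.2)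
      rw [add_neg_cancel_right] at h1 h2
      exact ⟨h1, h2.norm_eq.symm ▸ hy.2⟩
    · obtain ⟨-, h1, h2⟩ := hmove y h hy (hlarge y hlt)
      refine ⟨h2, hψh y h hy h1, ?_⟩
      rw [← ePadic_add]
      congr 1
      ring

end Volume

/-! ### Localization of the semilocal integral -/

/-- If a translation in the `i`-th coordinate multiplies `g` by a constant other than `1` where the
`i`-th coordinate lies in `U i`, then these points do not contribute to the integral of `g`. -/
theorem integral_eq_integral_indicator_of_translation {ι : Type*} [Fintype ι] [DecidableEq ι]
    {X : ι → Type*} [∀ i, AddGroup (X i)] [∀ i, MeasurableSpace (X i)]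
    [MeasurableAdd (∀ i, X i)] {μ : Measure (∀ i, X i)} [μ.IsAddRightInvariant]
    {g : (∀ i, X i) → ℂ} (hg : Integrable g μ) {U : ∀ i, Set (X i)}
    (hU : ∀ i, MeasurableSet (U i)) (h : ∀ i, X i) (χ : ι → ℂ) (hχ : ∀ i, χ i ≠ 1)
    (hmem : ∀ i x, x ∈ U i ↔ x + h i ∈ U i)
    (hgχ : ∀ i y, y i ∈ U i → g (y + Pi.single i (h i)) = χ i * g y) :
    ∫ y, g y ∂μ = ∫ y, {y | ∀ i, y i ∉ U i}.indicator g y ∂μ := by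
  have hUm : ∀ i, MeasurableSet {y : ∀ i, X i | y i ∈ U i} := fun i =>
    (measurable_pi_apply i) (hU i)
  have hVm : ∀ S : Finset ι, MeasurableSet {y : ∀ i, X i | ∀ i ∈ S, y i ∉ U i} := by
    intro S
    have : {y : ∀ i, X i | ∀ i ∈ S, y i ∉ U i} = ⋂ i ∈ S, {y : ∀ i, X i | y i ∈ U i}ᶜ := by
      ext y; simp
    rw [this]
    exact S.measurableSet_biInter fun i _ => (hUm i).compl
  -- Coordinates are removed one at a time. Shifting the i-th coordinate leaves the conditions on
  -- the coordinates already treated intact.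
  have key : ∀ S : Finset ι, ∫ y, g y ∂μ = ∫ y, {y | ∀ i ∈ S, y i ∉ U i}.indicator g y ∂μ := by
    intro S
    induction S using Finset.induction_on with
    | empty => simp
    | insert i S hi ih =>
      rw [ih]
      set V := {y : ∀ i, X i | ∀ i ∈ S, y i ∉ U i} with hV
      set W := {y : ∀ i, X i | ∀ j ∈ insert i S, y j ∉ U j} with hW
      set Q := V ∩ {y : ∀ i, X i | y i ∈ U i} with hQ
      have hsplit : V.indicator g = fun y => W.indicator g y + Q.indicator g y := by
        have hVWQ : V = W ∪ Q := by
          ext y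
          simp only [hV, hW, hQ, mem_ofPred_eq, mem_union, mem_inter_iff, Finset.forall_mem_insert]
          tauto
        have hdisj : Disjoint W Q := Set.disjoint_left.2 fun y h1 h2 =>
          h1 i (Finset.mem_insert_self i S) h2.2
        rw [hVWQ, Set.indicator_union_of_disjoint hdisj]
      have hQm : MeasurableSet Q := (hVm S).inter (hUm i)
      -- Translation invariance shows that this integral equals χ_i times itself, and χ_i ≠ 1.
      have hzero : ∫ y, Q.indicator g y ∂μ = 0 := by
        have h1 : ∀ y, Q.indicator g (y + Pi.single i (h i)) = χ i * Q.indicator g y := by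
          intro y
          have hiff : y + Pi.single i (h i) ∈ Q ↔ y ∈ Q := by
            have e1 : (y + Pi.single i (h i)) i = y i + h i := by simp
            have e2 : ∀ j ∈ S, (y + Pi.single i (h i)) j = y j := by
              intro j hj
              have : j ≠ i := fun hji => hi (hji ▸ hj)
              simp [this]
            simp only [hQ, hV, mem_inter_iff, mem_ofPred_eq, e1, ← hmem]
            refine and_congr_left fun _ => forall₂_congr fun j hj => ?_
            rw [e2 j hj]
          by_cases hy : y ∈ Q
          · rw [indicator_of_mem (hiff.2 hy), indicator_of_mem hy, hgχ i y hy.2]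
          · rw [indicator_of_notMem (fun h' => hy (hiff.1 h')), indicator_of_notMem hy, mul_zero]
        have h2 := integral_add_right_eq_self (μ := μ) (Q.indicator g) (Pi.single i (h i))
        simp_rw [h1] at h2
        rw [integral_const_mul] at h2
        have h3 : (χ i - 1) * ∫ y, Q.indicator g y ∂μ = 0 := by rw [sub_mul, h2, one_mul, sub_self]
        exact (mul_eq_zero.1 h3).resolve_left (sub_ne_zero.2 (hχ i))
      rw [hsplit, integral_add (hg.indicator (hVm _)) (hg.indicator hQm), hzero, add_zero]
  simpa using key Finset.univ

/-- On the support of `ψ` the discriminant is bounded, so the whole factor lives on a single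
`smallDisc` and the local bound applies. -/
theorem integrable_localFactor {p : ℕ} [Fact p.Prime] {N : ℚ} (hN : (N : ℚ_[p]) ≠ 0) (e : ℤ)
    {ψ : ℚ_[p] → ℂ} (hψ : IsLocallyConstant ψ) (hc : HasCompactSupport ψ) {s : ℝ} (hs : -1 < s) :
    Integrable (localFactor N e ψ s) (padicHaar p) := by
  have hκ : 0 < ‖(N : ℚ_[p])‖ := norm_pos_iff.2 hN
  obtain ⟨B, K, hK0, hB, hK⟩ := exists_translation hκ hψ hc
  obtain ⟨K', -, hK'⟩ := localFactor_bound hκ B hψ.continuous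
    (hc.exists_bound_of_continuous hψ.continuous) e hs
  have h1 := (hK' N rfl K hK0).1
  have h2 : (smallDisc p N B K).indicator (localFactor N e ψ s) = localFactor N e ψ s := by
    rw [indicator_eq_self]
    intro y hy
    have hyB : ‖y‖ ≤ B := by
      by_contra hlt
      exact hy (by simp [localFactor, hB y (not_le.1 hlt)])
    exact ⟨hyB, (hK N rfl).1 y hyB⟩
  rwa [h2] at h1

/-! ### Products of local factors over the primes q_i. -/

section Product

variable {r : ℕ} (q : Fin r → ℕ) [∀ i, Fact (q i).Prime]

/-- The product of the local factors at `y` with the additive characters. -/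
def localProduct (N : ℚ) (e : Fin r → ℤ) (ψ : ∀ i, ℚ_[q i] → ℂ) (s : Fin r → ℝ)
    (η y : ∀ i, ℚ_[q i]) : ℂ :=
  ∏ i, (localFactor N (e i) (ψ i) (s i) (y i) * ePadic (q i) (-(y i * η i)))

/-- The product of the modified norms of the discriminants. -/
def discNorm (N : ℚ) (y : ∀ i, ℚ_[q i]) : ℝ :=
  ∏ i, modNorm (q i) (y i ^ 2 - 4 * (N : ℚ_[q i]))

variable {q}

/-- Only the i-th factor moves, and in it the region, the modified norm and `ψ` are unaffected.
Since the product of the norms is also fixed, any function of it survives the translation. -/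
theorem localProduct_translate {N : ℚ} {e : Fin r → ℤ} {ψ : ∀ i, ℚ_[q i] → ℂ} {s : Fin r → ℝ}
    {η y : ∀ i, ℚ_[q i]} {i : Fin r} {h : ℚ_[q i]} {χ : ℂ}
    (hcl : PadicClose (y i ^ 2 - 4 * (N : ℚ_[q i])) ((y i + h) ^ 2 - 4 * (N : ℚ_[q i])))
    (hψ : ψ i (y i + h) = ψ i (y i))
    (hχ : ePadic (q i) (-((y i + h) * η i)) = χ * ePadic (q i) (-(y i * η i))) :
    localProduct q N e ψ s η (y + Pi.single i h) = χ * localProduct q N e ψ s η y ∧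
      discNorm q N (y + Pi.single i h) = discNorm q N y := by
  have e1 : (y + Pi.single i h : ∀ i, ℚ_[q i]) i = y i + h := by simp
  have e2 : ∀ j ∈ Finset.univ.erase i, (y + Pi.single i h : ∀ i, ℚ_[q i]) j = y j := by
    intro j hj
    have := Finset.ne_of_mem_erase hj
    simp [this]
  constructor
  · have hL : localFactor N (e i) (ψ i) (s i) (y i + h) = localFactor N (e i) (ψ i) (s i) (y i) := by
      have hiff : y i + h ∈ regionY (q i) N (e i) ↔ y i ∈ regionY (q i) N (e i) := by
        rw [mem_regionY, mem_regionY, hcl.discSymbol_eq]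
        exact and_congr_left fun _ => ⟨fun _ => hcl.1, fun _ => hcl.ne_zero⟩
      by_cases hy : y i ∈ regionY (q i) N (e i)
      · rw [localFactor, indicator_of_mem (hiff.2 hy), indicator_of_mem hy, hψ, hcl.modNorm_eq]
      · rw [localFactor, indicator_of_notMem (fun h' => hy (hiff.1 h')), indicator_of_notMem hy]
    rw [localProduct, localProduct, ← Finset.mul_prod_erase _ _ (Finset.mem_univ i),
      ← Finset.mul_prod_erase _ (fun i => localFactor N (e i) (ψ i) (s i) (y i) *
        ePadic (q i) (-(y i * η i))) (Finset.mem_univ i), e1, hL, hχ,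
      Finset.prod_congr rfl fun j hj => by rw [e2 j hj]]
    ring
  · rw [discNorm, discNorm, ← Finset.mul_prod_erase _ _ (Finset.mem_univ i),
      ← Finset.mul_prod_erase _ (fun i => modNorm (q i) (y i ^ 2 - 4 * (N : ℚ_[q i])))
        (Finset.mem_univ i), e1, hcl.modNorm_eq,
      Finset.prod_congr rfl fun j hj => by rw [e2 j hj]]

/-- A power of the product of the modified norms splits over the primes and lowers every local
exponent by β, so that the integral again factors. -/
theorem norm_localProduct_mul_rpow (N : ℚ) (e : Fin r → ℤ) (ψ : ∀ i, ℚ_[q i] → ℂ) (s : Fin r → ℝ)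
    (η y : ∀ i, ℚ_[q i]) (β : ℝ) :
    ‖localProduct q N e ψ s η y‖ * discNorm q N y ^ (-β) =
      ∏ i, ‖localFactor N (e i) (ψ i) (s i - β) (y i)‖ := by
  rw [localProduct, discNorm, norm_prod,
    ← Real.finsetProd_rpow _ _ (fun i _ => modNorm_nonneg _), ← Finset.prod_mul_distrib]
  refine Finset.prod_congr rfl fun i _ => ?_
  rw [norm_mul, norm_ePadic, mul_one]
  by_cases hy : y i ∈ regionY (q i) N (e i)
  · have hpos := modNorm_pos (mem_regionY.1 hy).1
    rw [localFactor, localFactor, indicator_of_mem hy, indicator_of_mem hy, norm_mul, norm_mul,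
      Complex.norm_real, Complex.norm_real, Real.norm_of_nonneg (Real.rpow_nonneg hpos.le _),
      Real.norm_of_nonneg (Real.rpow_nonneg hpos.le _), sub_eq_add_neg (s i) β, Real.rpow_add hpos]
    ring
  · rw [localFactor, localFactor, indicator_of_notMem hy, indicator_of_notMem hy, norm_zero,
      zero_mul]

theorem localProduct_eq_zero {N : ℚ} {e : Fin r → ℤ} {ψ : ∀ i, ℚ_[q i] → ℂ} {s : Fin r → ℝ}
    {η y : ∀ i, ℚ_[q i]} {i : Fin r} (h : y i ∉ regionY (q i) N (e i) ∨ ψ i (y i) = 0) :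
    localProduct q N e ψ s η y = 0 := by
  refine Finset.prod_eq_zero (Finset.mem_univ i) ?_
  rcases h with h | h
  · rw [localFactor, indicator_of_notMem h, zero_mul]
  · simp [localFactor, h]

/-- The semilocal bound: the integral of the local factors against a function of the product of
the modified norms that is bounded by a constant plus a power. -/
theorem semilocal_bound {κ : Fin r → ℝ} (hκ : ∀ i, 0 < κ i) {ψ : ∀ i, ℚ_[q i] → ℂ}
    (hψ : ∀ i, IsLocallyConstant (ψ i) ∧ HasCompactSupport (ψ i)) (e : Fin r → ℤ)
    {s : Fin r → ℝ} (hs : ∀ i, -1 < s i) {β : ℝ} (hβ : ∀ i, -1 < s i - β) :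
    ∃ K, 0 ≤ K ∧ ∀ N : ℚ, (∀ i, ‖(N : ℚ_[q i])‖ = κ i) → ∀ (η : ∀ i, ℚ_[q i]) (J : ℝ → ℂ)
      (L₁ L₂ : ℝ), 0 ≤ L₁ → 0 ≤ L₂ → (∀ m, 0 < m → ‖J m‖ ≤ L₁ + L₂ * m ^ (-β)) →
      ‖∫ y, localProduct q N e ψ s η y * J (discNorm q N y) ∂Measure.pi fun i => padicHaar (q i)‖ ≤
        K * (L₁ * ∏ i, (1 + ‖η i‖) ^ (-1 - s i) + L₂ * ∏ i, (1 + ‖η i‖) ^ (-1 - s i + β)) := by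
  choose B K₀ hK₀ hB htr using fun i => exists_translation (hκ i) (hψ i).1 (hψ i).2
  have hbdd : ∀ i, ∃ M, ∀ y, ‖ψ i y‖ ≤ M := fun i =>
    (hψ i).2.exists_bound_of_continuous (hψ i).1.continuous
  choose K₁ hK₁0 hK₁ using fun i =>
    localFactor_bound (hκ i) (B i) (hψ i).1.continuous (hbdd i) (e i) (hs i)
  choose K₂ hK₂0 hK₂ using fun i =>
    localFactor_bound (hκ i) (B i) (hψ i).1.continuous (hbdd i) (e i) (hβ i)
  set A₁ := ∏ i, (K₁ i * K₀ i ^ (1 + s i)) with hA₁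
  set A₂ := ∏ i, (K₂ i * K₀ i ^ (1 + (s i - β))) with hA₂
  have hA₁0 : 0 ≤ A₁ := Finset.prod_nonneg fun i _ =>
    mul_nonneg (hK₁0 i) (Real.rpow_nonneg (hK₀ i).le _)
  have hA₂0 : 0 ≤ A₂ := Finset.prod_nonneg fun i _ =>
    mul_nonneg (hK₂0 i) (Real.rpow_nonneg (hK₀ i).le _)
  refine ⟨max A₁ A₂, le_max_of_le_left hA₁0, fun N hN η J L₁ L₂ hL₁ hL₂ hJ => ?_⟩
  set μ := Measure.pi fun i => padicHaar (q i) with hμ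
  set g : (∀ i, ℚ_[q i]) → ℂ := fun y => localProduct q N e ψ s η y * J (discNorm q N y) with hg
  have hη : ∀ i, 0 < 1 + ‖η i‖ := fun i => by positivity
  have hP₁ : 0 ≤ ∏ i, (1 + ‖η i‖) ^ (-1 - s i) :=
    Finset.prod_nonneg fun i _ => Real.rpow_nonneg (hη i).le _
  have hP₂ : 0 ≤ ∏ i, (1 + ‖η i‖) ^ (-1 - s i + β) :=
    Finset.prod_nonneg fun i _ => Real.rpow_nonneg (hη i).le _
  -- If the integrand is not integrable its integral is 0 by convention, so no regularity of `J` is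
  -- needed.
  by_cases hint : Integrable g μ
  swap
  · rw [integral_undef hint, norm_zero]
    positivity
  set T : Fin r → ℝ := fun i => K₀ i / (1 + ‖η i‖) with hT
  have hT0 : ∀ i, 0 < T i := fun i => div_pos (hK₀ i) (hη i)
  set U : ∀ i, Set ℚ_[q i] := fun i =>
    {y | ‖y‖ ≤ B i ∧ T i < ‖y ^ 2 - 4 * (N : ℚ_[q i])‖} with hU
  have hUm : ∀ i, MeasurableSet (U i) := fun i =>
    (isClosed_le continuous_norm continuous_const).measurableSet.inter
      (isOpen_lt continuous_const (continuous_disc N).norm).measurableSet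
  choose h χ hχ hmem htrans using fun i => (htr i N (hN i)).2 (η i)
  -- Cancellation is used only here. After it, absolute values are taken on the set where every
  -- discriminant is O(1/(1+|η_i|)).
  have hloc := integral_eq_integral_indicator_of_translation hint hUm h χ hχ
    (fun i x => hmem i x) (fun i y hy => by
      obtain ⟨hcl, hψi, hχi⟩ := htrans i (y i) hy.1 hy.2
      obtain ⟨h1, h2⟩ := localProduct_translate (e := e) (s := s) hcl hψi hχi
      simp only [hg, h1, h2, mul_assoc])
  set f₁ : ∀ i, ℚ_[q i] → ℝ := fun i y =>
    ‖(smallDisc (q i) N (B i) (T i)).indicator (localFactor N (e i) (ψ i) (s i)) y‖ with hf₁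
  set f₂ : ∀ i, ℚ_[q i] → ℝ := fun i y =>
    ‖(smallDisc (q i) N (B i) (T i)).indicator (localFactor N (e i) (ψ i) (s i - β)) y‖ with hf₂
  have hi₁ : Integrable (fun y : ∀ i, ℚ_[q i] => ∏ i, f₁ i (y i)) μ :=
    Integrable.fintype_prod_dep fun i => (hK₁ i N (hN i) (T i) (hT0 i)).1.norm
  have hi₂ : Integrable (fun y : ∀ i, ℚ_[q i] => ∏ i, f₂ i (y i)) μ :=
    Integrable.fintype_prod_dep fun i => (hK₂ i N (hN i) (T i) (hT0 i)).1.norm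
  have hnn₁ : ∀ y : ∀ i, ℚ_[q i], 0 ≤ ∏ i, f₁ i (y i) := fun y =>
    Finset.prod_nonneg fun i _ => norm_nonneg _
  have hnn₂ : ∀ y : ∀ i, ℚ_[q i], 0 ≤ ∏ i, f₂ i (y i) := fun y =>
    Finset.prod_nonneg fun i _ => norm_nonneg _
  have hpt : ∀ y, ‖{y | ∀ i, y i ∉ U i}.indicator g y‖ ≤
      L₁ * ∏ i, f₁ i (y i) + L₂ * ∏ i, f₂ i (y i) := by
    intro y
    have hrhs : 0 ≤ L₁ * ∏ i, f₁ i (y i) + L₂ * ∏ i, f₂ i (y i) := by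
      have := hnn₁ y
      have := hnn₂ y
      positivity
    by_cases hyU : y ∈ {y : ∀ i, ℚ_[q i] | ∀ i, y i ∉ U i}
    swap
    · rwa [indicator_of_notMem hyU, norm_zero]
    rw [indicator_of_mem hyU]
    by_cases hz : ∃ i, y i ∉ regionY (q i) N (e i) ∨ ψ i (y i) = 0
    · obtain ⟨i, hi⟩ := hz
      simp only [hg]
      rwa [localProduct_eq_zero hi, zero_mul, norm_zero]
    push Not at hz
    have hsm : ∀ i, y i ∈ smallDisc (q i) N (B i) (T i) := by
      intro i
      have hyB : ‖y i‖ ≤ B i := by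
        by_contra hlt
        exact (hz i).2 (hB i _ (not_le.1 hlt))
      refine ⟨hyB, ?_⟩
      by_contra hlt
      exact hyU i ⟨hyB, not_le.1 hlt⟩
    have hpos : 0 < discNorm q N y :=
      Finset.prod_pos fun i _ => modNorm_pos (mem_regionY.1 (hz i).1).1
    have e₁ : ∏ i, f₁ i (y i) = ‖localProduct q N e ψ s η y‖ := by
      have := norm_localProduct_mul_rpow N e ψ s η y 0
      rw [neg_zero, Real.rpow_zero, mul_one] at this
      rw [this]
      refine Finset.prod_congr rfl fun i _ => ?_
      rw [hf₁, sub_zero]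
      simp only
      rw [indicator_of_mem (hsm i)]
    have e₂ : ∏ i, f₂ i (y i) = ‖localProduct q N e ψ s η y‖ * discNorm q N y ^ (-β) := by
      rw [norm_localProduct_mul_rpow]
      refine Finset.prod_congr rfl fun i _ => ?_
      rw [hf₂]
      simp only
      rw [indicator_of_mem (hsm i)]
    rw [e₁, e₂, hg, norm_mul]
    calc _ ≤ ‖localProduct q N e ψ s η y‖ * (L₁ + L₂ * discNorm q N y ^ (-β)) := by
          gcongr; exact hJ _ hpos
      _ = _ := by ring
  have hpw : ∀ i (t : ℝ), T i ^ (1 + t) = K₀ i ^ (1 + t) * (1 + ‖η i‖) ^ (-1 - t) := by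
    intro i t
    rw [hT, Real.div_rpow (hK₀ i).le (hη i).le, show -1 - t = -(1 + t) by ring,
      Real.rpow_neg (hη i).le, div_eq_mul_inv]
  have hI₁ : ∫ y : ∀ i, ℚ_[q i], ∏ i, f₁ i (y i) ∂μ ≤ A₁ * ∏ i, (1 + ‖η i‖) ^ (-1 - s i) := by
    rw [hμ, integral_fintype_prod_eq_prod, hA₁, ← Finset.prod_mul_distrib]
    refine Finset.prod_le_prod (fun i _ => integral_nonneg fun _ => norm_nonneg _) fun i _ => ?_
    refine (hK₁ i N (hN i) (T i) (hT0 i)).2.trans (le_of_eq ?_)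
    rw [hpw, mul_assoc]
  have hI₂ : ∫ y : ∀ i, ℚ_[q i], ∏ i, f₂ i (y i) ∂μ ≤ A₂ * ∏ i, (1 + ‖η i‖) ^ (-1 - s i + β) := by
    rw [hμ, integral_fintype_prod_eq_prod, hA₂, ← Finset.prod_mul_distrib]
    refine Finset.prod_le_prod (fun i _ => integral_nonneg fun _ => norm_nonneg _) fun i _ => ?_
    refine (hK₂ i N (hN i) (T i) (hT0 i)).2.trans (le_of_eq ?_)
    rw [hpw, mul_assoc, show -1 - (s i - β) = -1 - s i + β by ring]
  rw [hloc]
  calc _ ≤ ∫ y, (L₁ * ∏ i, f₁ i (y i) + L₂ * ∏ i, f₂ i (y i)) ∂μ :=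
        norm_integral_le_of_norm_le ((hi₁.const_mul L₁).add (hi₂.const_mul L₂))
          (Eventually.of_forall hpt)
    _ = L₁ * ∫ y : ∀ i, ℚ_[q i], ∏ i, f₁ i (y i) ∂μ +
        L₂ * ∫ y : ∀ i, ℚ_[q i], ∏ i, f₂ i (y i) ∂μ := by
        rw [integral_add (hi₁.const_mul L₁) (hi₂.const_mul L₂), integral_const_mul,
          integral_const_mul]
    _ ≤ L₁ * (max A₁ A₂ * ∏ i, (1 + ‖η i‖) ^ (-1 - s i)) +
        L₂ * (max A₁ A₂ * ∏ i, (1 + ‖η i‖) ^ (-1 - s i + β)) := by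
        gcongr
        · exact hI₁.trans (by gcongr; exact le_max_left _ _)
        · exact hI₂.trans (by gcongr; exact le_max_right _ _)
    _ = _ := by ring

/-- Coprimality makes every factor other than q_i^(ν_i) a unit at q_i. The norm is thus independent
of `n`, which is what makes the p-adic constants uniform. -/
theorem norm_bigN (hq : Function.Injective q) (sgn : ℤˣ) (ν : Fin r → ℤ) {n : ℕ}
    (hn : ∀ i, n.Coprime (q i)) (i : Fin r) :
    ‖((bigN q sgn ν n : ℚ) : ℚ_[q i])‖ = (q i : ℝ) ^ (-ν i) := by
  have h1 : ‖(((sgn : ℤ) : ℚ) : ℚ_[q i])‖ = 1 := by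
    rcases Int.units_eq_one_or sgn with rfl | rfl <;> simp
  have h2 : ‖(n : ℚ_[q i])‖ = 1 := by
    rw [Padic.norm_natCast_eq_one_iff]
    exact (hn i).symm
  have h3 : ∀ j, j ≠ i → ‖(q j : ℚ_[q i])‖ = 1 := by
    intro j hj
    rw [Padic.norm_natCast_eq_one_iff]
    exact (Nat.coprime_primes Fact.out Fact.out).2 fun h => hj (hq h).symm
  rw [bigN]
  push_cast
  rw [norm_mul, norm_mul, norm_prod, Finset.prod_eq_single i, Padic.norm_p_zpow, h2]
  · have : ‖((sgn : ℤ) : ℚ_[q i])‖ = 1 := by simpa using h1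
    rw [this]; simp
  · intro j _ hj
    rw [norm_zpow, h3 j hj, one_zpow]
  · simp

end Product

/-! ### The archimedean integral as a function of the product of the modified norms -/

/-- The integral over `ℝ`, as a function of `m = |y² - 4N|'`. -/
def archIntegral (s : ℝ) (φ h : ℝ → ℂ) (α C ξ m : ℝ) : ℂ :=
  ∫ x, realTerm s φ h α (Real.log C - Real.log m / 2) x * eInf (-(x * ξ))

theorem div_sqrt_mul_sqrt_eq_exp {C w m : ℝ} (hC : 0 < C) (hw : 0 < w) (hm : 0 < m) :
    C / (w ^ ((1 : ℝ) / 2) * m ^ ((1 : ℝ) / 2)) =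
      Real.exp (Real.log C - Real.log m / 2 - Real.log w / 2) := by
  rw [Real.exp_sub, Real.exp_sub, Real.exp_log hC, Real.rpow_def_of_pos hw,
    Real.rpow_def_of_pos hm, div_div, mul_comm (Real.exp _)]
  ring_nf

theorem ae_sq_sub_ne_zero (s : ℝ) : ∀ᵐ x : ℝ, x ^ 2 - s ≠ 0 := by
  have h : {x : ℝ | x ^ 2 - s = 0} ⊆ {√s, -√s} := by
    intro x hx
    have hx' : x ^ 2 = s := sub_eq_zero.1 hx
    have h1 : x ^ 2 = √s ^ 2 := by rw [Real.sq_sqrt (hx' ▸ sq_nonneg x), hx']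
    exact sq_eq_sq_iff_eq_or_eq_neg.1 h1
  rw [ae_iff]
  simp only [not_not]
  exact ((finite_singleton (-√s)).insert (√s)).subset h |>.measure_zero _

theorem integrable_realTerm_mul_eInf {f : ℝ → ℂ} (hf : Integrable f) (ξ : ℝ) :
    Integrable fun x => f x * eInf (-(x * ξ)) := by
  have hE : Continuous fun x : ℝ => eInf (-(x * ξ)) := continuous_eInf.comp (by fun_prop)
  exact hf.mul_bdd (c := 1) hE.aestronglyMeasurable
    (Eventually.of_forall fun x => (norm_eInf _).le)

/-- If `h(u) = c + O(e^(bu))` with `b < 2`, then the archimedean integral is that of `c` up to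
`O(C^b m^(-b/2))`. -/
theorem norm_archIntegral_sub_le {sgn : ℤˣ} {φ h : ℝ → ℂ} (hφ : SmoothUpToBoundary sgn φ)
    (hh : IsBoundedSymbol h) {c : ℂ} {b K : ℝ} (hb : b < 2)
    (hK : ∀ u, ‖h u - c‖ ≤ K * Real.exp (b * u)) :
    ∃ K', 0 ≤ K' ∧ ∀ C ξ m : ℝ, 0 < C → 0 < m →
      ‖archIntegral ((sgn : ℤ) : ℝ) φ h 0 C ξ m - c * ∫ x, φ x * eInf (-(x * ξ))‖ ≤
        K' * (C ^ b * m ^ (-(b / 2))) := by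
  set s : ℝ := ((sgn : ℤ) : ℝ) with hs
  have hK0 : 0 ≤ K := by
    have := (norm_nonneg _).trans (hK 0)
    rwa [mul_zero, Real.exp_zero, mul_one] at this
  -- Inserting the error exp(bu) produces the weight |x² ∓ 1|^(−b/2), integrable at the zeros
  -- precisely because b < 2.
  have hint := (integrable_abs_rpow_mul hφ (α := -(b / 2)) (by linarith)).norm
  refine ⟨K * ∫ x, ‖((|x ^ 2 - s| ^ (-(b / 2)) : ℝ) : ℂ) * φ x‖,
    mul_nonneg hK0 (integral_nonneg fun _ => norm_nonneg _), fun C ξ m hC hm => ?_⟩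
  have hi1 := integrable_realTerm_mul_eInf
    ((realTerm_fourier_bound hφ hh (α := 0) (by norm_num)).1 (Real.log C - Real.log m / 2)) ξ
  have hφi : Integrable φ := by
    simpa using integrable_abs_rpow_mul hφ (α := 0) (by norm_num)
  have hi2 := (integrable_realTerm_mul_eInf hφi ξ).const_mul c
  rw [archIntegral, ← integral_const_mul, ← integral_sub hi1 hi2]
  calc _ ≤ ∫ x, K * (C ^ b * m ^ (-(b / 2))) *
          ‖((|x ^ 2 - s| ^ (-(b / 2)) : ℝ) : ℂ) * φ x‖ := by
        refine norm_integral_le_of_norm_le (hint.const_mul _) ?_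
        filter_upwards [ae_sq_sub_ne_zero s] with x hx
        have hw : 0 < |x ^ 2 - s| := abs_pos.2 hx
        set u := Real.log C - Real.log m / 2 - Real.log |x ^ 2 - s| / 2 with hu
        have e1 : realTerm s φ h 0 (Real.log C - Real.log m / 2) x * eInf (-(x * ξ)) -
            c * (φ x * eInf (-(x * ξ))) = (h u - c) * (φ x * eInf (-(x * ξ))) := by
          rw [realTerm, Real.rpow_zero]
          push_cast
          ring
        have e2 : Real.exp (b * u) = C ^ b * m ^ (-(b / 2)) * |x ^ 2 - s| ^ (-(b / 2)) := by
          rw [Real.rpow_def_of_pos hC, Real.rpow_def_of_pos hm, Real.rpow_def_of_pos hw,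
            ← Real.exp_add, ← Real.exp_add, hu]
          ring_nf
        rw [e1, norm_mul, norm_mul, norm_mul, norm_eInf, mul_one, Complex.norm_real,
          Real.norm_of_nonneg (Real.rpow_nonneg hw.le _)]
        calc ‖h u - c‖ * ‖φ x‖ ≤ K * Real.exp (b * u) * ‖φ x‖ := by gcongr; exact hK u
          _ = _ := by rw [e2]; ring
    _ = _ := by rw [integral_const_mul]; ring

/-! ### Absolute convergence and the order of integration. -/

section Transform

variable {r : ℕ} {q : Fin r → ℕ} [∀ i, Fact (q i).Prime]

theorem measurable_discNorm (N : ℚ) : Measurable (discNorm q N) := by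
  unfold discNorm
  exact Finset.measurable_prod _ fun i _ =>
    (measurable_modNorm.comp (continuous_disc N).measurable).comp (measurable_pi_apply i)

theorem discNorm_nonneg (N : ℚ) (y : ∀ i, ℚ_[q i]) : 0 ≤ discNorm q N y :=
  Finset.prod_nonneg fun _ _ => modNorm_nonneg _

theorem measurableSet_regionYProd (N : ℚ) (e : Fin r → ℤ) :
    MeasurableSet (regionYProd q N e) :=
  MeasurableSet.univ_pi fun _ => measurableSet_regionY N _

/-- The integral defining `𝐅` converges absolutely. -/
theorem integrable_integrand {sgn : ℤˣ} {N : ℚ} (hN : ∀ i, (N : ℚ_[q i]) ≠ 0) {a₀ : ℤ}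
    (ha₀ : -1 ≤ a₀) {a : Fin r → ℤ} (ha : ∀ i, -1 ≤ a i) (e : Fin r → ℤ) {φ' : ℝ → ℂ}
    (hφ' : SmoothUpToBoundary sgn φ') {ψ' : ∀ i, ℚ_[q i] → ℂ}
    (hψ' : ∀ i, IsLocallyConstant (ψ' i) ∧ HasCompactSupport (ψ' i)) {Φ : ℝ → ℂ}
    (hΦc : ContinuousOn Φ (Ioi 0)) (hΦb : ∃ K, ∀ u, ‖Φ (Real.exp u)‖ ≤ K) {C : ℝ} (hC : 0 < C)
    (ξ : ℝ) (η : ∀ i, ℚ_[q i]) :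
    Integrable (fun z : ℝ × (∀ i, ℚ_[q i]) =>
      integrand q sgn N a₀ a φ' ψ' Φ C ξ η z.1 z.2) (semilocalMeasure q N e) := by
  obtain ⟨K, hK⟩ := hΦb
  set s : ℝ := ((sgn : ℤ) : ℝ) with hs
  have ha₀' : (-1 : ℝ) ≤ a₀ := by exact_mod_cast ha₀
  have hA := integrable_abs_rpow_mul hφ' (α := (a₀ : ℝ) / 2) (by linarith)
  have hB : Integrable (fun y : ∀ i, ℚ_[q i] => ∏ i,
      (((modNorm (q i) (y i ^ 2 - 4 * (N : ℚ_[q i])) ^ ((a i : ℝ) / 2) : ℝ) : ℂ) * ψ' i (y i)))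
      ((Measure.pi fun i => padicHaar (q i)).restrict (regionYProd q N e)) := by
    have h1 : Integrable (fun y : ∀ i, ℚ_[q i] =>
        ∏ i, localFactor N (e i) (ψ' i) ((a i : ℝ) / 2) (y i))
        (Measure.pi fun i => padicHaar (q i)) := by
      refine Integrable.fintype_prod_dep fun i =>
        integrable_localFactor (hN i) (e i) (hψ' i).1 (hψ' i).2 ?_
      have : (-1 : ℝ) ≤ a i := by exact_mod_cast ha i
      linarith
    refine h1.integrableOn.congr_fun (fun y hy => ?_) (measurableSet_regionYProd N e)
    refine Finset.prod_congr rfl fun i _ => ?_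
    rw [localFactor, indicator_of_mem (hy i (mem_univ i))]
  classical
  -- Nothing is assumed about `Φ` on (−∞, 0], so it is replaced by a measurable function. The value
  -- at 0 is kept because division by zero gives argument 0 at singular points.
  set Φ' : ℝ → ℂ := (Ioi (0 : ℝ)).piecewise Φ (fun _ => Φ 0) with hΦ'
  have hΦ'm : Measurable Φ' := hΦc.measurable_piecewise continuousOn_const measurableSet_Ioi
  have hΦ'b : ∀ x, ‖Φ' x‖ ≤ max K ‖Φ 0‖ := by
    intro x
    by_cases hx : x ∈ Ioi (0 : ℝ)
    · rw [hΦ', piecewise_eq_of_mem _ _ _ hx, ← Real.exp_log hx]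
      exact (hK _).trans (le_max_left _ _)
    · rw [hΦ', piecewise_eq_of_notMem _ _ _ hx]
      exact le_max_right _ _
  set E : ℝ × (∀ i, ℚ_[q i]) → ℂ := fun z =>
    Φ' (C / (|z.1 ^ 2 - s| ^ ((1 : ℝ) / 2) * discNorm q N z.2 ^ ((1 : ℝ) / 2))) *
      eInf (-(z.1 * ξ)) * ∏ i, ePadic (q i) (-(z.2 i * η i)) with hE
  have hEm : Measurable E := by
    refine Measurable.mul (Measurable.mul (hΦ'm.comp ?_) ?_) ?_
    · refine measurable_const.div (Measurable.mul ?_ ?_)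
      · have : Measurable fun z : ℝ × (∀ i, ℚ_[q i]) => |z.1 ^ 2 - s| := by fun_prop
        exact this.pow_const _
      · exact ((measurable_discNorm N).comp measurable_snd).pow_const _
    · exact continuous_eInf.measurable.comp ((measurable_fst.mul_const ξ).neg)
    · refine Finset.measurable_prod _ fun i _ => continuous_ePadic.measurable.comp ?_
      have : Continuous fun y : ℚ_[q i] => -(y * η i) := by fun_prop
      exact this.measurable.comp ((measurable_pi_apply i).comp measurable_snd)
  have hEb : ∀ z, ‖E z‖ ≤ max K ‖Φ 0‖ := by
    intro z
    rw [hE]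
    simp only [norm_mul, norm_prod, norm_eInf, norm_ePadic, Finset.prod_const_one, mul_one]
    exact hΦ'b _
  refine ((hA.mul_prod hB).mul_bdd hEm.aestronglyMeasurable
    (Eventually.of_forall hEb)).congr (Eventually.of_forall fun z => ?_)
  have harg : 0 ≤ C / (|z.1 ^ 2 - s| ^ ((1 : ℝ) / 2) * discNorm q N z.2 ^ ((1 : ℝ) / 2)) := by
    have := discNorm_nonneg N z.2
    positivity
  have hΦeq : ∀ x, 0 ≤ x → Φ' x = Φ x := by
    intro x hx
    rcases hx.eq_or_lt with rfl | hx
    · rw [hΦ', piecewise_eq_of_notMem _ _ _ (by simp)]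
    · rw [hΦ', piecewise_eq_of_mem _ _ _ (mem_Ioi.2 hx)]
  simp only [integrand, hE]
  rw [hΦeq _ harg, discNorm]
  ring

theorem integrand_eq {sgn : ℤˣ} {N : ℚ} {a₀ : ℤ} {a e : Fin r → ℤ} {φ' : ℝ → ℂ}
    {ψ' : ∀ i, ℚ_[q i] → ℂ} {Φ : ℝ → ℂ} {C : ℝ} (hC : 0 < C) (ξ : ℝ) (η : ∀ i, ℚ_[q i]) {x : ℝ}
    (hx : x ^ 2 - ((sgn : ℤ) : ℝ) ≠ 0) {y : ∀ i, ℚ_[q i]} (hy : y ∈ regionYProd q N e) :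
    integrand q sgn N a₀ a φ' ψ' Φ C ξ η x y =
      localProduct q N e ψ' (fun i => (a i : ℝ) / 2) η y *
        (realTerm ((sgn : ℤ) : ℝ) φ' (fun u => Φ (Real.exp u)) ((a₀ : ℝ) / 2)
          (Real.log C - Real.log (discNorm q N y) / 2) x * eInf (-(x * ξ))) := by
  have hy' : ∀ i, y i ∈ regionY (q i) N (e i) := fun i => hy i (mem_univ i)
  have hpos : 0 < discNorm q N y :=
    Finset.prod_pos fun i _ => modNorm_pos (mem_regionY.1 (hy' i)).1
  have h1 : localProduct q N e ψ' (fun i => (a i : ℝ) / 2) η y =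
      (∏ i, (((modNorm (q i) (y i ^ 2 - 4 * (N : ℚ_[q i])) ^ ((a i : ℝ) / 2) : ℝ) : ℂ) *
        ψ' i (y i))) * ∏ i, ePadic (q i) (-(y i * η i)) := by
    rw [localProduct, ← Finset.prod_mul_distrib]
    refine Finset.prod_congr rfl fun i _ => ?_
    rw [localFactor, indicator_of_mem (hy' i)]
  have h2 := div_sqrt_mul_sqrt_eq_exp hC (abs_pos.2 hx) hpos
  rw [discNorm] at h2
  rw [integrand, h2, h1, realTerm, discNorm]
  ring

/-- By Fubini the `x`-integral can be done first; outside the local product it depends on `y` only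
through `discNorm`, which is the form `semilocal_bound` accepts. -/
theorem fourierF_eq {sgn : ℤˣ} {N : ℚ} {a₀ : ℤ} {a e : Fin r → ℤ} {φ' : ℝ → ℂ}
    {ψ' : ∀ i, ℚ_[q i] → ℂ} {Φ : ℝ → ℂ} {C : ℝ} (hC : 0 < C) {ξ : ℝ} {η : ∀ i, ℚ_[q i]}
    (hint : Integrable (fun z : ℝ × (∀ i, ℚ_[q i]) =>
      integrand q sgn N a₀ a φ' ψ' Φ C ξ η z.1 z.2) (semilocalMeasure q N e)) :
    fourierF q sgn N a₀ a e φ' ψ' Φ C ξ η =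
      ∫ y, localProduct q N e ψ' (fun i => (a i : ℝ) / 2) η y *
        archIntegral ((sgn : ℤ) : ℝ) φ' (fun u => Φ (Real.exp u)) ((a₀ : ℝ) / 2) C ξ
          (discNorm q N y) ∂Measure.pi fun i => padicHaar (q i) := by
  rw [fourierF, integral_integral_swap hint,
    ← integral_indicator (measurableSet_regionYProd N e)]
  congr 1
  ext y
  by_cases hy : y ∈ regionYProd q N e
  · rw [indicator_of_mem hy, archIntegral, ← integral_const_mul]
    refine integral_congr_ae ?_
    filter_upwards [ae_sq_sub_ne_zero ((sgn : ℤ) : ℝ)] with x hx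
    exact integrand_eq hC ξ η hx hy
  · rw [indicator_of_notMem hy]
    have : ∃ i, y i ∉ regionY (q i) N (e i) := by
      by_contra! hall
      exact hy fun i _ => hall i
    obtain ⟨i, hi⟩ := this
    rw [localProduct_eq_zero (Or.inl hi), zero_mul]

end Transform

/-! ### Elementary inequalities for the interpolation. -/

/-- Young's inequality with exponents `3/4` and `1/4`. -/
theorem rpow_three_quarters_mul_le {u w : ℝ} (hu : 0 ≤ u) (hw : 0 ≤ w) :
    u ^ (3 / 4 : ℝ) * w ^ (1 / 4 : ℝ) ≤ u + w := by
  have h := Real.geom_mean_le_arith_mean2_weighted (w₁ := 3 / 4) (w₂ := 1 / 4) (by norm_num)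
    (by norm_num) hu hw (by norm_num)
  linarith

theorem prod_one_add_rpow {r : ℕ} {t : Fin r → ℝ} (ht : ∀ i, 0 ≤ t i) (c : Fin r → ℝ) (β : ℝ) :
    ∏ i, (1 + t i) ^ (c i + β) = (∏ i, (1 + t i)) ^ β * ∏ i, (1 + t i) ^ c i := by
  rw [← Real.finsetProd_rpow _ _ (fun i _ => by have := ht i; positivity),
    ← Finset.prod_mul_distrib]
  refine Finset.prod_congr rfl fun i _ => ?_
  have := ht i
  rw [add_comm (c i), Real.rpow_add (by positivity)]

end SemilocalFourier

end

/-! ### The two bounds of the theorem. -/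

theorem theoremA2 {r : ℕ} (q : Fin r → ℕ) [∀ i, Fact (q i).Prime]
    (hq : Function.Injective q) (sgn : ℤˣ) (ν : Fin r → ℤ)
    (Φ : ℝ → ℂ) (hΦ : SemilocalFourier.ClassS Φ)
    (G : ℂ → ℂ) (hG : SemilocalFourier.IsMellinContinuation Φ G)
    (a₀ : ℤ) (ha₀ : -1 ≤ a₀) (a : Fin r → ℤ) (ha : ∀ i, -1 ≤ a i)
    (e : Fin r → ℤ) (he : ∀ i, e i = 0 ∨ e i = 1 ∨ e i = -1)
    (φ' : ℝ → ℂ) (hφ' : SemilocalFourier.SmoothUpToBoundary sgn φ')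
    (ψ' : ∀ i, ℚ_[q i] → ℂ)
    (hψ' : ∀ i, IsLocallyConstant (ψ' i) ∧ HasCompactSupport (ψ' i)) :
    -- the integral defining `𝐅` converges absolutely
    (∀ (n : ℕ), 0 < n → (∀ i, n.Coprime (q i)) →
      ∀ (C : ℝ), 0 < C → ∀ (ξ : ℝ) (η : ∀ i, ℚ_[q i]),
        MeasureTheory.Integrable
          (fun z : ℝ × (∀ i, ℚ_[q i]) =>
            SemilocalFourier.integrand q sgn (SemilocalFourier.bigN q sgn ν n) a₀ a φ' ψ' Φ C ξ η
              z.1 z.2)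
          (SemilocalFourier.semilocalMeasure q (SemilocalFourier.bigN q sgn ν n) e)) ∧
    -- the general bound
    (∃ K : ℝ, ∀ (n : ℕ), 0 < n → (∀ i, n.Coprime (q i)) →
      ∀ (C : ℝ), 0 < C → ∀ (ξ : ℝ) (η : ∀ i, ℚ_[q i]),
        ‖SemilocalFourier.fourierF q sgn (SemilocalFourier.bigN q sgn ν n) a₀ a e φ' ψ' Φ C ξ η‖ ≤
          K * ((1 + |ξ|) ^ (-1 - (a₀ : ℝ) / 2) *
            ∏ i, (1 + ‖η i‖) ^ (-1 - (a i : ℝ) / 2))) ∧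
    -- the bound for `a₀ = 0` and `φ'` smooth on `ℝ`
    (a₀ = 0 → ContDiff ℝ ∞ φ' → ∀ ε : ℝ, 0 < ε → ((∀ i, 0 ≤ a i) ∨ 1 / 3 < ε) →
      ∃ K : ℝ, ∀ (n : ℕ), 0 < n → (∀ i, n.Coprime (q i)) →
        ∀ (C : ℝ), 0 < C → ∀ (ξ : ℝ) (η : ∀ i, ℚ_[q i]),
          ‖SemilocalFourier.fourierF q sgn (SemilocalFourier.bigN q sgn ν n) a₀ a e φ' ψ' Φ
              C ξ η‖ ≤
            K * (((|C| ^ 2 * ∏ i, (1 + ‖η i‖)) ^ (1 - ε) + (1 + |ξ|) ^ (-2 : ℝ)) *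
              ∏ i, (1 + ‖η i‖) ^ (-1 - (a i : ℝ) / 2))) := by
  open SemilocalFourier in
  obtain ⟨hsym, hdecay, c, hlim⟩ := hG.symbol hΦ
  have hκ : ∀ i, (0 : ℝ) < (q i : ℝ) ^ (-ν i) := fun i => zpow_pos prime_pos' _
  have hNn : ∀ n : ℕ, (∀ i, n.Coprime (q i)) →
      ∀ i, ‖((bigN q sgn ν n : ℚ) : ℚ_[q i])‖ = (q i : ℝ) ^ (-ν i) :=
    fun n hn i => norm_bigN hq sgn ν hn i
  have hN0 : ∀ n : ℕ, (∀ i, n.Coprime (q i)) → ∀ i, ((bigN q sgn ν n : ℚ) : ℚ_[q i]) ≠ 0 :=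
    fun n hn i => norm_pos_iff.1 ((hNn n hn i).symm ▸ hκ i)
  have ha' : ∀ i, (-1 : ℝ) ≤ a i := fun i => by exact_mod_cast ha i
  have ha₀' : (-1 : ℝ) ≤ a₀ := by exact_mod_cast ha₀
  have hs : ∀ i, -1 < (a i : ℝ) / 2 := fun i => by linarith [ha' i]
  have hint : ∀ (n : ℕ), 0 < n → (∀ i, n.Coprime (q i)) →
      ∀ (C : ℝ), 0 < C → ∀ (ξ : ℝ) (η : ∀ i, ℚ_[q i]),
        MeasureTheory.Integrable (fun z : ℝ × (∀ i, ℚ_[q i]) =>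
          integrand q sgn (bigN q sgn ν n) a₀ a φ' ψ' Φ C ξ η z.1 z.2)
          (semilocalMeasure q (bigN q sgn ν n) e) := by
    intro n _ hn C hC ξ η
    obtain ⟨K, -, hK⟩ := hdecay 0 le_rfl
    exact integrable_integrand (hN0 n hn) ha₀ ha e hφ' hψ' hΦ.1.continuousOn
      ⟨K, fun u => by simpa using hK u⟩ hC ξ η
  obtain ⟨-, K₁, hK₁0, hK₁⟩ := realTerm_fourier_bound hφ' hsym (α := (a₀ : ℝ) / 2) (by linarith)
  refine ⟨hint, ?_, ?_⟩
  -- The archimedean bound is uniform in m, so the power term is absent: β = 0 and L₂ = 0.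
  · obtain ⟨K₂, hK₂0, hK₂⟩ := semilocal_bound hκ hψ' e hs (β := 0) (by simpa using hs)
    refine ⟨K₂ * K₁, fun n hn0 hn C hC ξ η => ?_⟩
    rw [fourierF_eq hC (hint n hn0 hn C hC ξ η)]
    have := hK₂ _ (hNn n hn) η (archIntegral ((sgn : ℤ) : ℝ) φ' (fun u => Φ (Real.exp u))
      ((a₀ : ℝ) / 2) C ξ) (K₁ * (1 + |ξ|) ^ (-1 - (a₀ : ℝ) / 2)) 0 (by positivity) le_rfl
      (fun m _ => by rw [zero_mul, add_zero]; exact hK₁ _ ξ)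
    refine this.trans (le_of_eq ?_)
    ring
  · rintro rfl hφs ε hε hcase
    simp only [Int.cast_zero, zero_div, sub_zero] at hK₁
    obtain ⟨K₃, hK₃0, hK₃⟩ := fourier_bound_of_smooth hφs hφ'.hasCompactSupport
    -- it suffices to bound the archimedean integral by a constant plus a power
    have main : ∀ β : ℝ, (∀ i, -1 < (a i : ℝ) / 2 - β) → ∀ (L₁ L₂ : ℝ) (Λ : ℝ → ℝ), 0 ≤ L₁ →
        0 ≤ L₂ → (∀ ξ, 0 ≤ Λ ξ) →
        (∀ C ξ m : ℝ, 0 < C → 0 < m →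
          ‖archIntegral ((sgn : ℤ) : ℝ) φ' (fun u => Φ (Real.exp u)) 0 C ξ m‖ ≤
            L₁ * (1 + |ξ|) ^ (-2 : ℝ) + L₂ * (Λ ξ * ((C ^ 2) ^ β * m ^ (-β)))) →
        (∀ Z ξ : ℝ, 0 < Z → Λ ξ * Z ^ β ≤ Z ^ (1 - ε) + (1 + |ξ|) ^ (-2 : ℝ)) →
        ∃ K : ℝ, ∀ (n : ℕ), 0 < n → (∀ i, n.Coprime (q i)) →
        ∀ (C : ℝ), 0 < C → ∀ (ξ : ℝ) (η : ∀ i, ℚ_[q i]),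
          ‖fourierF q sgn (bigN q sgn ν n) 0 a e φ' ψ' Φ C ξ η‖ ≤
            K * (((|C| ^ 2 * ∏ i, (1 + ‖η i‖)) ^ (1 - ε) + (1 + |ξ|) ^ (-2 : ℝ)) *
              ∏ i, (1 + ‖η i‖) ^ (-1 - (a i : ℝ) / 2)) := by
      intro β hβ L₁ L₂ Λ hL₁ hL₂ hΛ hJ hZ
      obtain ⟨K₂, hK₂0, hK₂⟩ := semilocal_bound hκ hψ' e hs hβ
      refine ⟨K₂ * (L₁ + L₂), fun n hn0 hn C hC ξ η => ?_⟩
      rw [fourierF_eq hC (hint n hn0 hn C hC ξ η)]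
      have h1 := hK₂ _ (hNn n hn) η (archIntegral ((sgn : ℤ) : ℝ) φ' (fun u => Φ (Real.exp u))
        0 C ξ) (L₁ * (1 + |ξ|) ^ (-2 : ℝ)) (L₂ * (Λ ξ * (C ^ 2) ^ β)) (by positivity)
        (mul_nonneg hL₂ (mul_nonneg (hΛ ξ) (by positivity)))
        (fun m hm => (hJ C ξ m hC hm).trans (le_of_eq (by ring)))
      -- The loss (1+|η_i|)^β at each prime combines with C^(2β) into Z^β, where Z = C²∏(1+|η_i|).
      rw [prod_one_add_rpow (fun i => norm_nonneg (η i)) (fun i => -1 - (a i : ℝ) / 2)] at h1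
      simp only [Int.cast_zero, zero_div]
      refine h1.trans ?_
      set P := ∏ i, (1 + ‖η i‖) ^ (-1 - (a i : ℝ) / 2) with hP
      set Q := ∏ i, (1 + ‖η i‖) with hQ
      have hP0 : 0 ≤ P := Finset.prod_nonneg fun i _ => Real.rpow_nonneg (by positivity) _
      have hQ0 : 0 < Q := Finset.prod_pos fun i _ => by positivity
      have hX : Λ ξ * (C ^ 2 * Q) ^ β ≤ (C ^ 2 * Q) ^ (1 - ε) + (1 + |ξ|) ^ (-2 : ℝ) :=
        hZ _ ξ (by positivity)
      have hX' : (1 + |ξ|) ^ (-2 : ℝ) ≤ (C ^ 2 * Q) ^ (1 - ε) + (1 + |ξ|) ^ (-2 : ℝ) :=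
        le_add_of_nonneg_left (by positivity)
      rw [sq_abs]
      calc K₂ * (L₁ * (1 + |ξ|) ^ (-2 : ℝ) * P + L₂ * (Λ ξ * (C ^ 2) ^ β) * (Q ^ β * P))
          = K₂ * (L₁ * (1 + |ξ|) ^ (-2 : ℝ) + L₂ * (Λ ξ * (C ^ 2 * Q) ^ β)) * P := by
            rw [Real.mul_rpow (by positivity) hQ0.le]
            ring
        _ ≤ K₂ * (L₁ * ((C ^ 2 * Q) ^ (1 - ε) + (1 + |ξ|) ^ (-2 : ℝ)) +
            L₂ * ((C ^ 2 * Q) ^ (1 - ε) + (1 + |ξ|) ^ (-2 : ℝ))) * P := by gcongr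
        _ = _ := by ring
    have hpowC : ∀ {C : ℝ}, 0 < C → ∀ t : ℝ, (C ^ 2) ^ t = C ^ (2 * t) := by
      intro C hC t
      rw [Real.rpow_mul hC.le, Real.rpow_two]
    rcases le_or_gt 1 ε with h1 | h1
    -- For ε ≥ 1 the exponent b = 2(1−ε) is nonpositive, and decay of Φ at +∞ gives the estimate
    -- with limit c = 0. Here β ≤ 0 only helps integrability.
    · obtain ⟨K, -, hK⟩ := hdecay (2 * (ε - 1)) (by linarith)
      obtain ⟨K', hK'0, hK'⟩ := norm_archIntegral_sub_le hφ' hsym (c := 0)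
        (b := 2 * (1 - ε)) (K := K) (by linarith) (fun u => by
          rw [sub_zero]; exact (hK u).trans (le_of_eq (by ring_nf)))
      refine main (1 - ε) (fun i => by linarith [ha' i]) 0 K' (fun _ => 1) le_rfl hK'0
        (fun _ => zero_le_one) (fun C ξ m hC hm => ?_) (fun Z ξ _ => ?_)
      · have := hK' C ξ m hC hm
        rw [zero_mul, sub_zero] at this
        refine this.trans (le_of_eq ?_)
        rw [hpowC hC]
        ring_nf
      · rw [one_mul]
        exact le_add_of_nonneg_right (by positivity)
    have hφhat : ∀ ξ : ℝ, ‖c * ∫ x, φ' x * eInf (-(x * ξ))‖ ≤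
        ‖c‖ * K₃ * (1 + |ξ|) ^ (-2 : ℝ) := by
      intro ξ
      rw [norm_mul, mul_assoc]
      gcongr
      exact hK₃ ξ
    rcases hcase with hcase | hcase
    -- With b = 2(1−ε) the exponent β = 1 − ε is admissible, since a_i ≥ 0 leaves a_i/2 − β > −1.
    · obtain ⟨K, -, hK⟩ := hlim (2 * (1 - ε)) (by linarith) (by linarith)
      obtain ⟨K', hK'0, hK'⟩ := norm_archIntegral_sub_le hφ' hsym (by linarith) hK
      refine main (1 - ε) (fun i => ?_) (‖c‖ * K₃) K' (fun _ => 1) (by positivity) hK'0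
        (fun _ => zero_le_one) (fun C ξ m hC hm => ?_) (fun Z ξ _ => ?_)
      · have : (0 : ℝ) ≤ a i := by exact_mod_cast hcase i
        linarith
      · have h2 := hK' C ξ m hC hm
        have h3 := norm_le_norm_add_norm_sub
          (c * ∫ x, φ' x * eInf (-(x * ξ)))
          (archIntegral ((sgn : ℤ) : ℝ) φ' (fun u => Φ (Real.exp u)) 0 C ξ m)
        rw [norm_sub_rev] at h2
        refine h3.trans (add_le_add (hφhat ξ) (h2.trans (le_of_eq ?_)))
        rw [hpowC hC]
        ring_nf
      · rw [one_mul]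
        exact le_add_of_nonneg_right (by positivity)
    -- The condition ε > 1/3 is used twice: it gives b = 3(1−ε) < 2, and it gives β = 3(1−ε)/4 <
    -- 1/2, as needed when a_i = −1.
    · obtain ⟨K, -, hK⟩ := hlim (3 * (1 - ε)) (by linarith) (by linarith)
      obtain ⟨K', hK'0, hK'⟩ := norm_archIntegral_sub_le hφ' hsym (by linarith) hK
      set K₄ := K₁ + ‖c‖ * K₃ with hK₄
      have hK₄0 : 0 ≤ K₄ := by positivity
      refine main (3 / 4 * (1 - ε)) (fun i => ?_) (‖c‖ * K₃) ((K' * K₄) ^ (1 / 2 : ℝ))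
        (fun ξ => (1 + |ξ|) ^ (-(1 / 2) : ℝ)) (by positivity) (by positivity)
        (fun ξ => by positivity) (fun C ξ m hC hm => ?_) (fun Z ξ hZ => ?_)
      · linarith [ha' i]
      · have hξ : 0 < 1 + |ξ| := by positivity
        have h2 := hK' C ξ m hC hm
        have h3 := norm_le_norm_add_norm_sub
          (c * ∫ x, φ' x * eInf (-(x * ξ)))
          (archIntegral ((sgn : ℤ) : ℝ) φ' (fun u => Φ (Real.exp u)) 0 C ξ m)
        rw [norm_sub_rev] at h2
        set X := ‖c * (∫ x, φ' x * eInf (-(x * ξ))) -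
          archIntegral ((sgn : ℤ) : ℝ) φ' (fun u => Φ (Real.exp u)) 0 C ξ m‖ with hX
        have h4 : X ≤ K₄ * (1 + |ξ|) ^ (-1 : ℝ) := by
          have h5 : ‖archIntegral ((sgn : ℤ) : ℝ) φ' (fun u => Φ (Real.exp u)) 0 C ξ m‖ ≤
              K₁ * (1 + |ξ|) ^ (-1 : ℝ) := hK₁ _ ξ
          have h6 : (1 + |ξ|) ^ (-2 : ℝ) ≤ (1 + |ξ|) ^ (-1 : ℝ) :=
            Real.rpow_le_rpow_of_exponent_le (by linarith [abs_nonneg ξ]) (by norm_num)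
          calc X ≤ ‖c * ∫ x, φ' x * eInf (-(x * ξ))‖ +
                ‖archIntegral ((sgn : ℤ) : ℝ) φ' (fun u => Φ (Real.exp u)) 0 C ξ m‖ :=
                norm_sub_le _ _
            _ ≤ ‖c‖ * K₃ * (1 + |ξ|) ^ (-1 : ℝ) + K₁ * (1 + |ξ|) ^ (-1 : ℝ) :=
                add_le_add ((hφhat ξ).trans (by gcongr)) h5
            _ = _ := by rw [hK₄]; ring
        -- Geometric mean of the two bounds for `X`: it halves the power of `m` and keeps a factor
        -- (1+|ξ|)^(−1/2).
        have h7 : X ≤ (K' * K₄) ^ (1 / 2 : ℝ) * ((1 + |ξ|) ^ (-(1 / 2) : ℝ) *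
            ((C ^ 2) ^ (3 / 4 * (1 - ε)) * m ^ (-(3 / 4 * (1 - ε))))) := by
          have hX0 : 0 ≤ X := norm_nonneg _
          have h8 : X * X ≤ (K' * (C ^ (3 * (1 - ε)) * m ^ (-(3 * (1 - ε) / 2)))) *
              (K₄ * (1 + |ξ|) ^ (-1 : ℝ)) :=
            mul_le_mul h2 h4 hX0 (by positivity)
          calc X = (X * X) ^ (1 / 2 : ℝ) := by
                rw [← Real.sqrt_eq_rpow, Real.sqrt_mul_self hX0]
            _ ≤ ((K' * (C ^ (3 * (1 - ε)) * m ^ (-(3 * (1 - ε) / 2)))) *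
                (K₄ * (1 + |ξ|) ^ (-1 : ℝ))) ^ (1 / 2 : ℝ) :=
                Real.rpow_le_rpow (by positivity) h8 (by norm_num)
            _ = (K' * K₄) ^ (1 / 2 : ℝ) * (((1 + |ξ|) ^ (-1 : ℝ)) ^ (1 / 2 : ℝ) *
                ((C ^ (3 * (1 - ε))) ^ (1 / 2 : ℝ) *
                  (m ^ (-(3 * (1 - ε) / 2))) ^ (1 / 2 : ℝ))) := by
                rw [← Real.mul_rpow (by positivity) (by positivity),
                  ← Real.mul_rpow (by positivity) (by positivity),
                  ← Real.mul_rpow (by positivity) (by positivity)]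
                congr 1
                ring
            _ = _ := by
                rw [hpowC hC, ← Real.rpow_mul hξ.le, ← Real.rpow_mul hC.le, ← Real.rpow_mul hm.le]
                ring_nf
        exact h3.trans (add_le_add (hφhat ξ) h7)
      · have hξ : 0 < 1 + |ξ| := by positivity
        -- The factor (1+|ξ|)^(−1/2) is the 1/4-th power of (1+|ξ|)^(−2), and Z^β is the 3/4-th
        -- power of Z^(1−ε); this matching is what dictates b = 3(1−ε).
        have h2 := rpow_three_quarters_mul_le (u := Z ^ (1 - ε)) (w := (1 + |ξ|) ^ (-2 : ℝ))
          (by positivity) (by positivity)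
        rw [← Real.rpow_mul hZ.le, ← Real.rpow_mul hξ.le] at h2
        refine (le_of_eq ?_).trans h2
        rw [mul_comm]
        ring_nf
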